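/- Let $Q$ be a smooth finite-dimensional manifold (Hausdorff, second countable). For a smooth manifold $M$, a \emph{discretization map on $M$} is a smooth map $R=(R^1,R^2)\colon U\to M\times M$ on an open neighbourhood $U\subset TM$ of the zero section such that, for all $x\in M$, $R(x,0)=(x,x)$ and $T_{0_x}R^2_x-T_{0_x}R^1_x=\mathrm{Id}_{T_xM}$, where $R^a_x$ is the restriction of $R^a$ to $U\cap T_xM$. Let $R_d\colon U\subset TQ\to Q\times Q$ be a discretization map on $Q$. Let $\omega_Q=-d\theta_Q$ be the canonical symplectic form of $T^*Q$, let $\alpha_Q\colon TT^*Q\to T^*TQ$, $(q,p,\dot q,\dot p)\mapsto(q,\dot q,\dot p,p)$, be the canonical diffeomorphism, let $\Phi\colon T^*Q\times T^*Q\to T^*(Q\times Q)$, $(q_0,p_0;q_1,p_1)\mapsto(q_0,q_1,-p_0,p_1)$, and let $\widehat{R_d}(v,\beta)=(R_d(v),\beta\circ(T_vR_d)^{-1})$ for $v\in U$ with $T_vR_d$ invertible and $\beta\in T_v^*TQ$. Put $R_d^{T^*}=\Phi^{-1}\circ\widehat{R_d}\circ\alpha_Q$, with values in $T^*Q\times T^*Q$;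 it is defined at those $X\in TT^*Q$ for which the base point $v$ of $\alpha_Q(X)$ lies in $U$ and $T_vR_d$ is invertible. Let $L\colon TQ\to\mathbb R$ be a smooth regular Lagrangian (its Hessian along the fibres of $TQ$ is non-degenerate everywhere), let $\mathcal FL\colon TQ\to T^*Q$ be its Legendre map (fibre derivative), $\Omega_L=(\mathcal FL)^*\omega_Q$ and $E_L(v)=\langle\mathcal FL(v),v\rangle-L(v)$. Then there is a unique vector field $\Gamma_L$ on $TQ$ with $i_{\Gamma_L}\Omega_L=dE_L$ (the Euler--Lagrange equations). Consider $$R_d^L=(\mathcal FL^{-1},\mathcal FL^{-1})\circ R_d^{T^*}\circ T\mathcal FL\colon W\to TQ\times TQ ,$$ where $W\subset TTQ$ is an open neighbourhood of the zero section which $T\mathcal FL$ maps into the domain of $R_d^{T^*}$ and, near each $w\in W$ with base point $v\in TQ$, $\mathcal FL^{-1}$ is a local inverse of the local diffeomorphism $\mathcal FL$ with $\mathcal FL^{-1}(\mathcal FL(v))=v$. Such $W$ and $R_d^L$ exist, and for every choice of them the following holds. (a) $R_d^L$ defines a symplectic numerical integrator of the Euler--Lagrange equations for $L$, through the scheme $$R_d^L\bigl(h\,\Gamma_L(y)\bigr)=(x_0,x_1),\qquad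 h\,\Gamma_L(y)\in W,\qquad\text{that is, } h\,\Gamma_L\bigl(\tau_{TQ}((R_d^L)^{-1}(x_0,x_1))\bigr)=(R_d^L)^{-1}(x_0,x_1),\quad y=\tau_{TQ}((R_d^L)^{-1}(x_0,x_1)).$$ Precisely: - (integrator) for every $x\in TQ$ there are $h_0>0$ and open neighbourhoods $V,N$ of $x$ in $TQ$ such that for $|h|<h_0$ and $x_0\in V$ the scheme has exactly one solution $(x_1,y)$ with $x_1\in TQ$ and $y\in N$; it depends smoothly on $(h,x_0)$, and the one-step map $x_1=\varphi_h(x_0)$ satisfies $\varphi_0(x_0)=x_0$ and $\frac{d}{dh}\big|_{h=0}\varphi_h(x_0)=\Gamma_L(x_0)$; - (symplecticity) for every $h\in\mathbb R$, if $\varphi\colon V\to TQ$ is a smooth map on an open set $V\subset TQ$ and $Y\colon V\to TQ$ is continuous, such that $h\,\Gamma_L(Y(x_0))\in W$ and $R_d^L(h\,\Gamma_L(Y(x_0)))=(x_0,\varphi(x_0))$ for all $x_0\in V$, then $\varphi^*\Omega_L=\Omega_L$ on $V$. (b) $R_d^L\colon W\to TQ\times TQ$ is a discretization map on $TQ$.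 -/

import Mathlib

open Set Filter Topology Bundle
open scoped Manifold ContDiff

noncomputable section

namespace DiscMap

section General

variable {E : Type*} [NormedAddCommGroup E] [NormedSpace ℝ E]
  {H : Type*} [TopologicalSpace H] (I : ModelWithCorners ℝ E H)
  {M : Type*} [TopologicalSpace M] [ChartedSpace H M]

/-- A discretization map on the manifold `M`, defined on an open neighbourhood `U` of the zero
section of `TM` (the values of `R` outside `U` are irrelevant).  In `rigidity`, `R` is restricted to
the fibre `T_xM`, which in Mathlib is the model space `E`, and the derivatives are taken at `0`;
since `R (x, 0) = (x, x)`, both of them are endomorphisms of `T_xM`. -/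
structure IsDiscretizationMap [IsManifold I 1 M]
    (U : Set (TangentBundle I M)) (R : TangentBundle I M → M × M) : Prop where
  isOpen : IsOpen U
  zero_mem : ∀ x : M, (⟨x, 0⟩ : TangentBundle I M) ∈ U
  smooth : ContMDiffOn I.tangent (I.prod I) ∞ R U
  map_zero : ∀ x : M, R ⟨x, 0⟩ = (x, x)
  rigidity : ∀ (x : M) (v : E),
    let D₁ : E →L[ℝ] E := mfderiv 𝓘(ℝ, E) I (fun u : E => (R ⟨x, u⟩).1) 0
    let D₂ : E →L[ℝ] E := mfderiv 𝓘(ℝ, E) I (fun u : E => (R ⟨x, u⟩).2) 0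
    D₂ v - D₁ v = v

/-- The cotangent space `T_x^*M`. -/
abbrev CotangentSpace (x : M) : Type _ := TangentSpace I x →L[ℝ] Trivial M ℝ x

variable (M) in
/-- The cotangent bundle `T^*M`, with Mathlib's topology and smooth structure on the bundle of
continuous linear maps from `TM` to the trivial line bundle. -/
abbrev CotangentBundle : Type _ :=
  TotalSpace (E →L[ℝ] ℝ) (fun x : M => TangentSpace I x →L[ℝ] Trivial M ℝ x)

/-- The model with corners of the manifold `T^*M`. -/
abbrev cotangentModel : ModelWithCorners ℝ (E × (E →L[ℝ] ℝ)) (ModelProd H (E →L[ℝ] ℝ)) :=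
  I.prod 𝓘(ℝ, E →L[ℝ] ℝ)

/-- The exterior derivative of a differential one-form `θ` on `M`, computed at `x` in the chart of
`M` around `x`: if `θ'` is the coordinate expression of `θ` and `u'`, `v'` those of `u`, `v`, then
`dθ (u, v) = D_{u'} θ' (v') - D_{v'} θ' (u')`. -/
def extDerivOneForm (θ : ∀ x : M, TangentSpace I x →L[ℝ] ℝ) (x : M)
    (u v : TangentSpace I x) : ℝ :=
  let θ' : E → (E →L[ℝ] ℝ) := fun y =>
    (θ ((extChartAt I x).symm y)).comp
      (mfderivWithin 𝓘(ℝ, E) I (extChartAt I x).symm (range I) y)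
  let Dθ' : E →L[ℝ] E →L[ℝ] ℝ := fderivWithin ℝ θ' (range I) (extChartAt I x x)
  let u' : E := mfderiv I 𝓘(ℝ, E) (extChartAt I x) x u
  let v' : E := mfderiv I 𝓘(ℝ, E) (extChartAt I x) x v
  Dθ' u' v' - Dθ' v' u'

variable [IsManifold I ∞ M]

/-- The Liouville one-form `θ_M` on `T^*M`: `θ_M(α)(X) = α (Tπ X)`. -/
def liouvilleForm (α : CotangentBundle I M) :
    TangentSpace (cotangentModel I) α →L[ℝ] ℝ :=
  ContinuousLinearMap.comp (α.2 : TangentSpace I α.1 →L[ℝ] ℝ)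
    (mfderiv (cotangentModel I) I (TotalSpace.proj : CotangentBundle I M → M) α)

/-- The canonical symplectic form `ω_M = - dθ_M` on `T^*M`. -/
def canonicalForm (α : CotangentBundle I M) (X Y : TangentSpace (cotangentModel I) α) : ℝ :=
  - extDerivOneForm (cotangentModel I) (liouvilleForm I (M := M)) α X Y

/-- The canonical diffeomorphism `α_M : TT^*M → T^*TM`, given in canonical coordinates by
`(q, p, q̇, ṗ) ↦ (q, q̇, ṗ, p)`.  Mathlib's tangent spaces `T_α T^*M = E × E^*` and `T_v TM = E × E`
consist of the components of tangent vectors in the preferred charts of `T^*M` at `α` and of `TM` at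
`v`; for `α` and `v` over the same point `q` these are the canonical charts induced by one and the
same chart of `M` around `q`, in which `α` and `v` themselves have components `p = α.2`, `q̇ = v.2`.
The covector with components `(ṗ, p)` is `(a, b) ↦ ṗ a + p b`. -/
def tulczyjew (X : TangentBundle (cotangentModel I) (CotangentBundle I M)) :
    CotangentBundle I.tangent (TangentBundle I M) :=
  let p : E →L[ℝ] ℝ := X.proj.2
  let X' : E × (E →L[ℝ] ℝ) := X.2
  let v : TangentBundle I M := ⟨X.proj.proj, X'.1⟩
  let β : E × E →L[ℝ] ℝ :=
    X'.2.comp (ContinuousLinearMap.fst ℝ E E) + p.comp (ContinuousLinearMap.snd ℝ E E)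
  ⟨v, β⟩

/-- The cotangent lift of (the inverse of) a local diffeomorphism `F : TM → M × M`,
`(v, β) ↦ (F v, β ∘ (T_v F)⁻¹)`, meaningful where `T_v F` is invertible. -/
def cotangentLift (F : TangentBundle I M → M × M)
    (β : CotangentBundle I.tangent (TangentBundle I M)) : CotangentBundle (I.prod I) (M × M) :=
  ⟨F β.proj, ContinuousLinearMap.comp (β.2 : TangentSpace I.tangent β.proj →L[ℝ] ℝ)
    (mfderiv I.tangent (I.prod I) F β.proj).inverse⟩

/-- The diffeomorphism `Φ⁻¹ : T^*(M × M) → T^*M × T^*M`,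
`(q₀, q₁, p₀, p₁) ↦ (q₀, -p₀; q₁, p₁)`. -/
def splitCotangent (β : CotangentBundle (I.prod I) (M × M)) :
    CotangentBundle I M × CotangentBundle I M :=
  let b : E × E →L[ℝ] ℝ := β.2
  let b₀ : E →L[ℝ] ℝ := b.comp (ContinuousLinearMap.inl ℝ E E)
  let b₁ : E →L[ℝ] ℝ := b.comp (ContinuousLinearMap.inr ℝ E E)
  (⟨β.proj.1, -b₀⟩, ⟨β.proj.2, b₁⟩)

/-- The lift `R_d^{T^*} = Φ⁻¹ ∘ R̂_d ∘ α_Q : TT^*Q → T^*Q × T^*Q` of a discretization map `R_d`. -/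
def cotangentDiscretization (Rd : TangentBundle I M → M × M)
    (X : TangentBundle (cotangentModel I) (CotangentBundle I M)) :
    CotangentBundle I M × CotangentBundle I M :=
  splitCotangent I (cotangentLift I Rd (tulczyjew I X))

/-- The set of `X` in `TT^*Q` at which `R_d^{T^*}` is defined, for `R_d` with domain `U`: the base
point `v` of `α_Q X` lies in `U`, and `T_v R_d` is invertible. -/
def cotangentDiscretizationDomain (U : Set (TangentBundle I M)) (Rd : TangentBundle I M → M × M) :
    Set (TangentBundle (cotangentModel I) (CotangentBundle I M)) :=
  {X | (tulczyjew I X).proj ∈ U ∧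
    (mfderiv I.tangent (I.prod I) Rd (tulczyjew I X).proj).IsInvertible}

/-- The Legendre map (fibre derivative) `FL : TQ → T^*Q` of a Lagrangian `L : TQ → ℝ`. -/
def legendre (L : TangentBundle I M → ℝ) (v : TangentBundle I M) : CotangentBundle I M :=
  let p : E →L[ℝ] ℝ := fderiv ℝ (fun u : E => L ⟨v.proj, u⟩) v.2
  ⟨v.proj, p⟩

/-- A smooth Lagrangian is regular if its Hessian along the fibres of `TQ` is everywhere
non-degenerate. -/
structure IsRegularLagrangian (L : TangentBundle I M → ℝ) : Prop where
  smooth : ContMDiff I.tangent 𝓘(ℝ, ℝ) ∞ L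
  nondegenerate : ∀ (q : M) (v a : E),
    (∀ b : E, fderiv ℝ (fderiv ℝ (fun u : E => L ⟨q, u⟩)) v a b = 0) → a = 0

/-- The energy `E_L(v) = ⟨FL(v), v⟩ - L(v)`. -/
def energy (L : TangentBundle I M → ℝ) (v : TangentBundle I M) : ℝ :=
  (legendre I L v).2 v.2 - L v

/-- The Lagrange two-form `Ω_L = (FL)^* ω_Q` on `TQ`. -/
def lagrangeForm (L : TangentBundle I M → ℝ) (v : TangentBundle I M)
    (X Y : TangentSpace I.tangent v) : ℝ :=
  canonicalForm I (legendre I L v)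
    (mfderiv I.tangent (cotangentModel I) (legendre I L) v X)
    (mfderiv I.tangent (cotangentModel I) (legendre I L) v Y)

/-- `Γ` is the Euler-Lagrange vector field of `L`, that is, `i_Γ Ω_L = dE_L`. -/
def IsEulerLagrangeField (L : TangentBundle I M → ℝ)
    (Γ : ∀ v : TangentBundle I M, TangentSpace I.tangent v) : Prop :=
  ∀ (v : TangentBundle I M) (X : TangentSpace I.tangent v),
    lagrangeForm I L v (Γ v) X = mfderiv I.tangent 𝓘(ℝ, ℝ) (energy I L) v X

/-- `R : W → TQ × TQ` is (a realization of) the map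
`R_d^L = (FL⁻¹, FL⁻¹) ∘ R_d^{T^*} ∘ TFL` on the open neighbourhood `W` of the zero section of `TTQ`.
As `FL` is only a local diffeomorphism, `FL⁻¹` means a local inverse: near each `w ∈ W`, `R` is the
above composition for one local inverse `FL⁻¹ = σ.symm` of `FL` which takes `FL(v)` to `v`, where
`v` is the base point of `w`. -/
structure IsLagrangianLift (L : TangentBundle I M → ℝ)
    (U : Set (TangentBundle I M)) (Rd : TangentBundle I M → M × M)
    (W : Set (TangentBundle I.tangent (TangentBundle I M)))
    (R : TangentBundle I.tangent (TangentBundle I M) →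
      TangentBundle I M × TangentBundle I M) : Prop where
  isOpen : IsOpen W
  zero_mem : ∀ v : TangentBundle I M,
    (⟨v, 0⟩ : TangentBundle I.tangent (TangentBundle I M)) ∈ W
  mem_domain : ∀ w ∈ W, tangentMap I.tangent (cotangentModel I) (legendre I L) w ∈
    cotangentDiscretizationDomain I U Rd
  eq_comp : ∀ w ∈ W, ∃ σ : OpenPartialHomeomorph (TangentBundle I M) (CotangentBundle I M),
    w.proj ∈ σ.source ∧ EqOn σ (legendre I L) σ.source ∧
    ∀ᶠ w' in 𝓝 w,
      let z := cotangentDiscretization I Rd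
        (tangentMap I.tangent (cotangentModel I) (legendre I L) w')
      z.1 ∈ σ.target ∧ z.2 ∈ σ.target ∧ R w' = (σ.symm z.1, σ.symm z.2)

end General

section Integrators

variable {E : Type*} [NormedAddCommGroup E] [NormedSpace ℝ E]
  {H : Type*} [TopologicalSpace H] (I : ModelWithCorners ℝ E H)
  {M : Type*} [TopologicalSpace M] [ChartedSpace H M]

/-- `(x₀, x₁)` satisfies, with auxiliary point `y`, the numerical scheme of step size `h` defined by
a map `R : W ⊆ TM → M × M` and a vector field `Γ` on `M`:
`h Γ(τ(R⁻¹(x₀, x₁))) = R⁻¹(x₀, x₁)`, with `y = τ(R⁻¹(x₀, x₁))`; in other words,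
`R(h Γ(y)) = (x₀, x₁)`. -/
def SchemeStep (Γ : ∀ x : M, TangentSpace I x) (W : Set (TangentBundle I M))
    (R : TangentBundle I M → M × M) (h : ℝ) (x₀ x₁ y : M) : Prop :=
  (⟨y, h • Γ y⟩ : TangentBundle I M) ∈ W ∧ R ⟨y, h • Γ y⟩ = (x₀, x₁)

/-- `φ` preserves the two-form `Ω` on `V`, that is, `φ^*Ω = Ω` on `V`. -/
def PreservesForm (Ω : ∀ x : M, TangentSpace I x → TangentSpace I x → ℝ)
    (V : Set M) (φ : M → M) : Prop :=
  ∀ x ∈ V, ∀ u w : TangentSpace I x,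
    Ω (φ x) (mfderiv I I φ x u) (mfderiv I I φ x w) = Ω x u w

/-- The scheme `R(h Γ(y)) = (x₀, x₁)` defines a numerical one-step integrator of `ẋ = Γ(x)`:
around every point `x` and for small `h`, it has, for `x₀ ∈ V`, exactly one solution `(x₁, y)` with
`y` near `x`; the solution depends smoothly on `(h, x₀)`, and the one-step map `x₁ = φ_h(x₀)` is
consistent with `ẋ = Γ(x)`, that is, `φ_0(x₀) = x₀` and `(d/dh) φ_h(x₀) = Γ(x₀)` at `h = 0`. -/
def IsIntegrator [IsManifold I 1 M] (Γ : ∀ x : M, TangentSpace I x)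
    (W : Set (TangentBundle I M)) (R : TangentBundle I M → M × M) : Prop :=
  ∀ x : M, ∃ h₀ : ℝ, 0 < h₀ ∧ ∃ V N : Set M, IsOpen V ∧ x ∈ V ∧ IsOpen N ∧ x ∈ N ∧
    ∃ φ Y : ℝ → M → M,
      ContMDiffOn (𝓘(ℝ, ℝ).prod I) I ∞ (fun z : ℝ × M => φ z.1 z.2) (Ioo (-h₀) h₀ ×ˢ V) ∧
      ContMDiffOn (𝓘(ℝ, ℝ).prod I) I ∞ (fun z : ℝ × M => Y z.1 z.2) (Ioo (-h₀) h₀ ×ˢ V) ∧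
      (∀ h ∈ Ioo (-h₀) h₀, ∀ x₀ ∈ V, ∀ x₁ y : M,
        (y ∈ N ∧ SchemeStep I Γ W R h x₀ x₁ y) ↔ (x₁ = φ h x₀ ∧ y = Y h x₀)) ∧
      ∀ x₀ ∈ V, tangentMap 𝓘(ℝ, ℝ) I (fun h : ℝ => φ h x₀) ⟨0, (1 : ℝ)⟩ =
        (⟨x₀, Γ x₀⟩ : TangentBundle I M)

/-- The scheme `R(h Γ(y)) = (x₀, x₁)` is symplectic for the two-form `Ω`: for every step size `h`,
every smooth one-step map `φ` on an open set `V` given by the scheme, with the auxiliary point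
`y = Y(x₀)` depending continuously on `x₀`, preserves `Ω`. -/
def IsSymplecticScheme (Ω : ∀ x : M, TangentSpace I x → TangentSpace I x → ℝ)
    (Γ : ∀ x : M, TangentSpace I x)
    (W : Set (TangentBundle I M)) (R : TangentBundle I M → M × M) [IsManifold I 1 M] : Prop :=
  ∀ (h : ℝ) (V : Set M) (φ Y : M → M), IsOpen V → ContMDiffOn I I ∞ φ V → ContinuousOn Y V →
    (∀ x₀ ∈ V, SchemeStep I Γ W R h x₀ (φ x₀) (Y x₀)) → PreservesForm I Ω V φ

end Integrators

end DiscMap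

end

noncomputable section

namespace DiscMap

section Coordinates

variable {E : Type*} [NormedAddCommGroup E] [NormedSpace ℝ E]
  {H : Type*} [TopologicalSpace H] (I : ModelWithCorners ℝ E H)
  {M : Type*} [TopologicalSpace M] [ChartedSpace H M]
  {E' : Type*} [NormedAddCommGroup E'] [NormedSpace ℝ E']
  {H' : Type*} [TopologicalSpace H'] (I' : ModelWithCorners ℝ E' H')
  {M' : Type*} [TopologicalSpace M'] [ChartedSpace H' M']
  {E'' : Type*} [NormedAddCommGroup E''] [NormedSpace ℝ E'']
  {H'' : Type*} [TopologicalSpace H''] (I'' : ModelWithCorners ℝ E'' H'')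
  {M'' : Type*} [TopologicalSpace M''] [ChartedSpace H'' M'']

/-- The derivative of a map between manifolds, as a linear map between the model spaces. -/
def modelDeriv (f : M → M') (x : M) : E →L[ℝ] E' := mfderiv I I' f x

variable {I I' I''}

lemma modelDeriv_comp {g : M' → M''} {f : M → M'} {x : M} (hg : MDifferentiableAt I' I'' g (f x))
    (hf : MDifferentiableAt I I' f x) :
    modelDeriv I I'' (g ∘ f) x = (modelDeriv I' I'' g (f x)).comp (modelDeriv I I' f x) :=
  mfderiv_comp x hg hf

lemma modelDeriv_comp_of_eq {g : M' → M''} {f : M → M'} {x : M} {y : M'}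
    (hg : MDifferentiableAt I' I'' g y) (hf : MDifferentiableAt I I' f x) (hy : f x = y) :
    modelDeriv I I'' (g ∘ f) x = (modelDeriv I' I'' g y).comp (modelDeriv I I' f x) := by
  subst hy
  exact modelDeriv_comp hg hf

lemma modelDeriv_congr {f g : M → M'} {x : M} (h : f =ᶠ[𝓝 x] g) :
    modelDeriv I I' f x = modelDeriv I I' g x := h.mfderiv_eq

lemma modelDeriv_eq_fderiv (f : E → E') (x : E) :
    modelDeriv 𝓘(ℝ, E) 𝓘(ℝ, E') f x = fderiv ℝ f x := mfderiv_eq_fderiv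

lemma modelDeriv_id (x : M) : modelDeriv I I (id : M → M) x = ContinuousLinearMap.id ℝ E :=
  mfderiv_id

lemma modelDeriv_const (c : M') (x : M) : modelDeriv I I' (fun _ : M => c) x = 0 :=
  mfderiv_const

lemma modelDeriv_prodMk {f : M → M'} {g : M → M''} {x : M} (hf : MDifferentiableAt I I' f x)
    (hg : MDifferentiableAt I I'' g x) :
    modelDeriv I (I'.prod I'') (fun y => (f y, g y)) x
      = (modelDeriv I I' f x).prod (modelDeriv I I'' g x) :=
  hf.mfderiv_prod hg

lemma modelDeriv_fst_comp {f : M → M' × M''} {x : M}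
    (hf : MDifferentiableAt I (I'.prod I'') f x) :
    modelDeriv I I' (fun y => (f y).1) x
      = (ContinuousLinearMap.fst ℝ E' E'').comp (modelDeriv I (I'.prod I'') f x) := by
  have h := (hasMFDerivAt_fst (I := I') (I' := I'') (f x)).comp x hf.hasMFDerivAt
  exact h.mfderiv

lemma modelDeriv_snd_comp {f : M → M' × M''} {x : M}
    (hf : MDifferentiableAt I (I'.prod I'') f x) :
    modelDeriv I I'' (fun y => (f y).2) x
      = (ContinuousLinearMap.snd ℝ E' E'').comp (modelDeriv I (I'.prod I'') f x) := by
  have h := (hasMFDerivAt_snd (I := I') (I' := I'') (f x)).comp x hf.hasMFDerivAt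
  exact h.mfderiv

section Change

variable (I) [IsManifold I 1 M]

/-- The components in the chart around `q₀` of tangent vectors at `q`. -/
def toChart (q₀ q : M) : E →L[ℝ] E := tangentCoordChange I q q₀ q

/-- The tangent vectors at `q` with given components in the chart around `q₀`. -/
def ofChart (q₀ q : M) : E →L[ℝ] E := tangentCoordChange I q₀ q q

variable {I}

lemma toChart_comp_ofChart {q₀ q : M} (h : q ∈ (chartAt H q₀).source) :
    (toChart I q₀ q).comp (ofChart I q₀ q) = ContinuousLinearMap.id ℝ E := by
  ext v
  have h' : q ∈ (extChartAt I q₀).source := by rwa [extChartAt_source]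
  exact (tangentCoordChange_comp ⟨⟨h', mem_extChartAt_source q⟩, h'⟩).trans
    (tangentCoordChange_self h')

lemma ofChart_comp_toChart {q₀ q : M} (h : q ∈ (chartAt H q₀).source) :
    (ofChart I q₀ q).comp (toChart I q₀ q) = ContinuousLinearMap.id ℝ E := by
  ext v
  have h' : q ∈ (extChartAt I q₀).source := by rwa [extChartAt_source]
  exact (tangentCoordChange_comp ⟨⟨mem_extChartAt_source q, h'⟩, mem_extChartAt_source q⟩).trans
    (tangentCoordChange_self (mem_extChartAt_source q))

@[simp] lemma toChart_ofChart {q₀ q : M} (h : q ∈ (chartAt H q₀).source) (v : E) :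
    toChart I q₀ q (ofChart I q₀ q v) = v :=
  DFunLike.congr_fun (toChart_comp_ofChart h) v

@[simp] lemma ofChart_toChart {q₀ q : M} (h : q ∈ (chartAt H q₀).source) (v : E) :
    ofChart I q₀ q (toChart I q₀ q v) = v :=
  DFunLike.congr_fun (ofChart_comp_toChart h) v

@[simp] lemma toChart_self (q : M) : toChart I q q = ContinuousLinearMap.id ℝ E := by
  ext v
  exact tangentCoordChange_self (mem_extChartAt_source q)

@[simp] lemma ofChart_self (q : M) : ofChart I q q = ContinuousLinearMap.id ℝ E := by
  ext v
  exact tangentCoordChange_self (mem_extChartAt_source q)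

lemma isInvertible_toChart {q₀ q : M} (h : q ∈ (chartAt H q₀).source) :
    (toChart I q₀ q).IsInvertible :=
  .of_inverse (toChart_comp_ofChart h) (ofChart_comp_toChart h)

lemma isInvertible_ofChart {q₀ q : M} (h : q ∈ (chartAt H q₀).source) :
    (ofChart I q₀ q).IsInvertible :=
  .of_inverse (ofChart_comp_toChart h) (toChart_comp_ofChart h)

lemma modelDeriv_extChartAt {q₀ q : M} (h : q ∈ (chartAt H q₀).source) :
    modelDeriv I 𝓘(ℝ, E) (extChartAt I q₀) q = toChart I q₀ q :=
  (TangentBundle.continuousLinearMapAt_trivializationAt h).symm.trans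
    (TangentBundle.continuousLinearMapAt_trivializationAt_eq_core h)

variable [I.Boundaryless]

lemma mdifferentiableAt_extChartAt_symm {q₀ : M} {y : E} (h : y ∈ (extChartAt I q₀).target) :
    MDifferentiableAt 𝓘(ℝ, E) I (extChartAt I q₀).symm y := by
  have := mdifferentiableWithinAt_extChartAt_symm (I := I) h
  rwa [I.range_eq_univ, mdifferentiableWithinAt_univ] at this

lemma modelDeriv_extChartAt_symm' {q₀ q : M} (h : q ∈ (chartAt H q₀).source) :
    modelDeriv 𝓘(ℝ, E) I (extChartAt I q₀).symm (extChartAt I q₀ q) = ofChart I q₀ q := by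
  have h1 := (TangentBundle.symmL_trivializationAt (I := I) h).symm.trans
    (TangentBundle.symmL_trivializationAt_eq_core h)
  rw [I.range_eq_univ, mfderivWithin_univ] at h1
  exact h1

end Change

section Rep

variable [IsManifold I 1 M] [IsManifold I' 1 M'] [I.Boundaryless]

lemma toChart_comp_modelDeriv {f : M → M'} {q₀ q : M} {r₀ : M'}
    (hf : MDifferentiableAt I I' f q) (hq : q ∈ (chartAt H q₀).source)
    (hr : f q ∈ (chartAt H' r₀).source) :
    fderiv ℝ (extChartAt I' r₀ ∘ f ∘ (extChartAt I q₀).symm) (extChartAt I q₀ q)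
      = (toChart I' r₀ (f q)).comp ((modelDeriv I I' f q).comp (ofChart I q₀ q)) := by
  have hq' : q ∈ (extChartAt I q₀).source := by rwa [extChartAt_source]
  rw [← modelDeriv_eq_fderiv, modelDeriv_comp_of_eq (I' := I') (y := f q)
    (mdifferentiableAt_extChartAt hr), modelDeriv_comp_of_eq (I' := I) (y := q) hf,
    modelDeriv_extChartAt hr, modelDeriv_extChartAt_symm' hq]
  · exact mdifferentiableAt_extChartAt_symm ((extChartAt I q₀).map_source hq')
  · exact (extChartAt I q₀).left_inv hq'
  · exact MDifferentiableAt.comp_of_eq (I' := I) _ hf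
      (mdifferentiableAt_extChartAt_symm ((extChartAt I q₀).map_source hq'))
      ((extChartAt I q₀).left_inv hq')
  · exact congrArg f ((extChartAt I q₀).left_inv hq')

lemma modelDeriv_eq_ofChart_comp {f : M → M'} {q₀ q : M} {r₀ : M'}
    (hf : MDifferentiableAt I I' f q) (hq : q ∈ (chartAt H q₀).source)
    (hr : f q ∈ (chartAt H' r₀).source) :
    modelDeriv I I' f q = (ofChart I' r₀ (f q)).comp
      ((fderiv ℝ (extChartAt I' r₀ ∘ f ∘ (extChartAt I q₀).symm) (extChartAt I q₀ q)).comp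
        (toChart I q₀ q)) := by
  rw [toChart_comp_modelDeriv hf hq hr]
  ext v
  simp [ofChart_toChart hq, ofChart_toChart hr]

lemma isInvertible_modelDeriv_iff {f : M → M'} {q₀ q : M} {r₀ : M'}
    (hf : MDifferentiableAt I I' f q) (hq : q ∈ (chartAt H q₀).source)
    (hr : f q ∈ (chartAt H' r₀).source) :
    (modelDeriv I I' f q).IsInvertible ↔
      (fderiv ℝ (extChartAt I' r₀ ∘ f ∘ (extChartAt I q₀).symm)
        (extChartAt I q₀ q)).IsInvertible := by
  constructor
  · intro h
    rw [toChart_comp_modelDeriv hf hq hr]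
    exact (isInvertible_toChart hr).comp (h.comp (isInvertible_ofChart hq))
  · intro h
    rw [modelDeriv_eq_ofChart_comp hf hq hr]
    exact (isInvertible_ofChart hr).comp (h.comp (isInvertible_toChart hq))

end Rep

end Coordinates

section InverseFunction

variable {E : Type*} [NormedAddCommGroup E] [NormedSpace ℝ E]
  {H : Type*} [TopologicalSpace H] {I : ModelWithCorners ℝ E H}
  {M : Type*} [TopologicalSpace M] [ChartedSpace H M]
  {E' : Type*} [NormedAddCommGroup E'] [NormedSpace ℝ E']
  {H' : Type*} [TopologicalSpace H'] {I' : ModelWithCorners ℝ E' H'}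
  {M' : Type*} [TopologicalSpace M'] [ChartedSpace H' M']
  [I.Boundaryless]

lemma contDiffAt_writtenInCharts {n : ℕ∞} [IsManifold I n M] [IsManifold I' n M'] {f : M → M'}
    {q₀ q : M} {r₀ : M'} (hf : ContMDiffAt I I' n f q) (hq : q ∈ (chartAt H q₀).source)
    (hr : f q ∈ (chartAt H' r₀).source) :
    ContDiffAt ℝ n (extChartAt I' r₀ ∘ f ∘ (extChartAt I q₀).symm) (extChartAt I q₀ q) := by
  have h := ((contMDiffAt_iff_of_mem_source hq hr).1 hf).2
  rwa [I.range_eq_univ, contDiffWithinAt_univ] at h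

lemma eventually_isInvertible [CompleteSpace E] {X : Type*} [TopologicalSpace X]
    {A : X → E →L[ℝ] E'} {x : X}
    (hA : ContinuousAt A x) (h : (A x).IsInvertible) : ∀ᶠ y in 𝓝 x, (A y).IsInvertible := by
  obtain ⟨e, he⟩ := h
  have h1 := ContinuousLinearEquiv.nhds e
  rw [he] at h1
  filter_upwards [hA h1] with y hy using hy

variable [IsManifold I ∞ M] [IsManifold I' ∞ M']

lemma eventually_isInvertible_modelDeriv [CompleteSpace E] {f : M → M'} {x : M}
    (hf : ContMDiffAt I I' 1 f x) (h : (modelDeriv I I' f x).IsInvertible) :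
    ∀ᶠ y in 𝓝 x, (modelDeriv I I' f y).IsInvertible := by
  have h1 := contDiffAt_writtenInCharts (n := 1) hf (mem_chart_source H x) (mem_chart_source H' _)
  have h2 : ContinuousAt (fderiv ℝ (extChartAt I' (f x) ∘ f ∘ (extChartAt I x).symm))
      (extChartAt I x x) := (h1.fderiv_right (m := 0) (by norm_num)).continuousAt
  rw [isInvertible_modelDeriv_iff (hf.mdifferentiableAt one_ne_zero) (mem_chart_source H x)
    (mem_chart_source H' _)] at h
  have h3 := eventually_isInvertible (h2.comp (continuousAt_extChartAt x)) h
  have h4 : ∀ᶠ y in 𝓝 x, ContMDiffAt I I' 1 f y :=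
    (contMDiffAt_iff_contMDiffAt_nhds (n := 1) (by simp)).1 hf
  filter_upwards [h3, h4, (chartAt H x).open_source.mem_nhds (mem_chart_source H x),
    hf.continuousAt ((chartAt H' (f x)).open_source.mem_nhds (mem_chart_source H' _))]
    with y hy hy4 hy1 hy2
  exact (isInvertible_modelDeriv_iff (hy4.mdifferentiableAt one_ne_zero) hy1 hy2).2 hy

/-- The extended chart of a manifold without boundary, as an open partial homeomorphism. -/
def openExtChartAt (I : ModelWithCorners ℝ E H) [I.Boundaryless] (x : M) :
    OpenPartialHomeomorph M E :=
  (chartAt H x).trans I.toHomeomorph.toOpenPartialHomeomorph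

omit [IsManifold I ∞ M] in
lemma openExtChartAt_source (x : M) : (openExtChartAt I x).source = (chartAt H x).source := by
  simp [openExtChartAt]

/-- The inverse function theorem for smooth maps between manifolds without boundary. -/
theorem exists_localInverse [CompleteSpace E] [I'.Boundaryless] {f : M → M'} {s : Set M} {x : M}
    (hs : IsOpen s) (hx : x ∈ s) (hf : ContMDiffOn I I' ∞ f s)
    (h : (modelDeriv I I' f x).IsInvertible) :
    ∃ σ : OpenPartialHomeomorph M M', x ∈ σ.source ∧ σ.source ⊆ s ∧ EqOn σ f σ.source ∧
      ContMDiffOn I' I ∞ σ.symm σ.target := by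
  set c := openExtChartAt I x with hc
  set c' := openExtChartAt I' (f x) with hc'
  have hcs : c.source = (chartAt H x).source := openExtChartAt_source x
  have hcs' : c'.source = (chartAt H' (f x)).source := openExtChartAt_source _
  have hxc : x ∈ c.source := hcs ▸ mem_chart_source H x
  have hxc' : f x ∈ c'.source := hcs' ▸ mem_chart_source H' _
  have hfs : ∀ y ∈ s, ContMDiffAt I I' ∞ f y := fun y hy => hf.contMDiffAt (hs.mem_nhds hy)
  set F : E → E' := c' ∘ f ∘ c.symm with hF
  have hF1 : ContDiffAt ℝ ∞ F (c x) := contDiffAt_writtenInCharts (n := ⊤) (hfs x hx)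
    (mem_chart_source H x) (mem_chart_source H' _)
  have hi := (isInvertible_modelDeriv_iff ((hfs x hx).mdifferentiableAt (by simp))
    (mem_chart_source H x) (mem_chart_source H' _)).1 h
  obtain ⟨e, he⟩ := hi
  have hFd : HasFDerivAt F (e : E →L[ℝ] E') (c x) := by
    rw [he]; exact (hF1.differentiableAt (by simp)).hasFDerivAt
  set τ := hF1.toOpenPartialHomeomorph F hFd (by simp) with hτ
  have hτF : ⇑τ = F := rfl
  have hτx : c x ∈ τ.source := hF1.mem_toOpenPartialHomeomorph_source hFd (by simp)
  obtain ⟨t, ht, hto, hxt⟩ := eventually_nhds_iff.1 ((eventually_isInvertible_modelDeriv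
    ((hfs x hx).of_le (by simp)) h).and ((hs.eventually_mem hx).and
    ((hfs x hx).continuousAt.eventually (c'.open_source.eventually_mem hxc'))))
  set O : Set E := c.target ∩ c.symm ⁻¹' t with hO
  have hOo : IsOpen O := c.isOpen_inter_preimage_symm hto
  have hxO : c x ∈ O := ⟨c.map_source hxc, by simpa [c.left_inv hxc] using hxt⟩
  set τ' := τ.restrOpen O hOo with hτ'
  have hτF' : ⇑τ' = F := rfl
  refine ⟨(c.trans τ').trans c'.symm, ?_, ?_, ?_, ?_⟩
  · simp only [OpenPartialHomeomorph.trans_source, mem_inter_iff, mem_preimage,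
      OpenPartialHomeomorph.symm_source, OpenPartialHomeomorph.coe_trans, Function.comp_apply]
    refine ⟨⟨hxc, ⟨hτx, hxO⟩⟩, ?_⟩
    rw [hτF', hF]
    simpa [c.left_inv hxc] using c'.map_source hxc'
  · rintro y ⟨⟨hy1, hy2⟩, -⟩
    have := hy2.2.2
    change c.symm (c y) ∈ t at this
    rw [c.left_inv hy1] at this
    exact (ht y this).2.1
  · rintro y ⟨⟨hy1, hy2⟩, -⟩
    have := hy2.2.2
    change c.symm (c y) ∈ t at this
    rw [c.left_inv hy1] at this
    simp only [OpenPartialHomeomorph.coe_trans, Function.comp_apply, hτF', hF, c.left_inv hy1]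
    exact c'.left_inv (ht y this).2.2
  · intro y hy
    apply ContMDiffAt.contMDiffWithinAt
    have hyc : y ∈ c'.source := by
      have := hy.1
      simpa using this
    have hyτ : c' y ∈ τ'.target := by
      have := hy.2
      simp only [OpenPartialHomeomorph.trans_target, mem_preimage, mem_inter_iff] at this
      exact this.1
    have hyt : τ'.symm (c' y) ∈ O := (τ'.map_target hyτ).2
    have hk := ht _ hyt.2
    set k := c.symm (τ'.symm (c' y)) with hkdef
    have hkc : k ∈ c.source := c.map_target hyt.1
    have hck : c k = τ'.symm (c' y) := c.right_inv hyt.1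
    have hFk : ContDiffAt ℝ ∞ F (c k) := contDiffAt_writtenInCharts (n := ⊤) (hfs k hk.2.1)
      (hcs ▸ hkc) (hcs' ▸ hk.2.2)
    obtain ⟨e', he'⟩ := (isInvertible_modelDeriv_iff ((hfs k hk.2.1).mdifferentiableAt (by simp))
      (hcs ▸ hkc : k ∈ (chartAt H x).source)
      (hcs' ▸ hk.2.2 : f k ∈ (chartAt H' (f x)).source)).1 hk.1
    have hd : HasFDerivAt F (e' : E →L[ℝ] E') (c k) := by
      rw [he']; exact (hFk.differentiableAt (by simp)).hasFDerivAt
    rw [hck] at hd hFk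
    have hsymm : ContDiffAt ℝ ∞ τ'.symm (c' y) := τ'.contDiffAt_symm hyτ hd hFk
    have h1 : ContMDiffAt 𝓘(ℝ, E) I ∞ c.symm (τ'.symm (c' y)) := by
      refine (contMDiffOn_extChartAt_symm (n := ∞) (I := I) x).contMDiffAt ?_
      refine (isOpen_extChartAt_target x).mem_nhds ?_
      rw [← hck]
      exact (extChartAt I x).map_source (by rw [extChartAt_source]; exact hcs ▸ hkc)
    have h2 : ContMDiffAt I' 𝓘(ℝ, E') ∞ c' y :=
      contMDiffAt_extChartAt' (hcs' ▸ hyc : y ∈ (chartAt H' (f x)).source)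
    have h3 : ContMDiffAt I' I ∞ (c.symm ∘ (τ'.symm ∘ c')) y :=
      ContMDiffAt.comp (I' := 𝓘(ℝ, E)) y h1
        (ContMDiffAt.comp (I' := 𝓘(ℝ, E')) y hsymm.contMDiffAt h2)
    exact h3

end InverseFunction

section BundleCharts

variable {E : Type*} [NormedAddCommGroup E] [NormedSpace ℝ E]
  {H : Type*} [TopologicalSpace H] {I : ModelWithCorners ℝ E H}
  {M : Type*} [TopologicalSpace M] [ChartedSpace H M]

/-- The components of a covector in the preferred chart at its base point. -/
def covec (α : CotangentBundle I M) : E →L[ℝ] ℝ := α.2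

/-- The components of a tangent vector in the preferred chart at its base point. -/
def vec (v : TangentBundle I M) : E := v.2

variable [IsManifold I ∞ M]

lemma extChartAt_tangentBundle (v₀ v : TangentBundle I M) :
    extChartAt I.tangent v₀ v =
      (extChartAt I v₀.proj v.proj, toChart I v₀.proj v.proj (vec v)) := rfl

lemma mem_chart_tangentBundle {v₀ v : TangentBundle I M} :
    v ∈ (chartAt (ModelProd H E) v₀).source ↔ v.proj ∈ (chartAt H v₀.proj).source :=
  TangentBundle.mem_chart_source_iff v v₀

lemma extChartAt_tangentBundle_symm (v₀ : TangentBundle I M) (y : E × E) :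
    (extChartAt I.tangent v₀).symm y = ⟨(extChartAt I v₀.proj).symm y.1,
      ofChart I v₀.proj ((extChartAt I v₀.proj).symm y.1) y.2⟩ := rfl

lemma extChartAt_cotangentBundle {α₀ α : CotangentBundle I M}
    (h : α.proj ∈ (chartAt H α₀.proj).source) :
    extChartAt (cotangentModel I) α₀ α =
      (extChartAt I α₀.proj α.proj, (covec α).comp (ofChart I α₀.proj α.proj)) := by
  have h1 := hom_trivializationAt_apply (RingHom.id ℝ) (F₁ := E) (E₁ := TangentSpace I (M := M))
    (F₂ := ℝ) (E₂ := Trivial M ℝ) α₀.proj α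
  have h3 := TangentBundle.symmL_trivializationAt_eq_core (I := I) h
  have h2 : extChartAt (cotangentModel I) α₀ α = (extChartAt I α₀.proj α.proj,
    (trivializationAt (E →L[ℝ] ℝ) (fun x : M => TangentSpace I x →L[ℝ] Trivial M ℝ x)
      α₀.proj α).2) := rfl
  rw [h2, h1]
  refine Prod.ext rfl ?_
  ext w
  change (Trivial.trivialization M ℝ).linearMapAt ℝ α.proj (α.2
    ((trivializationAt E (TangentSpace I) α₀.proj).symmL ℝ α.proj w)) = _
  rw [h3, Trivial.linearMapAt_trivialization]
  rfl

lemma mem_chart_cotangentBundle {α₀ α : CotangentBundle I M} :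
    α ∈ (chartAt (ModelProd H (E →L[ℝ] ℝ)) α₀).source ↔
      α.proj ∈ (chartAt H α₀.proj).source := by
  simp only [FiberBundle.chartedSpace_chartAt, mfld_simps]
  exact ⟨fun h => h.2, fun h => ⟨⟨h, mem_univ _⟩, h⟩⟩

lemma contMDiffAt_cotangentBundle {n : WithTop ℕ∞} {F : Type*} [NormedAddCommGroup F]
    [NormedSpace ℝ F] {G : Type*} [TopologicalSpace G] {J : ModelWithCorners ℝ F G}
    {N : Type*} [TopologicalSpace N] [ChartedSpace G N]
    {f : N → CotangentBundle I M} {x₀ : N} :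
    ContMDiffAt J (cotangentModel I) n f x₀ ↔ ContMDiffAt J I n (fun x => (f x).proj) x₀ ∧
      ContMDiffAt J 𝓘(ℝ, E →L[ℝ] ℝ) n
        (fun x => (covec (f x)).comp (ofChart I (f x₀).proj (f x).proj)) x₀ := by
  rw [Bundle.contMDiffAt_totalSpace]
  refine and_congr_right fun h => ?_
  suffices h' : (fun x => (trivializationAt (E →L[ℝ] ℝ)
      (fun x : M => TangentSpace I x →L[ℝ] Trivial M ℝ x) (f x₀).proj (f x)).2) =ᶠ[𝓝 x₀]
        fun x => (covec (f x)).comp (ofChart I (f x₀).proj (f x).proj) from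
    ⟨fun h => h.congr_of_eventuallyEq h'.symm, fun h => h.congr_of_eventuallyEq h'⟩
  filter_upwards [h.continuousAt ((chartAt H (f x₀).proj).open_source.mem_nhds
    (mem_chart_source H _))] with x hx
  exact congrArg Prod.snd (extChartAt_cotangentBundle hx)

lemma contMDiffAt_tangentBundle {n : WithTop ℕ∞} {F : Type*} [NormedAddCommGroup F]
    [NormedSpace ℝ F] {G : Type*} [TopologicalSpace G] {J : ModelWithCorners ℝ F G}
    {N : Type*} [TopologicalSpace N] [ChartedSpace G N]
    {f : N → TangentBundle I M} {x₀ : N} :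
    ContMDiffAt J I.tangent n f x₀ ↔ ContMDiffAt J I n (fun x => (f x).proj) x₀ ∧
      ContMDiffAt J 𝓘(ℝ, E) n
        (fun x => toChart I (f x₀).proj (f x).proj (vec (f x))) x₀ :=
  Bundle.contMDiffAt_totalSpace

variable [I.Boundaryless]

set_option synthInstance.maxHeartbeats 200000 in
/-- The canonical two-form in canonical coordinates. -/
theorem canonicalForm_apply (α : CotangentBundle I M) (X Y : E × (E →L[ℝ] ℝ)) :
    canonicalForm I α X Y = Y.2 X.1 - X.2 Y.1 := by
  set c := extChartAt (cotangentModel I) α with hc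
  set θ' : E × (E →L[ℝ] ℝ) → (E × (E →L[ℝ] ℝ)) →L[ℝ] ℝ := fun y =>
    (liouvilleForm I (M := M) (c.symm y)).comp
      (mfderivWithin 𝓘(ℝ, E × (E →L[ℝ] ℝ)) (cotangentModel I) c.symm (range (cotangentModel I)) y)
    with hθ
  have key : θ' =ᶠ[𝓝 (c α)] fun y => y.2.comp (ContinuousLinearMap.fst ℝ E (E →L[ℝ] ℝ)) := by
    filter_upwards [extChartAt_target_mem_nhds (I := cotangentModel I) α] with y hy
    have hy' : (c.symm y) ∈ (chartAt (ModelProd H (E →L[ℝ] ℝ)) α).source := by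
      rw [← extChartAt_source (cotangentModel I)]; exact c.map_target hy
    have hb := mem_chart_cotangentBundle.1 hy'
    have h1 : (mfderivWithin 𝓘(ℝ, E × (E →L[ℝ] ℝ)) (cotangentModel I) c.symm
        (range (cotangentModel I)) y) = modelDeriv 𝓘(ℝ, E × (E →L[ℝ] ℝ)) (cotangentModel I)
          c.symm y := by
      rw [ModelWithCorners.range_eq_univ, mfderivWithin_univ]; rfl
    have h2 : θ' y = (covec (c.symm y)).comp ((modelDeriv (cotangentModel I) I
        (TotalSpace.proj : CotangentBundle I M → M) (c.symm y)).comp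
          (modelDeriv 𝓘(ℝ, E × (E →L[ℝ] ℝ)) (cotangentModel I) c.symm y)) := by
      rw [← h1]; rfl
    have hd : MDifferentiableAt (cotangentModel I) I
        (TotalSpace.proj : CotangentBundle I M → M) (c.symm y) :=
      (contMDiffAt_proj (n := 1) _).mdifferentiableAt one_ne_zero
    rw [← modelDeriv_comp hd (mdifferentiableAt_extChartAt_symm hy)] at h2
    have h3 : (TotalSpace.proj : CotangentBundle I M → M) ∘ c.symm =ᶠ[𝓝 y]
        (extChartAt I α.proj).symm ∘ Prod.fst := by
      filter_upwards [(isOpen_extChartAt_target α).mem_nhds hy] with z hz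
      have e1 : extChartAt I α.proj (c.symm z).proj = z.1 :=
        congrArg Prod.fst (c.right_inv hz)
      have e2 := c.map_target hz
      rw [extChartAt_source] at e2
      simp only [Function.comp_apply]
      rw [← e1, (extChartAt I α.proj).left_inv]
      rw [extChartAt_source]
      exact mem_chart_cotangentBundle.1 e2
    have e1 : extChartAt I α.proj (c.symm y).proj = y.1 := congrArg Prod.fst (c.right_inv hy)
    have hy1 : y.1 ∈ (extChartAt I α.proj).target := by
      rw [← e1]; exact (extChartAt I α.proj).map_source (by rwa [extChartAt_source])
    rw [modelDeriv_congr h3, modelDeriv_comp (I' := 𝓘(ℝ, E))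
      (mdifferentiableAt_extChartAt_symm hy1) (differentiableAt_fst.mdifferentiableAt),
      modelDeriv_eq_fderiv, fderiv_fst, ← e1, modelDeriv_extChartAt_symm' hb] at h2
    rw [h2, ← ContinuousLinearMap.comp_assoc]
    have h4 := congrArg Prod.snd ((extChartAt_cotangentBundle hb).symm.trans (c.right_inv hy))
    simp only at h4
    rw [h4]
  have hd := (hasFDerivAt_snd (𝕜 := ℝ) (p := c α)).clm_comp
    (hasFDerivAt_const (ContinuousLinearMap.fst ℝ E (E →L[ℝ] ℝ)) (c α))
  have hD : ∀ Z Z' : E × (E →L[ℝ] ℝ),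
      fderivWithin ℝ θ' (range (cotangentModel I)) (c α) Z Z' = Z.2 Z'.1 := by
    intro Z Z'
    rw [ModelWithCorners.range_eq_univ, fderivWithin_univ, (hd.congr_of_eventuallyEq key).fderiv]
    simp
  have hid : ∀ Z : E × (E →L[ℝ] ℝ),
      modelDeriv (cotangentModel I) 𝓘(ℝ, E × (E →L[ℝ] ℝ)) c α Z = Z := by
    intro Z
    rw [modelDeriv_extChartAt (mem_chart_source _ α), toChart_self]; rfl
  have : canonicalForm I α X Y =
      -(fderivWithin ℝ θ' (range (cotangentModel I)) (c α)
          (modelDeriv (cotangentModel I) 𝓘(ℝ, E × (E →L[ℝ] ℝ)) c α X)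
          (modelDeriv (cotangentModel I) 𝓘(ℝ, E × (E →L[ℝ] ℝ)) c α Y) -
        fderivWithin ℝ θ' (range (cotangentModel I)) (c α)
          (modelDeriv (cotangentModel I) 𝓘(ℝ, E × (E →L[ℝ] ℝ)) c α Y)
          (modelDeriv (cotangentModel I) 𝓘(ℝ, E × (E →L[ℝ] ℝ)) c α X)) := rfl
  rw [this, hid, hid, hD, hD]
  ring

/-- The pullback of the Liouville form under `g`. -/
def pulledLiouville {F : Type*} [NormedAddCommGroup F] [NormedSpace ℝ F]
    (g : F → CotangentBundle I M) (y : F) : F →L[ℝ] ℝ :=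
  (covec (g y)).comp (modelDeriv 𝓘(ℝ, F) I (fun z => (g z).proj) y)

theorem canonicalForm_pullback {F : Type*} [NormedAddCommGroup F] [NormedSpace ℝ F]
    {g : F → CotangentBundle I M} {y₀ : F}
    (hg : ContMDiffAt 𝓘(ℝ, F) (cotangentModel I) ∞ g y₀) :
    DifferentiableAt ℝ (pulledLiouville g) y₀ ∧ ∀ u w : F,
      canonicalForm I (g y₀) (modelDeriv 𝓘(ℝ, F) (cotangentModel I) g y₀ u)
        (modelDeriv 𝓘(ℝ, F) (cotangentModel I) g y₀ w)
      = fderiv ℝ (pulledLiouville g) y₀ w u - fderiv ℝ (pulledLiouville g) y₀ u w := by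
  set G : F → E × (E →L[ℝ] ℝ) := fun y => extChartAt (cotangentModel I) (g y₀) (g y) with hG
  have hGs : ContDiffAt ℝ ∞ G y₀ :=
    contDiffAt_writtenInCharts (n := ⊤) (I := 𝓘(ℝ, F)) (q₀ := y₀) hg (mem_chart_source _ y₀)
      (mem_chart_source _ (g y₀))
  have hDG : modelDeriv 𝓘(ℝ, F) (cotangentModel I) g y₀ = fderiv ℝ G y₀ := by
    have := toChart_comp_modelDeriv (hg.mdifferentiableAt (by simp)) (mem_chart_source _ y₀)
      (mem_chart_source _ (g y₀))
    rw [toChart_self, ofChart_self, ContinuousLinearMap.comp_id,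
      ContinuousLinearMap.id_comp] at this
    rw [← this]
    rfl
  set G₁ : F → E := fun y => (G y).1 with hG₁
  have hG₁s : ContDiffAt ℝ ∞ G₁ y₀ := contDiffAt_fst.comp y₀ hGs
  have hG₂s : ContDiffAt ℝ ∞ (fun y => (G y).2) y₀ := contDiffAt_snd.comp y₀ hGs
  have key : pulledLiouville g =ᶠ[𝓝 y₀] fun y => (G y).2.comp (fderiv ℝ G₁ y) := by
    have hev : ∀ᶠ y in 𝓝 y₀, ContMDiffAt 𝓘(ℝ, F) (cotangentModel I) 1 g y :=
      (contMDiffAt_iff_contMDiffAt_nhds (n := 1) (by simp)).1 (hg.of_le (by simp))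
    filter_upwards [hev, hg.continuousAt ((chartAt (ModelProd H (E →L[ℝ] ℝ)) (g y₀)).open_source.mem_nhds
      (mem_chart_source _ (g y₀)))] with y hy hys
    have hb := mem_chart_cotangentBundle.1 hys
    have hpr : ContMDiffAt (cotangentModel I) I 1
        (TotalSpace.proj : CotangentBundle I M → M) (g y) := contMDiffAt_proj _
    have hp : MDifferentiableAt 𝓘(ℝ, F) I (fun z => (g z).proj) y :=
      (hpr.comp y hy).mdifferentiableAt one_ne_zero
    have h1 := modelDeriv_eq_ofChart_comp hp (mem_chart_source _ y) hb
    rw [toChart_self, ContinuousLinearMap.comp_id] at h1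
    rw [pulledLiouville, h1, ← ContinuousLinearMap.comp_assoc]
    have h2 : (G y).2 = (covec (g y)).comp (ofChart I (g y₀).proj (g y).proj) :=
      congrArg Prod.snd (extChartAt_cotangentBundle hb)
    rw [h2]
    rfl
  have hd1 : HasFDerivAt (fun y => (G y).2) (fderiv ℝ (fun y => (G y).2) y₀) y₀ :=
    (hG₂s.differentiableAt (by simp)).hasFDerivAt
  have hd2 : HasFDerivAt (fderiv ℝ G₁) (fderiv ℝ (fderiv ℝ G₁) y₀) y₀ :=
    ((hG₁s.fderiv_right (m := 1) (by exact WithTop.coe_le_coe.2 le_top)).differentiableAt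
      one_ne_zero).hasFDerivAt
  have hd := (hd1.clm_comp hd2).congr_of_eventuallyEq key
  have e1 : ∀ u, (fderiv ℝ G y₀ u).1 = fderiv ℝ G₁ y₀ u := by
    intro u
    rw [hG₁, fderiv.fst (hGs.differentiableAt (by simp))]; rfl
  have e2 : ∀ u, (fderiv ℝ G y₀ u).2 = fderiv ℝ (fun y => (G y).2) y₀ u := by
    intro u
    rw [fderiv.snd (hGs.differentiableAt (by simp))]; rfl
  have hsym : ∀ u w, fderiv ℝ (fderiv ℝ G₁) y₀ u w = fderiv ℝ (fderiv ℝ G₁) y₀ w u := by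
    intro u w
    exact (hG₁s.isSymmSndFDerivAt (by simpa using WithTop.coe_le_coe.2 (le_top : (2 : ℕ∞) ≤ ⊤))).eq u w
  refine ⟨hd.differentiableAt, fun u w => ?_⟩
  rw [hd.fderiv, hDG, canonicalForm_apply, e1, e1, e2, e2]
  simp [hsym u w]

end BundleCharts

section Tulczyjew

variable {E : Type*} [NormedAddCommGroup E] [NormedSpace ℝ E]
  {H : Type*} [TopologicalSpace H] {I : ModelWithCorners ℝ E H}
  {M : Type*} [TopologicalSpace M] [ChartedSpace H M] [IsManifold I ∞ M] [I.Boundaryless]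

variable (I) in
/-- The change of coordinates from the preferred chart at `q` to the one at `q₀`. -/
def chartChange (q₀ q : M) : E → E := extChartAt I q₀ ∘ (extChartAt I q).symm

lemma toChart_eq_fderiv (q₀ q : M) :
    toChart I q₀ q = fderiv ℝ (chartChange I q₀ q) (extChartAt I q q) := by
  have : toChart I q₀ q = fderivWithin ℝ (chartChange I q₀ q) (range I) (extChartAt I q q) := rfl
  rw [this, I.range_eq_univ, fderivWithin_univ]

lemma fderiv_chartChange {q₀ q q' : M} (h : q' ∈ (chartAt H q).source)
    (h₀ : q' ∈ (chartAt H q₀).source) :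
    fderiv ℝ (chartChange I q₀ q) (extChartAt I q q')
      = (toChart I q₀ q').comp (ofChart I q q') := by
  have := toChart_comp_modelDeriv (I := I) (I' := I) (f := (id : M → M)) mdifferentiableAt_id h h₀
  rw [modelDeriv_id, ContinuousLinearMap.id_comp] at this
  exact this

lemma contDiffAt_chartChange {q₀ q : M} (h₀ : q ∈ (chartAt H q₀).source) :
    ContDiffAt ℝ ∞ (chartChange I q₀ q) (extChartAt I q q) :=
  contDiffAt_writtenInCharts (n := ⊤) (f := (id : M → M)) contMDiffAt_id
    (mem_chart_source H q) h₀

omit [IsManifold I ∞ M] in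
lemma eventually_mem_charts {q₀ q : M} (h₀ : q ∈ (chartAt H q₀).source) :
    ∀ᶠ x in 𝓝 (extChartAt I q q), x ∈ (extChartAt I q).target ∧
      (extChartAt I q).symm x ∈ (chartAt H q).source ∧
      (extChartAt I q).symm x ∈ (chartAt H q₀).source := by
  have h1 : ContinuousAt (extChartAt I q).symm (extChartAt I q q) := continuousAt_extChartAt_symm q
  have h2 : (extChartAt I q).symm (extChartAt I q q) = q := extChartAt_to_inv q
  filter_upwards [extChartAt_target_mem_nhds (I := I) q,
    h1.eventually ((chartAt H q).open_source.eventually_mem (by rw [h2]; exact mem_chart_source H q)),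
    h1.eventually ((chartAt H q₀).open_source.eventually_mem (by rwa [h2]))] with x h1 h2 h3
  exact ⟨h1, h2, h3⟩

lemma toChart_tangentBundle_apply {v₀ v : TangentBundle I M}
    (h₀ : v.proj ∈ (chartAt H v₀.proj).source) (X : E × E) :
    toChart I.tangent v₀ v X = (toChart I v₀.proj v.proj X.1,
      fderiv ℝ (fderiv ℝ (chartChange I v₀.proj v.proj)) (extChartAt I v.proj v.proj) X.1 (vec v)
        + toChart I v₀.proj v.proj X.2) := by
  set ψ := chartChange I v₀.proj v.proj with hψ
  have hy₀ : extChartAt I.tangent v v = (extChartAt I v.proj v.proj, vec v) := by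
    rw [extChartAt_tangentBundle, toChart_self]; rfl
  have key : chartChange I.tangent v₀ v =ᶠ[𝓝 (extChartAt I v.proj v.proj, vec v)]
      fun y => (ψ y.1, fderiv ℝ ψ y.1 y.2) := by
    filter_upwards [(continuousAt_fst (p := (extChartAt I v.proj v.proj, vec v))).eventually
      (eventually_mem_charts h₀)] with y hy
    have h1 := fderiv_chartChange (I := I) hy.2.1 hy.2.2
    rw [(extChartAt I v.proj).right_inv hy.1] at h1
    rw [hψ, h1, chartChange, Function.comp_apply, extChartAt_tangentBundle_symm,
      extChartAt_tangentBundle]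
    rfl
  have hs := contDiffAt_chartChange (I := I) h₀
  have hd1 : HasFDerivAt (fun y : E × E => ψ y.1)
      ((fderiv ℝ ψ (extChartAt I v.proj v.proj)).comp (ContinuousLinearMap.fst ℝ E E))
      (extChartAt I v.proj v.proj, vec v) :=
    HasFDerivAt.comp (g := ψ) (f := Prod.fst) (extChartAt I v.proj v.proj, vec v)
      ((hs.differentiableAt (by simp)).hasFDerivAt) hasFDerivAt_fst
  have hd2 : HasFDerivAt (fun y : E × E => fderiv ℝ ψ y.1)
      ((fderiv ℝ (fderiv ℝ ψ) (extChartAt I v.proj v.proj)).comp (ContinuousLinearMap.fst ℝ E E))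
      (extChartAt I v.proj v.proj, vec v) :=
    HasFDerivAt.comp (g := fderiv ℝ ψ) (f := Prod.fst) (extChartAt I v.proj v.proj, vec v)
      (((hs.fderiv_right (m := 1) (by exact WithTop.coe_le_coe.2 le_top)).differentiableAt
      one_ne_zero).hasFDerivAt) hasFDerivAt_fst
  have hd := hd1.prodMk (hd2.clm_apply hasFDerivAt_snd)
  rw [toChart_eq_fderiv, hy₀, (hd.congr_of_eventuallyEq key).fderiv, toChart_eq_fderiv]
  simp only [ContinuousLinearMap.prod_apply, ContinuousLinearMap.comp_apply,
    add_apply, ContinuousLinearMap.flip_apply,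
    ContinuousLinearMap.coe_fst', ContinuousLinearMap.coe_snd']
  rw [add_comm]

lemma toChart_cotangentBundle_fst {α₀ α : CotangentBundle I M}
    (h₀ : α.proj ∈ (chartAt H α₀.proj).source) (X : E × (E →L[ℝ] ℝ)) :
    (toChart (cotangentModel I) α₀ α X).1 = toChart I α₀.proj α.proj X.1 := by
  have hα := mem_chart_cotangentBundle.2 h₀
  have hs := contDiffAt_chartChange (I := cotangentModel I) hα
  have hψ := (contDiffAt_chartChange (I := I) h₀).differentiableAt (by simp)
  set y₀ := extChartAt (cotangentModel I) α α with hy₀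
  have e0 : y₀.1 = extChartAt I α.proj α.proj := rfl
  have key : (fun y => (chartChange (cotangentModel I) α₀ α y).1) =ᶠ[𝓝 y₀]
      fun y => chartChange I α₀.proj α.proj y.1 := by
    filter_upwards [eventually_mem_charts hα] with y hy
    have h1 : (extChartAt (cotangentModel I) α ((extChartAt (cotangentModel I) α).symm y)).1
      = y.1 := congrArg Prod.fst ((extChartAt (cotangentModel I) α).right_inv hy.1)
    have h2 : (extChartAt (cotangentModel I) α ((extChartAt (cotangentModel I) α).symm y)).1
      = extChartAt I α.proj ((extChartAt (cotangentModel I) α).symm y).proj := rfl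
    have h3 : (chartChange (cotangentModel I) α₀ α y).1
      = extChartAt I α₀.proj ((extChartAt (cotangentModel I) α).symm y).proj := rfl
    rw [h3, ← h1, h2, chartChange, Function.comp_apply, (extChartAt I α.proj).left_inv]
    rw [extChartAt_source]
    exact mem_chart_cotangentBundle.1 hy.2.1
  have hd1 := HasFDerivAt.comp (f := Prod.fst) y₀ (e0 ▸ hψ.hasFDerivAt) hasFDerivAt_fst
  have hd2 := HasFDerivAt.congr_of_eventuallyEq hd1 key
  have hd3 := (hs.differentiableAt (by simp)).hasFDerivAt.fst
  rw [toChart_eq_fderiv, toChart_eq_fderiv]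
  exact DFunLike.congr_fun (hd3.unique hd2) X

/-- Invariance of the canonical diffeomorphism `TT^*M → T^*TM` under changes of coordinates. -/
lemma tulczyjew_pairing {α₀ α : CotangentBundle I M} (u₀ : E)
    (h₀ : α.proj ∈ (chartAt H α₀.proj).source) (X : E × (E →L[ℝ] ℝ)) (a b : E) :
    (toChart (cotangentModel I) α₀ α X).2 (toChart I α₀.proj α.proj a) +
      covec α (ofChart I α₀.proj α.proj
        (toChart I.tangent (⟨α₀.proj, u₀⟩ : TangentBundle I M)
          (⟨α.proj, X.1⟩ : TangentBundle I M) (a, b)).2) = X.2 a + covec α b := by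
  have hα := mem_chart_cotangentBundle.2 h₀
  have hs := contDiffAt_chartChange (I := cotangentModel I) hα
  have hψ := contDiffAt_chartChange (I := I) h₀
  rw [toChart_tangentBundle_apply (v₀ := (⟨α₀.proj, u₀⟩ : TangentBundle I M))
          (v := (⟨α.proj, X.1⟩ : TangentBundle I M)) h₀]
  set y₀ := extChartAt (cotangentModel I) α α with hy₀
  set ψ := chartChange I α₀.proj α.proj with hψdef
  have e0 : y₀.1 = extChartAt I α.proj α.proj := rfl
  have key : (fun y : E × (E →L[ℝ] ℝ) =>
      (chartChange (cotangentModel I) α₀ α y).2 (fderiv ℝ ψ y.1 a)) =ᶠ[𝓝 y₀] fun y => y.2 a := by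
    filter_upwards [eventually_mem_charts hα] with y hy
    set β := (extChartAt (cotangentModel I) α).symm y with hβ
    have hb := mem_chart_cotangentBundle.1 hy.2.1
    have hb0 := mem_chart_cotangentBundle.1 hy.2.2
    have h1 := (extChartAt_cotangentBundle hb).symm.trans
      ((extChartAt (cotangentModel I) α).right_inv hy.1)
    have h2 : chartChange (cotangentModel I) α₀ α y = extChartAt (cotangentModel I) α₀ β := rfl
    rw [h2, extChartAt_cotangentBundle hb0, ← h1]
    simp only
    rw [hψdef, fderiv_chartChange hb hb0]
    simp [ofChart_toChart hb0]
  have hd1 := (hs.differentiableAt (by simp)).hasFDerivAt.snd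
  have hd2 : HasFDerivAt (fderiv ℝ ψ) (fderiv ℝ (fderiv ℝ ψ) y₀.1) y₀.1 := e0 ▸
    ((hψ.fderiv_right (m := 1) (by exact WithTop.coe_le_coe.2 le_top)).differentiableAt
      one_ne_zero).hasFDerivAt
  have hd3 := (HasFDerivAt.comp (f := Prod.fst) y₀ hd2 hasFDerivAt_fst).clm_apply
    (hasFDerivAt_const a y₀)
  have hd4 := hd1.clm_apply hd3
  have hd5 := (hasFDerivAt_snd (𝕜 := ℝ) (p := y₀)).clm_apply (hasFDerivAt_const a y₀)
  have h := DFunLike.congr_fun (hd4.unique (HasFDerivAt.congr_of_eventuallyEq hd5 key)) X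
  have hcov : (chartChange (cotangentModel I) α₀ α y₀).2
      = (covec α).comp (ofChart I α₀.proj α.proj) := by
    rw [hy₀, chartChange, Function.comp_apply, extChartAt_to_inv, extChartAt_cotangentBundle h₀]
  have hsym : fderiv ℝ (fderiv ℝ ψ) y₀.1 X.1 a = fderiv ℝ (fderiv ℝ ψ) y₀.1 a X.1 :=
    (hψ.isSymmSndFDerivAt (by simpa using WithTop.coe_le_coe.2 (le_top : (2 : ℕ∞) ≤ ⊤))).eq _ _
  simp only [add_apply, ContinuousLinearMap.comp_apply,
    ContinuousLinearMap.flip_apply, ContinuousLinearMap.coe_fst', ContinuousLinearMap.coe_snd',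
    zero_apply, map_zero, zero_add, hcov, Function.comp_apply, hsym] at h
  have ha : fderiv ℝ ψ y₀.1 a = toChart I α₀.proj α.proj a := by rw [e0, toChart_eq_fderiv]
  have hT : fderiv ℝ (chartChange (cotangentModel I) α₀ α) y₀ = toChart (cotangentModel I) α₀ α :=
    (toChart_eq_fderiv _ _).symm
  rw [ha, hT] at h
  rw [← h, map_add, map_add]
  erw [ofChart_toChart h₀]
  simp only [vec, e0]
  ring

omit [I.Boundaryless] in
lemma covec_tulczyjew (X : TangentBundle (cotangentModel I) (CotangentBundle I M)) :
    covec (tulczyjew I X) = (vec X).2.comp (ContinuousLinearMap.fst ℝ E E)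
      + (covec X.proj).comp (ContinuousLinearMap.snd ℝ E E) := rfl

lemma covec_tulczyjew_comp_ofChart {α₀ : CotangentBundle I M} (u₀ : E)
    {X : TangentBundle (cotangentModel I) (CotangentBundle I M)}
    (h₀ : X.proj.proj ∈ (chartAt H α₀.proj).source) :
    (covec (tulczyjew I X)).comp (ofChart I.tangent (⟨α₀.proj, u₀⟩ : TangentBundle I M)
      (tulczyjew I X).proj) =
    (toChart (cotangentModel I) α₀ X.proj (vec X)).2.comp (ContinuousLinearMap.fst ℝ E E) +
      ((covec X.proj).comp (ofChart I α₀.proj X.proj.proj)).comp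
        (ContinuousLinearMap.snd ℝ E E) := by
  have hv : (tulczyjew I X).proj ∈
      (chartAt (ModelProd H E) (⟨α₀.proj, u₀⟩ : TangentBundle I M)).source :=
    mem_chart_tangentBundle.2 h₀
  refine ContinuousLinearMap.ext fun Z => ?_
  set Y : E × E := ofChart I.tangent (⟨α₀.proj, u₀⟩ : TangentBundle I M) (tulczyjew I X).proj Z
    with hY
  have hZ : Z = toChart I.tangent (⟨α₀.proj, u₀⟩ : TangentBundle I M) (tulczyjew I X).proj Y :=
    (toChart_ofChart hv Z).symm
  have hZ1 : Z.1 = toChart I α₀.proj X.proj.proj Y.1 := by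
    rw [hZ, toChart_tangentBundle_apply (v₀ := (⟨α₀.proj, u₀⟩ : TangentBundle I M)) h₀]; rfl
  have h := tulczyjew_pairing u₀ h₀ (vec X) Y.1 Y.2
  have h2 : (toChart I.tangent (⟨α₀.proj, u₀⟩ : TangentBundle I M)
    (⟨X.proj.proj, (vec X).1⟩ : TangentBundle I M) (Y.1, Y.2)) = Z := hZ.symm
  rw [h2, ← hZ1] at h
  rw [ContinuousLinearMap.comp_apply, ← hY, covec_tulczyjew]
  simp only [add_apply, ContinuousLinearMap.comp_apply,
    ContinuousLinearMap.coe_fst', ContinuousLinearMap.coe_snd']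
  exact h.symm

/-- The canonical diffeomorphism `TT^*M → T^*TM` is smooth. -/
theorem contMDiff_tulczyjew :
    ContMDiff (cotangentModel I).tangent (cotangentModel I.tangent) ∞ (tulczyjew I (M := M)) := by
  intro X₀
  have hid := (contMDiffAt_tangentBundle (I := cotangentModel I) (n := ∞)
    (f := (id : TangentBundle (cotangentModel I) (CotangentBundle I M) → _)) (x₀ := X₀)).1
    contMDiffAt_id
  have hpr := (contMDiffAt_cotangentBundle (I := I) (n := ∞)).1 hid.1
  have hev : ∀ᶠ X in 𝓝 X₀, X.proj.proj ∈ (chartAt H X₀.proj.proj).source :=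
    hpr.1.continuousAt.eventually ((chartAt H X₀.proj.proj).open_source.eventually_mem
      (mem_chart_source H _))
  refine contMDiffAt_cotangentBundle.2 ⟨contMDiffAt_tangentBundle.2 ⟨hpr.1, ?_⟩, ?_⟩
  · refine ((contDiff_fst.contMDiff (n := ∞)).contMDiffAt.comp X₀ hid.2).congr_of_eventuallyEq ?_
    filter_upwards [hev] with X hX
    exact (toChart_cotangentBundle_fst hX (vec X)).symm
  · have h1 := (contDiff_snd.contMDiff (n := ∞)).contMDiffAt.comp X₀ hid.2
    refine ((h1.clm_comp (contMDiffAt_const (c := ContinuousLinearMap.fst ℝ E E))).add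
      (hpr.2.clm_comp (contMDiffAt_const (c := ContinuousLinearMap.snd ℝ E E)))).congr_of_eventuallyEq
        ?_
    filter_upwards [hev] with X hX
    exact covec_tulczyjew_comp_ofChart _ hX

end Tulczyjew

lemma isInvertible_of_injective {E F : Type*} [NormedAddCommGroup E] [NormedSpace ℝ E]
    [FiniteDimensional ℝ E] [NormedAddCommGroup F] [NormedSpace ℝ F] [FiniteDimensional ℝ F]
    {A : E →L[ℝ] F} (h : Function.Injective A)
    (hEF : Module.finrank ℝ E = Module.finrank ℝ F) : A.IsInvertible :=
  ⟨(LinearEquiv.ofInjectiveOfFinrankEq (A : E →ₗ[ℝ] F) h hEF).toContinuousLinearEquiv, by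
    ext v; rfl⟩

lemma finrank_continuousDual (E : Type*) [NormedAddCommGroup E] [NormedSpace ℝ E]
    [FiniteDimensional ℝ E] : Module.finrank ℝ (E →L[ℝ] ℝ) = Module.finrank ℝ E :=
  (LinearMap.toContinuousLinearMap (𝕜 := ℝ) (E := E) (F' := ℝ)).finrank_eq.symm.trans
    (Subspace.dual_finrank_eq (K := ℝ) (V := E))

section Legendre

variable {E : Type*} [NormedAddCommGroup E] [NormedSpace ℝ E]
  {H : Type*} [TopologicalSpace H] {I : ModelWithCorners ℝ E H}
  {M : Type*} [TopologicalSpace M] [ChartedSpace H M] [IsManifold I ∞ M] [I.Boundaryless]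
  {L : TangentBundle I M → ℝ}

variable (L) in
/-- A function on `TM` in the chart of `TM` around `v₀`. -/
def inChart (v₀ : TangentBundle I M) : E × E → ℝ := L ∘ (extChartAt I.tangent v₀).symm

omit [I.Boundaryless] in
lemma extChartAt_tangentBundle_self (v : TangentBundle I M) (u : E) :
    extChartAt I.tangent v (⟨v.proj, u⟩ : TangentBundle I M) = (extChartAt I v.proj v.proj, u) := by
  rw [extChartAt_tangentBundle, toChart_self]; rfl

omit [I.Boundaryless] in
lemma extChartAt_tangentBundle_symm_self (v : TangentBundle I M) (u : E) :
    (extChartAt I.tangent v).symm (extChartAt I v.proj v.proj, u) = ⟨v.proj, u⟩ := by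
  rw [← extChartAt_tangentBundle_self, (extChartAt I.tangent v).left_inv]
  rw [extChartAt_source]
  exact mem_chart_tangentBundle.2 (mem_chart_source H _)

lemma contDiffAt_inChart (hL : ContMDiff I.tangent 𝓘(ℝ, ℝ) ∞ L) {v₀ v : TangentBundle I M}
    (h : v.proj ∈ (chartAt H v₀.proj).source) :
    ContDiffAt ℝ ∞ (inChart L v₀) (extChartAt I.tangent v₀ v) :=
  contDiffAt_writtenInCharts (n := ⊤) (hL v) (mem_chart_tangentBundle.2 h)
    (mem_chart_source ℝ (L v))

lemma fderiv_inChart (hL : ContMDiff I.tangent 𝓘(ℝ, ℝ) ∞ L) {v₀ v : TangentBundle I M}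
    (h : v.proj ∈ (chartAt H v₀.proj).source) :
    fderiv ℝ (inChart L v₀) (extChartAt I.tangent v₀ v)
      = (modelDeriv I.tangent 𝓘(ℝ, ℝ) L v).comp (ofChart I.tangent v₀ v) := by
  have := toChart_comp_modelDeriv ((hL v).mdifferentiableAt (by simp))
    (mem_chart_tangentBundle.2 h) (mem_chart_source ℝ (L v))
  rw [toChart_self, ContinuousLinearMap.id_comp] at this
  exact this

lemma ofChart_tangentBundle_vertical {v₀ v : TangentBundle I M}
    (h : v.proj ∈ (chartAt H v₀.proj).source) (b : E) :
    ofChart I.tangent v₀ v (0, b) = (0, ofChart I v₀.proj v.proj b) := by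
  have h1 : toChart I.tangent v₀ v (0, ofChart I v₀.proj v.proj b) = (0, b) := by
    rw [toChart_tangentBundle_apply h]
    simp [toChart_ofChart h]
  rw [← h1, ofChart_toChart (mem_chart_tangentBundle.2 h)]

lemma contDiffAt_fderiv_inChart (hL : ContMDiff I.tangent 𝓘(ℝ, ℝ) ∞ L) {v₀ v : TangentBundle I M}
    (h : v.proj ∈ (chartAt H v₀.proj).source) :
    ContDiffAt ℝ ∞ (fderiv ℝ (inChart L v₀)) (extChartAt I.tangent v₀ v) :=
  (contDiffAt_inChart hL h).fderiv_right le_rfl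

lemma hasFDerivAt_fiber (hL : ContMDiff I.tangent 𝓘(ℝ, ℝ) ∞ L) (v : TangentBundle I M) (u : E) :
    HasFDerivAt (fun u : E => L ⟨v.proj, u⟩)
      ((fderiv ℝ (inChart L v) (extChartAt I v.proj v.proj, u)).comp
        (ContinuousLinearMap.inr ℝ E E)) u := by
  have h1 := contDiffAt_inChart hL (v₀ := v) (v := ⟨v.proj, u⟩) (mem_chart_source H _)
  rw [extChartAt_tangentBundle_self] at h1
  have h2 := HasFDerivAt.comp (g := inChart L v) (f := fun u : E => (extChartAt I v.proj v.proj, u))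
    u (h1.differentiableAt (by simp)).hasFDerivAt (hasFDerivAt_prodMk_right _ u)
  refine h2.congr_of_eventuallyEq (Eventually.of_forall fun u => ?_)
  simp only [Function.comp_apply, inChart]
  rw [extChartAt_tangentBundle_symm_self]

lemma covec_legendre (hL : ContMDiff I.tangent 𝓘(ℝ, ℝ) ∞ L) (v : TangentBundle I M) :
    covec (legendre I L v) = (modelDeriv I.tangent 𝓘(ℝ, ℝ) L v).comp
      (ContinuousLinearMap.inr ℝ E E) := by
  have h1 := (hasFDerivAt_fiber hL v (vec v)).fderiv
  have h2 := fderiv_inChart hL (v₀ := v) (v := v) (mem_chart_source H _)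
  rw [ofChart_self, ContinuousLinearMap.comp_id] at h2
  have h0 : extChartAt I.tangent v v = (extChartAt I v.proj v.proj, vec v) :=
    extChartAt_tangentBundle_self v (vec v)
  rw [← h2, h0]
  exact h1

lemma covec_legendre_comp_ofChart (hL : ContMDiff I.tangent 𝓘(ℝ, ℝ) ∞ L)
    {v₀ v : TangentBundle I M} (h : v.proj ∈ (chartAt H v₀.proj).source) :
    (covec (legendre I L v)).comp (ofChart I v₀.proj v.proj) =
      (fderiv ℝ (inChart L v₀) (extChartAt I.tangent v₀ v)).comp
        (ContinuousLinearMap.inr ℝ E E) := by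
  rw [covec_legendre hL, fderiv_inChart hL h]
  refine ContinuousLinearMap.ext fun b => ?_
  simp only [ContinuousLinearMap.comp_apply, ContinuousLinearMap.inr_apply]
  rw [ofChart_tangentBundle_vertical h]

/-- The coordinate expression of the Legendre map. -/
def legendreInChart (L : TangentBundle I M → ℝ) (v₀ : TangentBundle I M) (y : E × E) :
    E × (E →L[ℝ] ℝ) :=
  (y.1, (fderiv ℝ (inChart L v₀) y).comp (ContinuousLinearMap.inr ℝ E E))

lemma extChartAt_legendre (hL : ContMDiff I.tangent 𝓘(ℝ, ℝ) ∞ L)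
    {v₀ v : TangentBundle I M} (h : v.proj ∈ (chartAt H v₀.proj).source) :
    extChartAt (cotangentModel I) (legendre I L v₀) (legendre I L v) =
      legendreInChart L v₀ (extChartAt I.tangent v₀ v) := by
  rw [extChartAt_cotangentBundle h, legendreInChart]
  exact Prod.ext rfl (covec_legendre_comp_ofChart hL h)

lemma contDiffAt_legendreInChart (hL : ContMDiff I.tangent 𝓘(ℝ, ℝ) ∞ L)
    {v₀ v : TangentBundle I M} (h : v.proj ∈ (chartAt H v₀.proj).source) :
    ContDiffAt ℝ ∞ (legendreInChart L v₀) (extChartAt I.tangent v₀ v) :=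
  contDiffAt_fst.prodMk ((contDiffAt_fderiv_inChart hL h).clm_comp contDiffAt_const)

omit [I.Boundaryless] in
lemma eventually_mem_chart_proj (v₀ : TangentBundle I M) :
    ∀ᶠ v in 𝓝 v₀, v.proj ∈ (chartAt H v₀.proj).source :=
  (contMDiffAt_proj (n := 1) (IB := I) (TangentSpace I) (p := v₀)).continuousAt.eventually
    ((chartAt H v₀.proj).open_source.eventually_mem (mem_chart_source H _))

theorem contMDiff_legendre (hL : ContMDiff I.tangent 𝓘(ℝ, ℝ) ∞ L) :
    ContMDiff I.tangent (cotangentModel I) ∞ (legendre I L) := by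
  intro v₀
  refine contMDiffAt_cotangentBundle.2 ⟨contMDiffAt_proj (TangentSpace I), ?_⟩
  have h1 : ContMDiffAt I.tangent 𝓘(ℝ, E →L[ℝ] ℝ) ∞
      (fun v => (fderiv ℝ (inChart L v₀) (extChartAt I.tangent v₀ v)).comp
        (ContinuousLinearMap.inr ℝ E E)) v₀ :=
    (((contDiffAt_fderiv_inChart hL (mem_chart_source H _)).contMDiffAt).comp v₀
      contMDiffAt_extChartAt).clm_comp contMDiffAt_const
  refine h1.congr_of_eventuallyEq ?_
  filter_upwards [eventually_mem_chart_proj v₀] with v hv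
  exact covec_legendre_comp_ofChart hL hv

/-- The Hessian of `L` in the preferred chart at `v`. -/
def hessian (L : TangentBundle I M → ℝ) (v : TangentBundle I M) : E × E →L[ℝ] E × E →L[ℝ] ℝ :=
  fderiv ℝ (fderiv ℝ (inChart L v)) (extChartAt I.tangent v v)

lemma hasFDerivAt_fderiv_inChart (hL : ContMDiff I.tangent 𝓘(ℝ, ℝ) ∞ L)
    (v : TangentBundle I M) : HasFDerivAt (fderiv ℝ (inChart L v)) (hessian L v)
      (extChartAt I.tangent v v) :=
  ((contDiffAt_fderiv_inChart hL (mem_chart_source H _)).differentiableAt (by simp)).hasFDerivAt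

lemma hessian_symm (hL : ContMDiff I.tangent 𝓘(ℝ, ℝ) ∞ L) (v : TangentBundle I M) (X Y : E × E) :
    hessian L v X Y = hessian L v Y X :=
  ((contDiffAt_inChart hL (mem_chart_source H _)).isSymmSndFDerivAt
    (by simpa using WithTop.coe_le_coe.2 (le_top : (2 : ℕ∞) ≤ ⊤))).eq _ _

lemma hessian_vertical (hL : ContMDiff I.tangent 𝓘(ℝ, ℝ) ∞ L) (v : TangentBundle I M) (a b : E) :
    fderiv ℝ (fderiv ℝ (fun u : E => L ⟨v.proj, u⟩)) (vec v) a b = hessian L v (0, a) (0, b) := by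
  have h1 : fderiv ℝ (fun u : E => L ⟨v.proj, u⟩) = fun u =>
      (fderiv ℝ (inChart L v) (extChartAt I v.proj v.proj, u)).comp
        (ContinuousLinearMap.inr ℝ E E) := funext fun u => (hasFDerivAt_fiber hL v u).fderiv
  have h2 := hasFDerivAt_fderiv_inChart hL v
  have h0 : extChartAt I.tangent v v = (extChartAt I v.proj v.proj, vec v) :=
    extChartAt_tangentBundle_self v (vec v)
  rw [h0] at h2
  have h3 := (HasFDerivAt.comp (f := fun u : E => (extChartAt I v.proj v.proj, u))
    (vec v) h2 (hasFDerivAt_prodMk_right _ (vec v))).clm_comp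
      (hasFDerivAt_const (ContinuousLinearMap.inr ℝ E E) (vec v))
  rw [h1]
  erw [h3.fderiv]
  simp

lemma hessian_nondegenerate (hL : IsRegularLagrangian I L) (v : TangentBundle I M) (a : E)
    (h : ∀ b, hessian L v (0, a) (0, b) = 0) : a = 0 :=
  hL.nondegenerate v.proj (vec v) a fun b => by rw [hessian_vertical hL.smooth, h]

lemma modelDeriv_legendre_eq_fderiv (hL : ContMDiff I.tangent 𝓘(ℝ, ℝ) ∞ L)
    {v₀ v : TangentBundle I M} (h : v.proj ∈ (chartAt H v₀.proj).source) :
    (toChart (cotangentModel I) (legendre I L v₀) (legendre I L v)).comp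
      ((modelDeriv I.tangent (cotangentModel I) (legendre I L) v).comp (ofChart I.tangent v₀ v))
      = fderiv ℝ (legendreInChart L v₀) (extChartAt I.tangent v₀ v) := by
  have hv := mem_chart_tangentBundle.2 h
  rw [← toChart_comp_modelDeriv ((contMDiff_legendre hL v).mdifferentiableAt (by simp))
    hv (mem_chart_cotangentBundle.2 h)]
  refine Filter.EventuallyEq.fderiv_eq ?_
  have hv' : v ∈ (extChartAt I.tangent v₀).source := by rwa [extChartAt_source]
  filter_upwards [(isOpen_extChartAt_target v₀).mem_nhds
    ((extChartAt I.tangent v₀).map_source hv')] with y hy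
  have h2 := (extChartAt I.tangent v₀).map_target hy
  rw [extChartAt_source] at h2
  simp only [Function.comp_apply]
  rw [extChartAt_legendre hL (mem_chart_tangentBundle.1 h2), (extChartAt I.tangent v₀).right_inv hy]

lemma modelDeriv_legendre (hL : ContMDiff I.tangent 𝓘(ℝ, ℝ) ∞ L) (v : TangentBundle I M)
    (X : E × E) : modelDeriv I.tangent (cotangentModel I) (legendre I L) v X =
      (X.1, (hessian L v X).comp (ContinuousLinearMap.inr ℝ E E)) := by
  have h := modelDeriv_legendre_eq_fderiv hL (v₀ := v) (v := v) (mem_chart_source H _)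
  rw [toChart_self, ofChart_self, ContinuousLinearMap.comp_id, ContinuousLinearMap.id_comp] at h
  have h2 : HasFDerivAt (legendreInChart L v) _ (extChartAt I.tangent v v) :=
    hasFDerivAt_fst.prodMk ((hasFDerivAt_fderiv_inChart hL v).clm_comp
      (hasFDerivAt_const (ContinuousLinearMap.inr ℝ E E) _))
  rw [h, h2.fderiv]
  simp

lemma isInvertible_modelDeriv_legendre [FiniteDimensional ℝ E] (hL : IsRegularLagrangian I L)
    (v : TangentBundle I M) :
    (modelDeriv I.tangent (cotangentModel I) (legendre I L) v).IsInvertible := by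
  refine isInvertible_of_injective ?_ ?_
  · refine (injective_iff_map_eq_zero _).2 fun X hX => ?_
    rw [modelDeriv_legendre hL.smooth] at hX
    obtain ⟨h1, h2⟩ := Prod.ext_iff.1 hX
    simp only at h1 h2
    refine Prod.ext h1 (hessian_nondegenerate hL v X.2 fun b => ?_)
    have := DFunLike.congr_fun h2 b
    have hX' : X = (0, X.2) := Prod.ext h1 rfl
    rw [hX'] at this
    simpa using this
  · rw [Module.finrank_prod, Module.finrank_prod, finrank_continuousDual]

lemma modelDeriv_energy (hL : ContMDiff I.tangent 𝓘(ℝ, ℝ) ∞ L) (v : TangentBundle I M)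
    (X : E × E) : modelDeriv I.tangent 𝓘(ℝ, ℝ) (energy I L) v X =
      hessian L v X (0, vec v) - modelDeriv I.tangent 𝓘(ℝ, ℝ) L v (X.1, 0) := by
  set y₀ := extChartAt I.tangent v v with hy₀
  have hy₂ : y₀.2 = vec v := congrArg Prod.snd (extChartAt_tangentBundle_self v (vec v))
  have key : energy I L =ᶠ[𝓝 v] (fun y : E × E => fderiv ℝ (inChart L v) y (0, y.2) - inChart L v y)
      ∘ extChartAt I.tangent v := by
    filter_upwards [eventually_mem_chart_proj v] with w hw
    have h1 : energy I L w = covec (legendre I L w) (vec w) - L w := rfl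
    have h2 := DFunLike.congr_fun (covec_legendre_comp_ofChart hL hw)
      (toChart I v.proj w.proj (vec w))
    simp only [ContinuousLinearMap.comp_apply, ofChart_toChart hw] at h2
    have h3 : w ∈ (extChartAt I.tangent v).source := by
      rw [extChartAt_source]; exact mem_chart_tangentBundle.2 hw
    rw [h1, h2, Function.comp_apply, inChart, Function.comp_apply,
      (extChartAt I.tangent v).left_inv h3]
    rfl
  have hd1 := (hasFDerivAt_fderiv_inChart hL v).clm_apply
    (((ContinuousLinearMap.inr ℝ E E).comp (ContinuousLinearMap.snd ℝ E E)).hasFDerivAt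
      (x := y₀))
  have hd2 : HasFDerivAt (inChart L v) (fderiv ℝ (inChart L v) y₀) y₀ :=
    ((contDiffAt_inChart hL (mem_chart_source H _)).differentiableAt (by simp)).hasFDerivAt
  have hd : HasFDerivAt (fun y : E × E => fderiv ℝ (inChart L v) y (0, y.2) - inChart L v y) _ y₀ :=
    hd1.sub hd2
  have hf := fderiv_inChart hL (v₀ := v) (v := v) (mem_chart_source H _)
  rw [ofChart_self, ContinuousLinearMap.comp_id] at hf
  rw [modelDeriv_congr key, modelDeriv_comp (I' := 𝓘(ℝ, E × E)) (f := extChartAt I.tangent v)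
    hd.differentiableAt.mdifferentiableAt (mdifferentiableAt_extChartAt (mem_chart_source _ v)),
    modelDeriv_extChartAt (mem_chart_source _ v), toChart_self, ContinuousLinearMap.comp_id,
    modelDeriv_eq_fderiv, hd.fderiv, ← hf]
  have hX : X = (X.1, 0) + (0, X.2) := by simp
  have hX2 : fderiv ℝ (inChart L v) y₀ X = fderiv ℝ (inChart L v) y₀ (X.1, 0) +
      fderiv ℝ (inChart L v) y₀ (0, X.2) := by rw [← map_add, ← hX]
  simp only [← hy₀, sub_apply, add_apply, ContinuousLinearMap.comp_apply,
    ContinuousLinearMap.flip_apply, ContinuousLinearMap.inr_apply,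
    ContinuousLinearMap.coe_snd', hX2, hy₂]
  ring

/-- The Euler-Lagrange equations in coordinates. -/
theorem isEulerLagrangeField_iff (hL : IsRegularLagrangian I L)
    {Γ : ∀ v : TangentBundle I M, TangentSpace I.tangent v} :
    IsEulerLagrangeField I L Γ ↔ ∀ v, (Γ v : E × E).1 = vec v ∧
      ∀ a, hessian L v (Γ v) (0, a) = modelDeriv I.tangent 𝓘(ℝ, ℝ) L v (a, 0) := by
  have hform : ∀ (v : TangentBundle I M) (G X : E × E), lagrangeForm I L v G X =
      hessian L v X (0, G.1) - hessian L v G (0, X.1) := by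
    intro v G X
    have h1 : lagrangeForm I L v G X = canonicalForm I (legendre I L v)
      (modelDeriv I.tangent (cotangentModel I) (legendre I L) v G)
      (modelDeriv I.tangent (cotangentModel I) (legendre I L) v X) := rfl
    rw [h1, canonicalForm_apply, modelDeriv_legendre hL.smooth, modelDeriv_legendre hL.smooth]
    simp
  refine forall_congr' fun v => ?_
  have h1 : (∀ X : TangentSpace I.tangent v, lagrangeForm I L v (Γ v) X =
      mfderiv I.tangent 𝓘(ℝ, ℝ) (energy I L) v X) ↔ ∀ X : E × E,
      hessian L v X (0, (Γ v : E × E).1) - hessian L v (Γ v) (0, X.1) =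
      hessian L v X (0, vec v) - modelDeriv I.tangent 𝓘(ℝ, ℝ) L v (X.1, 0) := by
    refine forall_congr' fun X => ?_
    rw [hform v (Γ v) X]
    have := modelDeriv_energy hL.smooth v X
    rw [← this]
    rfl
  refine h1.trans ⟨fun h => ?_, fun h X => by rw [h.1, h.2]⟩
  have h2 : (Γ v : E × E).1 = vec v := by
    refine sub_eq_zero.1 (hessian_nondegenerate hL v _ fun b => ?_)
    have h3 := h (0, b)
    have h4 : ((0 : E), (Γ v : E × E).1 - vec v) = (0, (Γ v : E × E).1) - (0, vec v) := by simp
    rw [hessian_symm hL.smooth, h4, map_sub, sub_eq_zero]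
    simpa [show ((0 : E), (0 : E)) = 0 from rfl] using h3
  refine ⟨h2, fun a => ?_⟩
  have h3 := h (a, 0)
  rw [h2] at h3
  simpa using h3

theorem existsUnique_eulerLagrangeField [FiniteDimensional ℝ E] (hL : IsRegularLagrangian I L) :
    ∃! Γ, IsEulerLagrangeField I L Γ := by
  have hinj : ∀ v : TangentBundle I M, ∃! c : E, ∀ a,
      hessian L v (vec v, c) (0, a) = modelDeriv I.tangent 𝓘(ℝ, ℝ) L v (a, 0) := by
    intro v
    obtain ⟨X, hX⟩ := (isInvertible_modelDeriv_legendre hL v).surjective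
      (vec v, (modelDeriv I.tangent 𝓘(ℝ, ℝ) L v).comp (ContinuousLinearMap.inl ℝ E E))
    rw [modelDeriv_legendre hL.smooth] at hX
    obtain ⟨h1, h2⟩ := Prod.ext_iff.1 hX
    simp only at h1 h2
    refine ⟨X.2, fun a => ?_, fun c hc => ?_⟩
    · have := DFunLike.congr_fun h2 a
      rw [← h1]
      simpa using this
    · refine sub_eq_zero.1 (hessian_nondegenerate hL v _ fun b => ?_)
      have h3 : ((0 : E), c - X.2) = (vec v, c) - X := Prod.ext (by simp [h1]) (by simp)
      have := DFunLike.congr_fun h2 b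
      rw [h3, map_sub, sub_apply, hc]
      simp only [ContinuousLinearMap.comp_apply, ContinuousLinearMap.inr_apply,
        ContinuousLinearMap.inl_apply] at this
      rw [this, sub_self]
  choose c hc hu using hinj
  refine ⟨fun v => ((vec v, c v) : E × E), (isEulerLagrangeField_iff hL).2 fun v => ⟨rfl, hc v⟩,
    fun Γ hΓ => funext fun v => ?_⟩
  obtain ⟨h1, h2⟩ := (isEulerLagrangeField_iff hL).1 hΓ v
  refine Prod.ext (α := E) (β := E) h1 (hu v _ fun a => ?_)
  rw [← h2 a]
  congr 2
  exact Prod.ext h1.symm rfl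

end Legendre

section EulerLagrange

variable {E : Type*} [NormedAddCommGroup E] [NormedSpace ℝ E]
  {H : Type*} [TopologicalSpace H] {I : ModelWithCorners ℝ E H}
  {M : Type*} [TopologicalSpace M] [ChartedSpace H M] [IsManifold I ∞ M] [I.Boundaryless]
  {L : TangentBundle I M → ℝ}

/-- The image of `h Γ(v)` in `TT^*M` under the tangent map of the Legendre map. -/
def legendreLift (L : TangentBundle I M → ℝ) (Γ : ∀ v : TangentBundle I M, TangentSpace I.tangent v)
    (h : ℝ) (v : TangentBundle I M) : TangentBundle (cotangentModel I) (CotangentBundle I M) :=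
  tangentMap I.tangent (cotangentModel I) (legendre I L) ⟨v, h • Γ v⟩

lemma vec_legendreLift (hL : ContMDiff I.tangent 𝓘(ℝ, ℝ) ∞ L)
    (Γ : ∀ v : TangentBundle I M, TangentSpace I.tangent v)
    (h : ℝ) (v : TangentBundle I M) : vec (legendreLift L Γ h v) =
      (h • (Γ v : E × E).1, h • (hessian L v (Γ v)).comp (ContinuousLinearMap.inr ℝ E E)) := by
  have h1 : vec (legendreLift L Γ h v) =
    modelDeriv I.tangent (cotangentModel I) (legendre I L) v (h • (Γ v : E × E)) := rfl
  have h2 : ∀ G : E × E, modelDeriv I.tangent (cotangentModel I) (legendre I L) v (h • G) =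
      (h • G.1, h • (hessian L v G).comp (ContinuousLinearMap.inr ℝ E E)) := fun G => by
    rw [map_smul, modelDeriv_legendre hL, Prod.smul_mk]
  exact h1.trans (h2 _)

lemma tulczyjew_legendreLift_proj (hL : IsRegularLagrangian I L)
    {Γ : ∀ v : TangentBundle I M, TangentSpace I.tangent v} (hΓ : IsEulerLagrangeField I L Γ)
    (h : ℝ) (v : TangentBundle I M) :
    (tulczyjew I (legendreLift L Γ h v)).proj = ⟨v.proj, h • vec v⟩ := by
  have h1 : (tulczyjew I (legendreLift L Γ h v)).proj =
    ⟨v.proj, (vec (legendreLift L Γ h v)).1⟩ := rfl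
  rw [h1, vec_legendreLift hL.smooth, ((isEulerLagrangeField_iff hL).1 hΓ v).1]

lemma covec_tulczyjew_legendreLift (hL : IsRegularLagrangian I L)
    {Γ : ∀ v : TangentBundle I M, TangentSpace I.tangent v} (hΓ : IsEulerLagrangeField I L Γ)
    (h : ℝ) (v : TangentBundle I M) (X : E × E) :
    covec (tulczyjew I (legendreLift L Γ h v)) X =
      modelDeriv I.tangent 𝓘(ℝ, ℝ) L v (h • X.1, X.2) := by
  have h2 : covec (legendreLift L Γ h v).proj = covec (legendre I L v) := rfl
  rw [covec_tulczyjew, vec_legendreLift hL.smooth, h2, covec_legendre hL.smooth]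
  have h3 : (h • X.1, X.2) = h • ((X.1, 0) : E × E) + (0, X.2) := by simp
  rw [h3, map_add, map_smul, ← ((isEulerLagrangeField_iff hL).1 hΓ v).2 X.1]
  simp

theorem contMDiff_eulerLagrangeField [FiniteDimensional ℝ E] (hL : IsRegularLagrangian I L)
    {Γ : ∀ v : TangentBundle I M, TangentSpace I.tangent v} (hΓ : IsEulerLagrangeField I L Γ) :
    ContMDiff I.tangent I.tangent.tangent ∞
      (fun v => (⟨v, Γ v⟩ : TangentBundle I.tangent (TangentBundle I M))) := by
  intro v₀
  have := FiniteDimensional.complete ℝ E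
  refine contMDiffAt_tangentBundle.2 ⟨contMDiffAt_id, ?_⟩
  set c := extChartAt I.tangent v₀ with hc
  have hcs : ContMDiffAt I.tangent 𝓘(ℝ, E × E) ∞ c v₀ := contMDiffAt_extChartAt
  -- the components of `TFL Γ`
  set T : TangentBundle I M → E × (E →L[ℝ] ℝ) := fun v =>
    ((c v).2, (fderiv ℝ (inChart L v₀) (c v)).comp (ContinuousLinearMap.inl ℝ E E)) with hT
  have hTs : ContMDiffAt I.tangent 𝓘(ℝ, E × (E →L[ℝ] ℝ)) ∞ T v₀ :=
    (ContDiffAt.contMDiffAt (f := fun y : E × E => (y.2, (fderiv ℝ (inChart L v₀) y).comp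
      (ContinuousLinearMap.inl ℝ E E))) (contDiffAt_snd.prodMk
        ((contDiffAt_fderiv_inChart hL.smooth (mem_chart_source H _)).clm_comp
          contDiffAt_const))).comp v₀ hcs
  set D : TangentBundle I M → (E × E →L[ℝ] E × (E →L[ℝ] ℝ)) := fun v =>
    fderiv ℝ (legendreInChart L v₀) (c v) with hD
  have hDs : ContMDiffAt I.tangent 𝓘(ℝ, E × E →L[ℝ] E × (E →L[ℝ] ℝ)) ∞ D v₀ :=
    (ContDiffAt.contMDiffAt ((contDiffAt_legendreInChart hL.smooth
      (mem_chart_source H _)).fderiv_right le_rfl)).comp v₀ hcs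
  have hinv : ∀ {v : TangentBundle I M}, v.proj ∈ (chartAt H v₀.proj).source →
      (D v).IsInvertible := by
    intro v hv
    rw [hD, hc]
    simp only
    rw [← modelDeriv_legendre_eq_fderiv hL.smooth hv]
    exact (isInvertible_toChart (mem_chart_cotangentBundle.2 hv)).comp
      ((isInvertible_modelDeriv_legendre hL v).comp
        (isInvertible_ofChart (mem_chart_tangentBundle.2 hv)))
  have hDi : ContMDiffAt I.tangent 𝓘(ℝ, E × (E →L[ℝ] ℝ) →L[ℝ] E × E) ∞
      (fun v => (D v).inverse) v₀ :=
    (ContDiffAt.contMDiffAt (hinv (mem_chart_source H _)).contDiffAt_map_inverse).comp v₀ hDs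
  refine (hDi.clm_apply hTs).congr_of_eventuallyEq ?_
  filter_upwards [eventually_mem_chart_proj v₀] with v hv
  have hvm := mem_chart_tangentBundle.2 hv
  have hEL := (isEulerLagrangeField_iff hL).1 hΓ v
  symm
  rw [(hinv hv).inverse_apply_eq]
  set X := legendreLift L Γ 1 v with hX
  have hXv : vec X = modelDeriv I.tangent (cotangentModel I) (legendre I L) v (Γ v) := by
    have h1 : vec X =
      modelDeriv I.tangent (cotangentModel I) (legendre I L) v ((1 : ℝ) • (Γ v : E × E)) := rfl
    rw [h1, one_smul]
  have h1 : D v (toChart I.tangent v₀ v (Γ v)) =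
      toChart (cotangentModel I) (legendre I L v₀) (legendre I L v) (vec X) := by
    rw [hD, hc]
    simp only
    rw [← modelDeriv_legendre_eq_fderiv hL.smooth hv, hXv]
    simp only [ContinuousLinearMap.comp_apply]
    erw [ofChart_toChart hvm]
  refine Eq.trans ?_ h1.symm
  have hpX : (tulczyjew I X).proj = v := by
    rw [hX, tulczyjew_legendreLift_proj hL hΓ, one_smul]; rfl
  refine Prod.ext ?_ ?_
  · rw [toChart_cotangentBundle_fst (α₀ := legendre I L v₀) (α := legendre I L v) hv, hX,
      vec_legendreLift hL.smooth, one_smul, hEL.1]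
    rfl
  · have h2 := covec_tulczyjew_comp_ofChart (α₀ := legendre I L v₀) (vec v₀) (X := X) hv
    have h3 : covec (tulczyjew I X) = modelDeriv I.tangent 𝓘(ℝ, ℝ) L v := by
      refine ContinuousLinearMap.ext fun Z => ?_
      rw [hX, covec_tulczyjew_legendreLift hL hΓ, one_smul]
    rw [h3, hpX] at h2
    have h4 := fderiv_inChart hL.smooth hv
    have h5 : (modelDeriv I.tangent 𝓘(ℝ, ℝ) L v).comp (ofChart I.tangent
      (⟨(legendre I L v₀).proj, (vec v₀ : E)⟩ : TangentBundle I M) v) =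
        (modelDeriv I.tangent 𝓘(ℝ, ℝ) L v).comp (ofChart I.tangent v₀ v) := rfl
    rw [h5, ← h4] at h2
    simp only [hT]
    rw [hc, h2]
    refine ContinuousLinearMap.ext fun a => ?_
    simp
    rfl

end EulerLagrange

section Fibers

variable {E : Type*} [NormedAddCommGroup E] [NormedSpace ℝ E]
  {H : Type*} [TopologicalSpace H] {I : ModelWithCorners ℝ E H}
  {M : Type*} [TopologicalSpace M] [ChartedSpace H M] [IsManifold I ∞ M]

omit [IsManifold I ∞ M] in
lemma cotangent_ext {α β : CotangentBundle I M} (h : α.proj = β.proj) (h' : covec α = covec β) :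
    α = β := by
  obtain ⟨q, p⟩ := α
  obtain ⟨q', p'⟩ := β
  obtain rfl : q = q' := h
  obtain rfl : p = p' := h'
  rfl

/-- The inclusion of the fibre `T_qM` into `TM`. -/
def fiberInclusion (I : ModelWithCorners ℝ E H) (q : M) (u : E) : TangentBundle I M := ⟨q, u⟩

lemma contMDiff_fiberInclusion (q : M) :
    ContMDiff 𝓘(ℝ, E) I.tangent ∞ (fiberInclusion I q) := by
  intro u
  refine contMDiffAt_tangentBundle.2 ⟨contMDiffAt_const, ?_⟩
  refine contMDiffAt_id.congr_of_eventuallyEq (Eventually.of_forall fun w => ?_)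
  change toChart I q q w = w
  rw [toChart_self]; rfl

variable [I.Boundaryless]

omit [I.Boundaryless] in
lemma modelDeriv_fiberInclusion (q : M) (u : E) :
    modelDeriv 𝓘(ℝ, E) I.tangent (fiberInclusion I q) u = ContinuousLinearMap.inr ℝ E E := by
  have h := toChart_comp_modelDeriv
    ((contMDiff_fiberInclusion (I := I) q u).mdifferentiableAt (by simp))
    (mem_chart_source E u) (mem_chart_source _ (fiberInclusion I q u))
  rw [toChart_self, ofChart_self, ContinuousLinearMap.comp_id, ContinuousLinearMap.id_comp] at h
  rw [← h]
  have h2 : extChartAt I.tangent (fiberInclusion I q u) ∘ fiberInclusion I q ∘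
      (extChartAt 𝓘(ℝ, E) u).symm = fun w : E => (extChartAt I q q, w) :=
    funext fun w => extChartAt_tangentBundle_self (fiberInclusion I q u) w
  rw [h2]
  exact (hasFDerivAt_prodMk_right _ _).fderiv

omit [I.Boundaryless] in
lemma contMDiff_zeroTangent :
    ContMDiff I I.tangent ∞ (fun q : M => (⟨q, 0⟩ : TangentBundle I M)) := by
  intro q
  refine contMDiffAt_tangentBundle.2 ⟨contMDiffAt_id, ?_⟩
  refine (contMDiffAt_const (c := (0 : E))).congr_of_eventuallyEq (Eventually.of_forall fun w => ?_)
  exact map_zero (toChart I q w)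

lemma modelDeriv_zeroTangent (q : M) :
    modelDeriv I I.tangent (fun q : M => (⟨q, 0⟩ : TangentBundle I M)) q
      = ContinuousLinearMap.inl ℝ E E := by
  have h := toChart_comp_modelDeriv
    ((contMDiff_zeroTangent (I := I) q).mdifferentiableAt (by simp))
    (mem_chart_source H q) (mem_chart_source (ModelProd H E) (⟨q, 0⟩ : TangentBundle I M))
  rw [toChart_self, ofChart_self, ContinuousLinearMap.comp_id, ContinuousLinearMap.id_comp] at h
  rw [← h]
  refine (Filter.EventuallyEq.fderiv_eq (f := fun x : E => (x, (0 : E))) ?_).trans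
    (hasFDerivAt_prodMk_left _ _).fderiv
  filter_upwards [extChartAt_target_mem_nhds (I := I) q] with x hx
  exact Prod.ext ((extChartAt I q).right_inv hx) (map_zero (toChart I q _))

lemma modelDeriv_apply_split {F : Type*} [NormedAddCommGroup F] [NormedSpace ℝ F] {G : Type*}
    [TopologicalSpace G] {J : ModelWithCorners ℝ F G} {N : Type*} [TopologicalSpace N]
    [ChartedSpace G N] {f : TangentBundle I M → N} {q : M}
    (hf : MDifferentiableAt I.tangent J f ⟨q, 0⟩) (Y : E × E) :
    modelDeriv I.tangent J f ⟨q, 0⟩ Y =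
      modelDeriv I J (fun x : M => f ⟨x, 0⟩) q Y.1 +
      modelDeriv 𝓘(ℝ, E) J (fun u : E => f ⟨q, u⟩) 0 Y.2 := by
  have h1 := modelDeriv_comp (I := I) (f := fun q : M => (⟨q, 0⟩ : TangentBundle I M)) (x := q) hf
    ((contMDiff_zeroTangent (I := I) q).mdifferentiableAt (by simp))
  have h2 := modelDeriv_comp (I := 𝓘(ℝ, E)) (f := fiberInclusion I q) (x := 0) hf
    ((contMDiff_fiberInclusion (I := I) q 0).mdifferentiableAt (by simp))
  rw [modelDeriv_zeroTangent] at h1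
  rw [modelDeriv_fiberInclusion] at h2
  have h3 : modelDeriv I J (fun x : M => f ⟨x, 0⟩) q Y.1 =
    modelDeriv I.tangent J f ⟨q, 0⟩ (Y.1, 0) := DFunLike.congr_fun h1 Y.1
  have h4 : modelDeriv 𝓘(ℝ, E) J (fun u : E => f ⟨q, u⟩) 0 Y.2 =
    modelDeriv I.tangent J f ⟨q, 0⟩ (0, Y.2) := DFunLike.congr_fun h2 Y.2
  rw [h3, h4, ← map_add]
  simp

lemma toChart_prod {F : Type*} [NormedAddCommGroup F] [NormedSpace ℝ F] {G : Type*}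
    [TopologicalSpace G] {J : ModelWithCorners ℝ F G} [J.Boundaryless] {N : Type*}
    [TopologicalSpace N] [ChartedSpace G N] [IsManifold J ∞ N] {r₀ r : M} {s₀ s : N}
    (hr : r ∈ (chartAt H r₀).source) (hs : s ∈ (chartAt G s₀).source) :
    toChart (I.prod J) (r₀, s₀) (r, s) = (toChart I r₀ r).prodMap (toChart J s₀ s) := by
  rw [toChart_eq_fderiv, toChart_eq_fderiv, toChart_eq_fderiv]
  have h1 := ((contDiffAt_chartChange (I := I) hr).differentiableAt (by simp)).hasFDerivAt
  have h2 := ((contDiffAt_chartChange (I := J) hs).differentiableAt (by simp)).hasFDerivAt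
  have h3 : chartChange (I.prod J) (r₀, s₀) (r, s) =
      Prod.map (chartChange I r₀ r) (chartChange J s₀ s) := by
    rw [chartChange, extChartAt_prod, extChartAt_prod]; rfl
  have h4 : extChartAt (I.prod J) (r, s) (r, s) = (extChartAt I r r, extChartAt J s s) := by
    rw [extChartAt_prod]; rfl
  rw [h3, h4]
  exact (HasFDerivAt.prodMap (p := (extChartAt I r r, extChartAt J s s)) h1 h2).fderiv

lemma ofChart_prod {F : Type*} [NormedAddCommGroup F] [NormedSpace ℝ F] {G : Type*}
    [TopologicalSpace G] {J : ModelWithCorners ℝ F G} [J.Boundaryless] {N : Type*}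
    [TopologicalSpace N] [ChartedSpace G N] [IsManifold J ∞ N] {r₀ r : M} {s₀ s : N}
    (hr : r ∈ (chartAt H r₀).source) (hs : s ∈ (chartAt G s₀).source) :
    ofChart (I.prod J) (r₀, s₀) (r, s) = (ofChart I r₀ r).prodMap (ofChart J s₀ s) := by
  refine ContinuousLinearMap.ext fun Z => ?_
  have hm : (r, s) ∈ (chartAt (ModelProd H G) (r₀, s₀)).source := by
    simpa using ⟨hr, hs⟩
  have h := toChart_prod (I := I) (J := J) hr hs
  rw [← (isInvertible_toChart (I := I.prod J) hm).injective.eq_iff, toChart_ofChart hm, h]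
  exact Prod.ext (toChart_ofChart hr _).symm (toChart_ofChart hs _).symm

end Fibers

section DiscretizationMap

variable {E : Type*} [NormedAddCommGroup E] [NormedSpace ℝ E]
  {H : Type*} [TopologicalSpace H] {I : ModelWithCorners ℝ E H}
  {M : Type*} [TopologicalSpace M] [ChartedSpace H M] [IsManifold I ∞ M] [I.Boundaryless]
  {U : Set (TangentBundle I M)} {R : TangentBundle I M → M × M}

/-- The derivative at the origin of the first component of `R` along the fibre `T_qM`. -/
def fiberDeriv₁ (R : TangentBundle I M → M × M) (q : M) : E →L[ℝ] E :=
  modelDeriv 𝓘(ℝ, E) I (fun u : E => (R ⟨q, u⟩).1) 0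

/-- The derivative at the origin of the second component of `R` along the fibre `T_qM`. -/
def fiberDeriv₂ (R : TangentBundle I M → M × M) (q : M) : E →L[ℝ] E :=
  modelDeriv 𝓘(ℝ, E) I (fun u : E => (R ⟨q, u⟩).2) 0

namespace IsDiscretizationMap

omit [I.Boundaryless] in
lemma contMDiffAt (h : IsDiscretizationMap I U R) {v : TangentBundle I M} (hv : v ∈ U) :
    ContMDiffAt I.tangent (I.prod I) ∞ R v :=
  h.smooth.contMDiffAt (h.isOpen.mem_nhds hv)

omit [I.Boundaryless] in
lemma fiberDeriv_sub (h : IsDiscretizationMap I U R) (q : M) (u : E) :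
    fiberDeriv₂ R q u - fiberDeriv₁ R q u = u := h.rigidity q u

lemma modelDeriv_fst_zero (h : IsDiscretizationMap I U R) (q : M) (Y : E × E) :
    modelDeriv I.tangent I (fun v => (R v).1) ⟨q, 0⟩ Y = Y.1 + fiberDeriv₁ R q Y.2 := by
  rw [modelDeriv_apply_split (f := fun v => (R v).1) ((contMDiffAt_fst.comp _
    (h.contMDiffAt (h.zero_mem q))).mdifferentiableAt (by simp))]
  have : (fun x : M => (R ⟨x, 0⟩).1) = id := funext fun x => by rw [h.map_zero]; rfl
  rw [this, modelDeriv_id]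
  rfl

lemma modelDeriv_snd_zero (h : IsDiscretizationMap I U R) (q : M) (Y : E × E) :
    modelDeriv I.tangent I (fun v => (R v).2) ⟨q, 0⟩ Y = Y.1 + fiberDeriv₂ R q Y.2 := by
  rw [modelDeriv_apply_split (f := fun v => (R v).2) ((contMDiffAt_snd.comp _
    (h.contMDiffAt (h.zero_mem q))).mdifferentiableAt (by simp))]
  have : (fun x : M => (R ⟨x, 0⟩).2) = id := funext fun x => by rw [h.map_zero]; rfl
  rw [this, modelDeriv_id]
  rfl

lemma modelDeriv_zero (h : IsDiscretizationMap I U R) (q : M) (Y : E × E) :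
    modelDeriv I.tangent (I.prod I) R ⟨q, 0⟩ Y =
      (Y.1 + fiberDeriv₁ R q Y.2, Y.1 + fiberDeriv₂ R q Y.2) := by
  have hd := (h.contMDiffAt (h.zero_mem q)).mdifferentiableAt (by simp)
  rw [← h.modelDeriv_fst_zero, ← h.modelDeriv_snd_zero, modelDeriv_fst_comp hd,
    modelDeriv_snd_comp hd]
  rfl

lemma isInvertible_modelDeriv_zero [FiniteDimensional ℝ E] (h : IsDiscretizationMap I U R)
    (q : M) : (modelDeriv I.tangent (I.prod I) R ⟨q, 0⟩).IsInvertible := by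
  refine isInvertible_of_injective ((injective_iff_map_eq_zero _).2 fun Y hY => ?_) rfl
  rw [h.modelDeriv_zero] at hY
  obtain ⟨h1, h2⟩ := Prod.ext_iff.1 hY
  simp only [Prod.fst_zero, Prod.snd_zero] at h1 h2
  have h3 : Y.2 = 0 := by
    rw [← h.fiberDeriv_sub q Y.2, ← add_sub_add_left_eq_sub _ _ Y.1, h1, h2, sub_zero]
  rw [h3, _root_.map_zero, add_zero] at h1
  exact Prod.ext h1 h3

end IsDiscretizationMap

end DiscretizationMap

section CotangentDiscretization

variable {E : Type*} [NormedAddCommGroup E] [NormedSpace ℝ E]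
  {H : Type*} [TopologicalSpace H] {I : ModelWithCorners ℝ E H}
  {M : Type*} [TopologicalSpace M] [ChartedSpace H M] [IsManifold I ∞ M]
  {U : Set (TangentBundle I M)} {R : TangentBundle I M → M × M}

/-- The covector on `M × M` which is split into the values of `R_d^{T^*}`. -/
def liftedCovec (R : TangentBundle I M → M × M)
    (X : TangentBundle (cotangentModel I) (CotangentBundle I M)) : E × E →L[ℝ] ℝ :=
  (covec (tulczyjew I X)).comp (modelDeriv I.tangent (I.prod I) R (tulczyjew I X).proj).inverse

lemma covec_cotangentDiscretization_fst
    (X : TangentBundle (cotangentModel I) (CotangentBundle I M)) :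
    covec (cotangentDiscretization I R X).1
      = -((liftedCovec R X).comp (ContinuousLinearMap.inl ℝ E E)) := rfl

lemma covec_cotangentDiscretization_snd
    (X : TangentBundle (cotangentModel I) (CotangentBundle I M)) :
    covec (cotangentDiscretization I R X).2
      = (liftedCovec R X).comp (ContinuousLinearMap.inr ℝ E E) := rfl

lemma cotangentDiscretization_fst_proj
    (X : TangentBundle (cotangentModel I) (CotangentBundle I M)) :
    (cotangentDiscretization I R X).1.proj = (R (tulczyjew I X).proj).1 := rfl

lemma cotangentDiscretization_snd_proj
    (X : TangentBundle (cotangentModel I) (CotangentBundle I M)) :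
    (cotangentDiscretization I R X).2.proj = (R (tulczyjew I X).proj).2 := rfl

lemma mem_cotangentDiscretizationDomain
    {X : TangentBundle (cotangentModel I) (CotangentBundle I M)} :
    X ∈ cotangentDiscretizationDomain I U R ↔ (tulczyjew I X).proj ∈ U ∧
      (modelDeriv I.tangent (I.prod I) R (tulczyjew I X).proj).IsInvertible := Iff.rfl

/-- The generating property of `R_d^{T^*}`: `p₁ dR² - p₀ dR¹ = α_Q`. -/
lemma cotangentDiscretization_pairing
    {X : TangentBundle (cotangentModel I) (CotangentBundle I M)}
    (hX : (modelDeriv I.tangent (I.prod I) R (tulczyjew I X).proj).IsInvertible) (Y : E × E) :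
    covec (cotangentDiscretization I R X).2
        (modelDeriv I.tangent (I.prod I) R (tulczyjew I X).proj Y).2 -
      covec (cotangentDiscretization I R X).1
        (modelDeriv I.tangent (I.prod I) R (tulczyjew I X).proj Y).1 =
      covec (tulczyjew I X) Y := by
  rw [covec_cotangentDiscretization_fst, covec_cotangentDiscretization_snd]
  set Z := modelDeriv I.tangent (I.prod I) R (tulczyjew I X).proj Y with hZ
  have h1 : liftedCovec R X Z = covec (tulczyjew I X) Y := by
    rw [liftedCovec, ContinuousLinearMap.comp_apply, hZ, hX.inverse_apply_self]
  have h2 : Z = (Z.1, 0) + (0, Z.2) := by simp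
  rw [← h1]
  conv_rhs => rw [h2, map_add]
  simp [add_comm]

lemma contMDiffAt_tulczyjew_comp {F : Type*} [NormedAddCommGroup F]
    [NormedSpace ℝ F] {G : Type*} [TopologicalSpace G] {J : ModelWithCorners ℝ F G}
    {N : Type*} [TopologicalSpace N] [ChartedSpace G N] [I.Boundaryless]
    {X : N → TangentBundle (cotangentModel I) (CotangentBundle I M)} {n₀ : N}
    (hX : ContMDiffAt J (cotangentModel I).tangent ∞ X n₀) :
    ContMDiffAt J I.tangent ∞ (fun n => (tulczyjew I (X n)).proj) n₀ ∧
    ContMDiffAt J 𝓘(ℝ, E × E →L[ℝ] ℝ) ∞ (fun n => (covec (tulczyjew I (X n))).comp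
      (ofChart I.tangent (tulczyjew I (X n₀)).proj (tulczyjew I (X n)).proj)) n₀ :=
  contMDiffAt_cotangentBundle.1 ((contMDiff_tulczyjew (X n₀)).comp n₀ hX)

/-- `R_d^{T^*}` is smooth on its domain. -/
theorem contMDiffAt_cotangentDiscretization [CompleteSpace E] [I.Boundaryless]
    {F : Type*} [NormedAddCommGroup F]
    [NormedSpace ℝ F] {G : Type*} [TopologicalSpace G] {J : ModelWithCorners ℝ F G}
    {N : Type*} [TopologicalSpace N] [ChartedSpace G N]
    {X : N → TangentBundle (cotangentModel I) (CotangentBundle I M)} {n₀ : N}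
    (hX : ContMDiffAt J (cotangentModel I).tangent ∞ X n₀)
    (hR : ContMDiffAt I.tangent (I.prod I) ∞ R (tulczyjew I (X n₀)).proj)
    (hi : (modelDeriv I.tangent (I.prod I) R (tulczyjew I (X n₀)).proj).IsInvertible) :
    ContMDiffAt J (cotangentModel I) ∞ (fun n => (cotangentDiscretization I R (X n)).1) n₀ ∧
    ContMDiffAt J (cotangentModel I) ∞ (fun n => (cotangentDiscretization I R (X n)).2) n₀ := by
  obtain ⟨hv, hβ⟩ := contMDiffAt_tulczyjew_comp hX
  set v : N → TangentBundle I M := fun n => (tulczyjew I (X n)).proj with hvdef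
  have hRv : ContMDiffAt J (I.prod I) ∞ (fun n => R (v n)) n₀ := hR.comp n₀ hv
  set A : N → (E × E →L[ℝ] E × E) := fun n => fderiv ℝ
    (extChartAt (I.prod I) (R (v n₀)) ∘ R ∘ (extChartAt I.tangent (v n₀)).symm)
    (extChartAt I.tangent (v n₀) (v n)) with hA
  have hAs : ContMDiffAt J 𝓘(ℝ, E × E →L[ℝ] E × E) ∞ A n₀ := by
    have h1 : ContDiffAt ℝ ∞ (extChartAt (I.prod I) (R (v n₀)) ∘ R ∘
        (extChartAt I.tangent (v n₀)).symm) (extChartAt I.tangent (v n₀) (v n₀)) :=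
      contDiffAt_writtenInCharts (n := ⊤) (I' := I.prod I) hR (mem_chart_source _ (v n₀))
        (mem_chart_source _ (R (v n₀)))
    have h2 : ContMDiffAt I.tangent 𝓘(ℝ, E × E) ∞ (extChartAt I.tangent (v n₀)) (v n₀) :=
      contMDiffAt_extChartAt
    have h3 : ContMDiffAt J 𝓘(ℝ, E × E) ∞ (fun n => extChartAt I.tangent (v n₀) (v n)) n₀ :=
      h2.comp n₀ hv
    exact (ContDiffAt.contMDiffAt (h1.fderiv_right le_rfl)).comp n₀ h3
  have hi' := (isInvertible_modelDeriv_iff (I := I.tangent) (I' := I.prod I)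
    (hR.mdifferentiableAt (by simp))
    (mem_chart_source _ (v n₀)) (mem_chart_source _ (R (v n₀)))).1 hi
  have hAi : ContMDiffAt J 𝓘(ℝ, E × E →L[ℝ] E × E) ∞ (fun n => (A n).inverse) n₀ :=
    (ContDiffAt.contMDiffAt (ContinuousLinearMap.IsInvertible.contDiffAt_map_inverse
      (e := A n₀) hi')).comp n₀ hAs
  have hb := hβ.clm_comp hAi
  have hev : ∀ᶠ n in 𝓝 n₀, (R (v n)).1 ∈ (chartAt H (R (v n₀)).1).source ∧
      (R (v n)).2 ∈ (chartAt H (R (v n₀)).2).source ∧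
      (liftedCovec R (X n)).comp (ofChart (I.prod I) (R (v n₀)) (R (v n))) =
        ((covec (tulczyjew I (X n))).comp (ofChart I.tangent (v n₀) (v n))).comp
          (A n).inverse := by
    have e1 : ∀ᶠ n in 𝓝 n₀, R (v n) ∈ (chartAt (ModelProd H H) (R (v n₀))).source :=
      hRv.continuousAt.eventually ((chartAt (ModelProd H H) (R (v n₀))).open_source.eventually_mem
        (mem_chart_source (ModelProd H H) _))
    have e2 : ∀ᶠ n in 𝓝 n₀, v n ∈ (chartAt (ModelProd H E) (v n₀)).source :=
      hv.continuousAt.eventually ((chartAt (ModelProd H E) (v n₀)).open_source.eventually_mem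
        (mem_chart_source (ModelProd H E) _))
    have e3 : ∀ᶠ n in 𝓝 n₀, ContMDiffAt I.tangent (I.prod I) 1 R (v n) :=
      hv.continuousAt.eventually ((contMDiffAt_iff_contMDiffAt_nhds (n := 1) (by simp)).1
        (hR.of_le (by simp)))
    have e4 : ∀ᶠ n in 𝓝 n₀, (modelDeriv I.tangent (I.prod I) R (v n)).IsInvertible :=
      hv.continuousAt.eventually (eventually_isInvertible_modelDeriv (hR.of_le (by simp)) hi)
    filter_upwards [e1, e2, e3, e4] with n h1 h2 h3 h4
    have h1' : (R (v n)).1 ∈ (chartAt H (R (v n₀)).1).source ∧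
        (R (v n)).2 ∈ (chartAt H (R (v n₀)).2).source := by
      simpa [mfld_simps] using h1
    refine ⟨h1'.1, h1'.2, ?_⟩
    have h5 := toChart_comp_modelDeriv (I := I.tangent) (I' := I.prod I)
      (h3.mdifferentiableAt one_ne_zero) h2 h1
    have h6 : (A n).IsInvertible := (isInvertible_modelDeriv_iff (I := I.tangent)
      (I' := I.prod I) (h3.mdifferentiableAt one_ne_zero) h2 h1).1 h4
    refine ContinuousLinearMap.ext fun Z => ?_
    obtain ⟨Y, rfl⟩ := h6.surjective Z
    rw [ContinuousLinearMap.comp_apply, ContinuousLinearMap.comp_apply, h6.inverse_apply_self]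
    have h7 : A n Y = toChart (I.prod I) (R (v n₀)) (R (v n))
      (modelDeriv I.tangent (I.prod I) R (v n) (ofChart I.tangent (v n₀) (v n) Y)) :=
      DFunLike.congr_fun h5 Y
    rw [h7, ofChart_toChart (I := I.prod I) h1, liftedCovec, ContinuousLinearMap.comp_apply,
      h4.inverse_apply_self]
    rfl
  constructor
  · refine contMDiffAt_cotangentBundle.2 ⟨contMDiffAt_fst.comp n₀ hRv, ?_⟩
    refine ((hb.clm_comp (contMDiffAt_const
      (c := ContinuousLinearMap.inl ℝ E E))).neg).congr_of_eventuallyEq ?_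
    filter_upwards [hev] with n hn
    rw [← hn.2.2, covec_cotangentDiscretization_fst]
    have := ofChart_prod (I := I) (J := I) hn.1 hn.2.1
    refine ContinuousLinearMap.ext fun a => ?_
    change -(liftedCovec R (X n) (ofChart I (R (v n₀)).1 (R (v n)).1 a, 0)) =
      -(liftedCovec R (X n) (ofChart (I.prod I) ((R (v n₀)).1, (R (v n₀)).2)
        ((R (v n)).1, (R (v n)).2) (a, 0)))
    rw [this]
    simp
  · refine contMDiffAt_cotangentBundle.2 ⟨contMDiffAt_snd.comp n₀ hRv, ?_⟩
    refine (hb.clm_comp (contMDiffAt_const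
      (c := ContinuousLinearMap.inr ℝ E E))).congr_of_eventuallyEq ?_
    filter_upwards [hev] with n hn
    rw [← hn.2.2, covec_cotangentDiscretization_snd]
    have := ofChart_prod (I := I) (J := I) hn.1 hn.2.1
    refine ContinuousLinearMap.ext fun a => ?_
    change (liftedCovec R (X n) (0, ofChart I (R (v n₀)).2 (R (v n)).2 a)) =
      (liftedCovec R (X n) (ofChart (I.prod I) ((R (v n₀)).1, (R (v n₀)).2)
        ((R (v n)).1, (R (v n)).2) (0, a)))
    rw [this]
    simp

lemma zero_mem_cotangentDiscretizationDomain [FiniteDimensional ℝ E] [I.Boundaryless]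
    (h : IsDiscretizationMap I U R) (α : CotangentBundle I M) :
    (⟨α, 0⟩ : TangentBundle (cotangentModel I) (CotangentBundle I M)) ∈
      cotangentDiscretizationDomain I U R :=
  ⟨h.zero_mem α.proj, h.isInvertible_modelDeriv_zero α.proj⟩

lemma cotangentDiscretization_zero [FiniteDimensional ℝ E] [I.Boundaryless]
    (h : IsDiscretizationMap I U R) (α : CotangentBundle I M) :
    cotangentDiscretization I R ⟨α, 0⟩ = (α, α) := by
  set X : TangentBundle (cotangentModel I) (CotangentBundle I M) := ⟨α, 0⟩ with hX
  have hp : (tulczyjew I X).proj = ⟨α.proj, 0⟩ := rfl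
  have hi := h.isInvertible_modelDeriv_zero α.proj
  have hb : ∀ a₀ a₁ : E, liftedCovec R X (a₀, a₁) = covec α (a₁ - a₀) := by
    intro a₀ a₁
    have h1 : modelDeriv I.tangent (I.prod I) R ⟨α.proj, 0⟩
        (a₀ - fiberDeriv₁ R α.proj (a₁ - a₀), a₁ - a₀) = (a₀, a₁) := by
      rw [h.modelDeriv_zero]
      refine Prod.ext ?_ ?_
      · simp
      · have := h.fiberDeriv_sub α.proj (a₁ - a₀)
        change a₀ - fiberDeriv₁ R α.proj (a₁ - a₀) + fiberDeriv₂ R α.proj (a₁ - a₀) = a₁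
        rw [sub_add_eq_add_sub, add_sub_assoc, this, add_sub_cancel]
    rw [liftedCovec, ContinuousLinearMap.comp_apply, hp, ← h1, hi.inverse_apply_self,
      covec_tulczyjew]
    have h0 : vec X = 0 := rfl
    rw [h0]
    simp only [Prod.snd_zero, ContinuousLinearMap.zero_comp, zero_add]
    rfl
  have e1 : (R (⟨α.proj, 0⟩ : TangentBundle I M)) = (α.proj, α.proj) := h.map_zero α.proj
  refine Prod.ext (cotangent_ext ?_ ?_) (cotangent_ext ?_ ?_)
  · rw [cotangentDiscretization_fst_proj, hp, e1]
  · rw [covec_cotangentDiscretization_fst]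
    refine ContinuousLinearMap.ext fun a => ?_
    change -(liftedCovec R X (a, 0)) = _
    rw [hb, zero_sub, map_neg, neg_neg]
  · rw [cotangentDiscretization_snd_proj, hp, e1]
  · rw [covec_cotangentDiscretization_snd]
    refine ContinuousLinearMap.ext fun a => ?_
    change (liftedCovec R X (0, a)) = _
    rw [hb, sub_zero]

end CotangentDiscretization

section CotangentDiscretization

variable {E : Type*} [NormedAddCommGroup E] [NormedSpace ℝ E]
  {H : Type*} [TopologicalSpace H] {I : ModelWithCorners ℝ E H}
  {M : Type*} [TopologicalSpace M] [ChartedSpace H M] [IsManifold I ∞ M] [I.Boundaryless]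
  {U : Set (TangentBundle I M)} {R : TangentBundle I M → M × M}

omit [I.Boundaryless] in
lemma modelDeriv_cotangentBundle {F : Type*} [NormedAddCommGroup F] [NormedSpace ℝ F]
    {g : F → CotangentBundle I M} {y₀ : F}
    (hg : ContMDiffAt 𝓘(ℝ, F) (cotangentModel I) ∞ g y₀) :
    HasFDerivAt (fun y => extChartAt I (g y₀).proj (g y).proj)
      ((ContinuousLinearMap.fst ℝ E (E →L[ℝ] ℝ)).comp
        (modelDeriv 𝓘(ℝ, F) (cotangentModel I) g y₀)) y₀ ∧
    HasFDerivAt (fun y => (covec (g y)).comp (ofChart I (g y₀).proj (g y).proj))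
      ((ContinuousLinearMap.snd ℝ E (E →L[ℝ] ℝ)).comp
        (modelDeriv 𝓘(ℝ, F) (cotangentModel I) g y₀)) y₀ := by
  obtain ⟨h1, h2⟩ := contMDiffAt_cotangentBundle.1 hg
  have h3 := toChart_comp_modelDeriv (hg.mdifferentiableAt (by simp)) (mem_chart_source F y₀)
    (mem_chart_source (ModelProd H (E →L[ℝ] ℝ)) (g y₀))
  rw [toChart_self, ofChart_self, ContinuousLinearMap.comp_id, ContinuousLinearMap.id_comp] at h3
  have h4 : DifferentiableAt ℝ (fun y => extChartAt I (g y₀).proj (g y).proj) y₀ := by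
    have : ContMDiffAt 𝓘(ℝ, F) 𝓘(ℝ, E) ∞ (fun y => extChartAt I (g y₀).proj (g y).proj) y₀ :=
      (contMDiffAt_extChartAt (I := I) (x := (g y₀).proj)).comp y₀ h1
    exact this.contDiffAt.differentiableAt (by simp)
  have h5 := h2.contDiffAt.differentiableAt (n := ∞) (by simp)
  have h6 : modelDeriv 𝓘(ℝ, F) (cotangentModel I) g y₀ =
      (fderiv ℝ (fun y => extChartAt I (g y₀).proj (g y).proj) y₀).prod
      (fderiv ℝ (fun y => (covec (g y)).comp (ofChart I (g y₀).proj (g y).proj)) y₀) := by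
    rw [← h3]
    refine (Filter.EventuallyEq.fderiv_eq ?_).trans (h4.hasFDerivAt.prodMk h5.hasFDerivAt).fderiv
    filter_upwards [h1.continuousAt.eventually ((chartAt H (g y₀).proj).open_source.eventually_mem
      (mem_chart_source H _))] with y hy
    exact extChartAt_cotangentBundle hy
  rw [h6]
  exact ⟨h4.hasFDerivAt, h5.hasFDerivAt⟩

omit [I.Boundaryless] in
lemma extChartAt_zeroTangent (q : M) :
    extChartAt I.tangent (⟨q, 0⟩ : TangentBundle I M) (⟨q, 0⟩ : TangentBundle I M) =
      (extChartAt I q q, 0) :=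
  extChartAt_tangentBundle_self (⟨q, 0⟩ : TangentBundle I M) 0

lemma fderiv_inCharts_zero {r : TangentBundle I M → M} {q q' : M}
    (hr : MDifferentiableAt I.tangent I r ⟨q', 0⟩) (h0 : r ⟨q', 0⟩ = q')
    (hq : q' ∈ (chartAt H q).source) (u : E) :
    fderiv ℝ (extChartAt I q ∘ r ∘ (extChartAt I.tangent (⟨q, 0⟩ : TangentBundle I M)).symm)
      (extChartAt I q q', 0) (0, u) =
      toChart I q q' (modelDeriv I.tangent I r ⟨q', 0⟩ (0, ofChart I q q' u)) := by
  have h := toChart_comp_modelDeriv (I := I.tangent) (q₀ := (⟨q, 0⟩ : TangentBundle I M))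
    (r₀ := q) hr (mem_chart_tangentBundle.2 hq) (by rwa [h0])
  have h1 : extChartAt I.tangent (⟨q, 0⟩ : TangentBundle I M) (⟨q', 0⟩ : TangentBundle I M) =
      (extChartAt I q q', 0) := by
    rw [extChartAt_tangentBundle]
    exact Prod.ext rfl (map_zero (toChart I q q'))
  rw [h1] at h
  have h2 := ofChart_tangentBundle_vertical (I := I) (v₀ := (⟨q, 0⟩ : TangentBundle I M))
    (v := (⟨q', 0⟩ : TangentBundle I M)) hq u
  rw [h, ContinuousLinearMap.comp_apply, ContinuousLinearMap.comp_apply, h2, h0]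

lemma fderiv_inCharts_zero_self {r : TangentBundle I M → M} {q : M}
    (hr : MDifferentiableAt I.tangent I r ⟨q, 0⟩) (h0 : r ⟨q, 0⟩ = q) (Y : E × E) :
    fderiv ℝ (extChartAt I q ∘ r ∘ (extChartAt I.tangent (⟨q, 0⟩ : TangentBundle I M)).symm)
      (extChartAt I q q, 0) Y = modelDeriv I.tangent I r ⟨q, 0⟩ Y := by
  have h := toChart_comp_modelDeriv (I := I.tangent) (q₀ := (⟨q, 0⟩ : TangentBundle I M))
    (r₀ := q) hr (mem_chart_source (ModelProd H E) _) (by rw [h0]; exact mem_chart_source H q)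
  rw [extChartAt_zeroTangent] at h
  rw [h, h0, toChart_self, ofChart_self]
  rfl

/-- `R_d^{T^*}` satisfies the rigidity condition of a discretization map on `T^*M`. -/
theorem cotangentDiscretization_rigidity [FiniteDimensional ℝ E]
    (h : IsDiscretizationMap I U R) (α : CotangentBundle I M) (X : E × (E →L[ℝ] ℝ)) :
    fiberDeriv₂ (I := cotangentModel I) (cotangentDiscretization I R) α X -
      fiberDeriv₁ (I := cotangentModel I) (cotangentDiscretization I R) α X = X := by
  have := FiniteDimensional.complete ℝ E
  set q := α.proj with hq
  set y₀ : E × E := (extChartAt I q q, 0) with hy₀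
  set z := fun X : E × (E →L[ℝ] ℝ) => cotangentDiscretization I R
    (fiberInclusion (cotangentModel I) α X) with hz
  set f₁ : E × E → E := extChartAt I q ∘ (fun v => (R v).1) ∘
    (extChartAt I.tangent (⟨q, 0⟩ : TangentBundle I M)).symm with hf₁
  set f₂ : E × E → E := extChartAt I q ∘ (fun v => (R v).2) ∘
    (extChartAt I.tangent (⟨q, 0⟩ : TangentBundle I M)).symm with hf₂
  have hRs : ∀ q', ContMDiffAt I.tangent I ∞ (fun v => (R v).1) ⟨q', 0⟩ ∧
      ContMDiffAt I.tangent I ∞ (fun v => (R v).2) ⟨q', 0⟩ := fun q' =>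
    ⟨contMDiffAt_fst.comp _ (h.contMDiffAt (h.zero_mem q')),
      contMDiffAt_snd.comp _ (h.contMDiffAt (h.zero_mem q'))⟩
  have hR0 : ∀ q', (R ⟨q', 0⟩).1 = q' ∧ (R ⟨q', 0⟩).2 = q' := fun q' => by
    rw [h.map_zero]; exact ⟨rfl, rfl⟩
  have hz0 : z 0 = (α, α) := cotangentDiscretization_zero h α
  have hzs : ContMDiffAt 𝓘(ℝ, E × (E →L[ℝ] ℝ)) (cotangentModel I) ∞ (fun X => (z X).1) 0 ∧
      ContMDiffAt 𝓘(ℝ, E × (E →L[ℝ] ℝ)) (cotangentModel I) ∞ (fun X => (z X).2) 0 :=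
    contMDiffAt_cotangentDiscretization
      (contMDiff_fiberInclusion (I := cotangentModel I) α 0) (h.contMDiffAt (h.zero_mem q))
      (h.isInvertible_modelDeriv_zero q)
  have hd₁ := modelDeriv_cotangentBundle hzs.1
  have hd₂ := modelDeriv_cotangentBundle hzs.2
  rw [hz0] at hd₁ hd₂
  set D₁ := modelDeriv 𝓘(ℝ, E × (E →L[ℝ] ℝ)) (cotangentModel I) (fun X => (z X).1) 0 with hD₁
  set D₂ := modelDeriv 𝓘(ℝ, E × (E →L[ℝ] ℝ)) (cotangentModel I) (fun X => (z X).2) 0 with hD₂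
  change D₂ X - D₁ X = X
  have hs₁ : ContDiffAt ℝ ∞ f₁ y₀ := by
    have := contDiffAt_writtenInCharts (n := ⊤) (hRs q).1 (r₀ := q)
      (mem_chart_source (ModelProd H E) _) (by rw [(hR0 q).1]; exact mem_chart_source H q)
    rwa [extChartAt_zeroTangent] at this
  have hs₂ : ContDiffAt ℝ ∞ f₂ y₀ := by
    have := contDiffAt_writtenInCharts (n := ⊤) (hRs q).2 (r₀ := q)
      (mem_chart_source (ModelProd H E) _) (by rw [(hR0 q).2]; exact mem_chart_source H q)
    rwa [extChartAt_zeroTangent] at this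
  have hDD₁ : HasFDerivAt (fderiv ℝ f₁) (fderiv ℝ (fderiv ℝ f₁) y₀) y₀ :=
    ((hs₁.fderiv_right (m := ∞) le_rfl).differentiableAt (by simp)).hasFDerivAt
  have hDD₂ : HasFDerivAt (fderiv ℝ f₂) (fderiv ℝ (fderiv ℝ f₂) y₀) y₀ :=
    ((hs₂.fderiv_right (m := ∞) le_rfl).differentiableAt (by simp)).hasFDerivAt
  -- the vertical derivatives along the zero section
  have hvert : ∀ q' ∈ (chartAt H q).source, ∀ u : E,
      fderiv ℝ f₂ (extChartAt I q q', 0) (0, u) - fderiv ℝ f₁ (extChartAt I q q', 0) (0, u) = u := by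
    intro q' hq' u
    rw [fderiv_inCharts_zero ((hRs q').2.mdifferentiableAt (by simp)) (hR0 q').2 hq',
      fderiv_inCharts_zero ((hRs q').1.mdifferentiableAt (by simp)) (hR0 q').1 hq',
      h.modelDeriv_fst_zero, h.modelDeriv_snd_zero, zero_add, zero_add, ← map_sub,
      h.fiberDeriv_sub, toChart_ofChart hq']
  have hhor₁ : ∀ a : E, fderiv ℝ f₁ y₀ (a, 0) = a := fun a => by
    rw [fderiv_inCharts_zero_self ((hRs q).1.mdifferentiableAt (by simp)) (hR0 q).1,
      h.modelDeriv_fst_zero, _root_.map_zero, add_zero]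
  have hhor₂ : ∀ a : E, fderiv ℝ f₂ y₀ (a, 0) = a := fun a => by
    rw [fderiv_inCharts_zero_self ((hRs q).2.mdifferentiableAt (by simp)) (hR0 q).2,
      h.modelDeriv_snd_zero, _root_.map_zero, add_zero]
  have hmixed : ∀ a u : E, fderiv ℝ (fderiv ℝ f₂) y₀ (0, u) (a, 0) =
      fderiv ℝ (fderiv ℝ f₁) y₀ (0, u) (a, 0) := by
    intro a u
    have hsym₁ := (hs₁.isSymmSndFDerivAt
      (by simpa using WithTop.coe_le_coe.2 (le_top : (2 : ℕ∞) ≤ ⊤))) (0, u) (a, 0)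
    have hsym₂ := (hs₂.isSymmSndFDerivAt
      (by simpa using WithTop.coe_le_coe.2 (le_top : (2 : ℕ∞) ≤ ⊤))) (0, u) (a, 0)
    rw [hsym₁, hsym₂]
    have e1 : HasFDerivAt (fun x : E => (x, (0 : E))) (ContinuousLinearMap.inl ℝ E E)
      (extChartAt I q q) := hasFDerivAt_prodMk_left _ _
    have e2 := ((HasFDerivAt.comp (g := fderiv ℝ f₂) (extChartAt I q q) hDD₂ e1).clm_apply
      (hasFDerivAt_const ((0 : E), u) _)).sub
      ((HasFDerivAt.comp (g := fderiv ℝ f₁) (extChartAt I q q) hDD₁ e1).clm_apply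
      (hasFDerivAt_const ((0 : E), u) _))
    have e3 : (fun _ : E => u) =ᶠ[𝓝 (extChartAt I q q)] fun x : E =>
        (fderiv ℝ f₂ (x, 0)) (0, u) - (fderiv ℝ f₁ (x, 0)) (0, u) := by
      filter_upwards [eventually_mem_charts (I := I) (mem_chart_source H q)] with x hx
      have := hvert _ hx.2.1 u
      rw [(extChartAt I q).right_inv hx.1] at this
      exact this.symm
    have e4 := DFunLike.congr_fun
      ((e2.congr_of_eventuallyEq e3).unique (hasFDerivAt_const u _)) a
    simpa [sub_eq_zero] using e4
  -- the base components
  have hbase₁ : (D₁ X).1 = fderiv ℝ f₁ y₀ (0, X.1) := by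
    have e1 : HasFDerivAt (fun X : E × (E →L[ℝ] ℝ) => (extChartAt I q q, X.1))
        ((ContinuousLinearMap.inr ℝ E E).comp (ContinuousLinearMap.fst ℝ E (E →L[ℝ] ℝ))) 0 :=
      HasFDerivAt.comp (g := fun u : E => (extChartAt I q q, u)) (f := Prod.fst) 0
        (hasFDerivAt_prodMk_right _ _) hasFDerivAt_fst
    have e2 := HasFDerivAt.comp (g := f₁) (f := fun X : E × (E →L[ℝ] ℝ) => (extChartAt I q q, X.1))
      0 (hs₁.differentiableAt (by simp)).hasFDerivAt e1
    refine DFunLike.congr_fun (hd₁.1.unique (e2.congr_of_eventuallyEq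
      (Eventually.of_forall fun Y => ?_))) X
    simp only [hf₁, Function.comp_apply]
    rw [extChartAt_tangentBundle_symm_self (⟨q, 0⟩ : TangentBundle I M)]
    rfl
  have hbase₂ : (D₂ X).1 = fderiv ℝ f₂ y₀ (0, X.1) := by
    have e1 : HasFDerivAt (fun X : E × (E →L[ℝ] ℝ) => (extChartAt I q q, X.1))
        ((ContinuousLinearMap.inr ℝ E E).comp (ContinuousLinearMap.fst ℝ E (E →L[ℝ] ℝ))) 0 :=
      HasFDerivAt.comp (g := fun u : E => (extChartAt I q q, u)) (f := Prod.fst) 0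
        (hasFDerivAt_prodMk_right _ _) hasFDerivAt_fst
    have e2 := HasFDerivAt.comp (g := f₂) (f := fun X : E × (E →L[ℝ] ℝ) => (extChartAt I q q, X.1))
      0 (hs₂.differentiableAt (by simp)).hasFDerivAt e1
    refine DFunLike.congr_fun (hd₂.1.unique (e2.congr_of_eventuallyEq
      (Eventually.of_forall fun Y => ?_))) X
    simp only [hf₂, Function.comp_apply]
    rw [extChartAt_tangentBundle_symm_self (⟨q, 0⟩ : TangentBundle I M)]
    rfl
  refine Prod.ext ?_ (ContinuousLinearMap.ext fun a => ?_)
  · rw [Prod.fst_sub, hbase₁, hbase₂]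
    exact hvert q (mem_chart_source H q) X.1
  -- the fibre components
  have hP₁ : (covec (z 0).1).comp (ofChart I q (z 0).1.proj) = covec α := by
    rw [hz0, ofChart_self, ContinuousLinearMap.comp_id]
  have hP₂ : (covec (z 0).2).comp (ofChart I q (z 0).2.proj) = covec α := by
    rw [hz0, ofChart_self, ContinuousLinearMap.comp_id]
  have e1 : HasFDerivAt (fun X : E × (E →L[ℝ] ℝ) => (extChartAt I q q, X.1))
      ((ContinuousLinearMap.inr ℝ E E).comp (ContinuousLinearMap.fst ℝ E (E →L[ℝ] ℝ))) 0 :=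
    HasFDerivAt.comp (g := fun u : E => (extChartAt I q q, u)) (f := Prod.fst) 0
      (hasFDerivAt_prodMk_right _ _) hasFDerivAt_fst
  have e2 := (hd₂.2.clm_apply ((HasFDerivAt.comp (g := fderiv ℝ f₂)
      (f := fun X : E × (E →L[ℝ] ℝ) => (extChartAt I q q, X.1)) 0 hDD₂ e1).clm_apply
      (hasFDerivAt_const (a, (0 : E)) _))).sub
    (hd₁.2.clm_apply ((HasFDerivAt.comp (g := fderiv ℝ f₁)
      (f := fun X : E × (E →L[ℝ] ℝ) => (extChartAt I q q, X.1)) 0 hDD₁ e1).clm_apply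
      (hasFDerivAt_const (a, (0 : E)) _)))
  have e3 : (fun X : E × (E →L[ℝ] ℝ) => X.2 a) =ᶠ[𝓝 0] fun X =>
      ((covec (z X).2).comp (ofChart I q (z X).2.proj))
        (fderiv ℝ f₂ (extChartAt I q q, X.1) (a, 0)) -
      ((covec (z X).1).comp (ofChart I q (z X).1.proj))
        (fderiv ℝ f₁ (extChartAt I q q, X.1) (a, 0)) := by
    have hv : ContinuousAt (fun X : E × (E →L[ℝ] ℝ) => fiberInclusion I q X.1) 0 :=
      ((contMDiff_fiberInclusion (I := I) q).continuous.comp continuous_fst).continuousAt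
    have hR := h.contMDiffAt (h.zero_mem q)
    have c1 : ∀ᶠ X : E × (E →L[ℝ] ℝ) in 𝓝 0,
        ContMDiffAt I.tangent (I.prod I) 1 R (fiberInclusion I q X.1) :=
      hv.eventually ((contMDiffAt_iff_contMDiffAt_nhds (n := 1) (by simp)).1
        (hR.of_le (by simp)))
    have c2 : ∀ᶠ X : E × (E →L[ℝ] ℝ) in 𝓝 0,
        (modelDeriv I.tangent (I.prod I) R (fiberInclusion I q X.1)).IsInvertible :=
      hv.eventually (eventually_isInvertible_modelDeriv (hR.of_le (by simp))
        (h.isInvertible_modelDeriv_zero q))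
    have c3 : ∀ᶠ X : E × (E →L[ℝ] ℝ) in 𝓝 0,
        (R (fiberInclusion I q X.1)).1 ∈ (chartAt H q).source :=
      hv.eventually ((hRs q).1.continuousAt.eventually ((chartAt H q).open_source.eventually_mem
        ((congrArg (· ∈ (chartAt H q).source) (hR0 q).1).mpr (mem_chart_source H q))))
    have c4 : ∀ᶠ X : E × (E →L[ℝ] ℝ) in 𝓝 0,
        (R (fiberInclusion I q X.1)).2 ∈ (chartAt H q).source :=
      hv.eventually ((hRs q).2.continuousAt.eventually ((chartAt H q).open_source.eventually_mem
        ((congrArg (· ∈ (chartAt H q).source) (hR0 q).2).mpr (mem_chart_source H q))))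
    filter_upwards [c1, c2, c3, c4] with X h1 h2 h3 h4
    have hmd := h1.mdifferentiableAt one_ne_zero
    have hmem : fiberInclusion I q X.1 ∈
        (chartAt (ModelProd H E) (⟨q, 0⟩ : TangentBundle I M)).source :=
      mem_chart_tangentBundle.2 (mem_chart_source H q)
    have hy : extChartAt I.tangent (⟨q, 0⟩ : TangentBundle I M) (fiberInclusion I q X.1) =
      (extChartAt I q q, X.1) := extChartAt_tangentBundle_self (⟨q, 0⟩ : TangentBundle I M) X.1
    have d1 := toChart_comp_modelDeriv (I := I.tangent) (I' := I)
      (f := fun v => (R v).1) (hmd.fst) hmem h3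
    have d2 := toChart_comp_modelDeriv (I := I.tangent) (I' := I)
      (f := fun v => (R v).2) (hmd.snd) hmem h4
    rw [hy, modelDeriv_fst_comp hmd] at d1
    rw [hy, modelDeriv_snd_comp hmd] at d2
    have hpair := cotangentDiscretization_pairing (R := R)
      (X := fiberInclusion (cotangentModel I) α X) h2 (ofChart I.tangent
        (⟨q, 0⟩ : TangentBundle I M) (fiberInclusion I q X.1) (a, 0))
    have hcov := DFunLike.congr_fun (covec_tulczyjew_comp_ofChart (α₀ := α) 0
      (X := fiberInclusion (cotangentModel I) α X) (mem_chart_source H q)) (a, 0)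
    have hself : (toChart (cotangentModel I) α α : E × (E →L[ℝ] ℝ) →L[ℝ] E × (E →L[ℝ] ℝ)) X = X := by
      rw [toChart_self]; rfl
    have hcov' : covec (tulczyjew I (fiberInclusion (cotangentModel I) α X))
        (ofChart I.tangent (⟨q, 0⟩ : TangentBundle I M) (fiberInclusion I q X.1) (a, 0)) =
        (toChart (cotangentModel I) α α X).2 a + covec α (ofChart I q q 0) := hcov
    rw [hself, _root_.map_zero, _root_.map_zero, add_zero] at hcov'
    rw [d1, d2]
    simp only [ContinuousLinearMap.comp_apply]
    have o1 : ∀ b : E, ofChart I q (z X).1.proj (toChart I q (R (fiberInclusion I q X.1)).1 b) =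
      b := fun b => ofChart_toChart h3 b
    have o2 : ∀ b : E, ofChart I q (z X).2.proj (toChart I q (R (fiberInclusion I q X.1)).2 b) =
      b := fun b => ofChart_toChart h4 b
    rw [o1, o2]
    refine Eq.trans ?_ hpair.symm
    exact hcov'.symm
  have e4 := DFunLike.congr_fun ((e2.congr_of_eventuallyEq e3).unique
    (((ContinuousLinearMap.apply ℝ ℝ a).comp
      (ContinuousLinearMap.snd ℝ E (E →L[ℝ] ℝ))).hasFDerivAt)) X
  simp only [ContinuousLinearMap.comp_zero, zero_add, sub_apply, add_apply,
    ContinuousLinearMap.comp_apply, ContinuousLinearMap.flip_apply] at e4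
  have e5 : ((covec (z 0).2).comp (ofChart I q (z 0).2.proj))
        (fderiv ℝ (fderiv ℝ f₂) y₀ (0, X.1) (a, 0)) + (D₂ X).2 (fderiv ℝ f₂ y₀ (a, 0)) -
      (((covec (z 0).1).comp (ofChart I q (z 0).1.proj))
        (fderiv ℝ (fderiv ℝ f₁) y₀ (0, X.1) (a, 0)) + (D₁ X).2 (fderiv ℝ f₁ y₀ (a, 0))) =
      X.2 a := e4
  rw [hP₁, hP₂, hhor₁, hhor₂, hmixed, add_sub_add_left_eq_sub] at e5
  exact e5

/-- The cotangent lift of a discretization map on `M` is a discretization map on `T^*M`. -/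
theorem isDiscretizationMap_cotangentDiscretization [FiniteDimensional ℝ E]
    (h : IsDiscretizationMap I U R) :
    IsDiscretizationMap (cotangentModel I) (cotangentDiscretizationDomain I U R)
      (cotangentDiscretization I R) where
  isOpen := by
    have := FiniteDimensional.complete ℝ E
    refine isOpen_iff_mem_nhds.2 fun X hX => ?_
    have hR := h.contMDiffAt hX.1
    have hc : ContinuousAt (fun X => (tulczyjew I X).proj) X :=
      (contMDiffAt_tulczyjew_comp (J := (cotangentModel I).tangent)
        (contMDiffAt_id (x := X))).1.continuousAt
    filter_upwards [hc.eventually (h.isOpen.eventually_mem hX.1),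
      hc.eventually (eventually_isInvertible_modelDeriv (hR.of_le (by simp)) hX.2)] with Y h1 h2
    exact ⟨h1, h2⟩
  zero_mem := zero_mem_cotangentDiscretizationDomain h
  smooth := by
    have := FiniteDimensional.complete ℝ E
    intro X hX
    obtain ⟨h1, h2⟩ := contMDiffAt_cotangentDiscretization (J := (cotangentModel I).tangent)
      (contMDiffAt_id (x := X)) (h.contMDiffAt hX.1) hX.2
    exact (h1.prodMk h2).contMDiffWithinAt
  map_zero := cotangentDiscretization_zero h
  rigidity := cotangentDiscretization_rigidity h

end CotangentDiscretization

section LocalDiffeomorphism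

variable {E : Type*} [NormedAddCommGroup E] [NormedSpace ℝ E]
  {H : Type*} [TopologicalSpace H] {I : ModelWithCorners ℝ E H} [I.Boundaryless]
  {M : Type*} [TopologicalSpace M] [ChartedSpace H M] [IsManifold I ∞ M]
  {F : Type*} [NormedAddCommGroup F] [NormedSpace ℝ F]
  {G : Type*} [TopologicalSpace G] {J : ModelWithCorners ℝ F G} [J.Boundaryless]
  {N : Type*} [TopologicalSpace N] [ChartedSpace G N] [IsManifold J ∞ N]

/-- A local inverse of a smooth map with invertible derivative is smooth. -/
lemma contMDiffAt_localInverse [CompleteSpace E] {f : M → N} (hf : ContMDiff I J ∞ f)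
    (hi : ∀ x, (modelDeriv I J f x).IsInvertible) {σ : OpenPartialHomeomorph M N}
    (hσ : EqOn σ f σ.source) {y : N} (hy : y ∈ σ.target) : ContMDiffAt J I ∞ σ.symm y := by
  obtain ⟨τ, h1, h2, h3, h4⟩ := exists_localInverse σ.open_source (σ.map_target hy)
    hf.contMDiffOn (hi (σ.symm y))
  have h5 : τ (σ.symm y) = y := by
    rw [h3 h1, ← hσ (σ.map_target hy), σ.right_inv hy]
  have hyt : τ.target ∈ 𝓝 y := τ.open_target.mem_nhds (h5 ▸ τ.map_source h1)
  refine (h4.contMDiffAt hyt).congr_of_eventuallyEq ?_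
  filter_upwards [hyt] with z hz
  have h6 := τ.map_target hz
  conv_lhs => rw [← τ.right_inv hz, h3 h6, ← hσ (h2 h6), σ.left_inv (h2 h6)]

/-- The pull-back of a discretization map along a local diffeomorphism is a discretization map. -/
theorem IsDiscretizationMap.pullback [CompleteSpace E] {V : Set (TangentBundle J N)}
    {S : TangentBundle J N → N × N} (h : IsDiscretizationMap J V S) {f : M → N}
    (hf : ContMDiff I J ∞ f) (hi : ∀ x, (modelDeriv I J f x).IsInvertible)
    {W : Set (TangentBundle I M)} {R : TangentBundle I M → M × M} (hW : IsOpen W)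
    (h0 : ∀ x, (⟨x, 0⟩ : TangentBundle I M) ∈ W) (hdom : ∀ w ∈ W, tangentMap I J f w ∈ V)
    (heq : ∀ w ∈ W, ∃ σ : OpenPartialHomeomorph M N, w.proj ∈ σ.source ∧ EqOn σ f σ.source ∧
      ∀ᶠ w' in 𝓝 w, (S (tangentMap I J f w')).1 ∈ σ.target ∧
        (S (tangentMap I J f w')).2 ∈ σ.target ∧
        R w' = (σ.symm (S (tangentMap I J f w')).1, σ.symm (S (tangentMap I J f w')).2)) :
    IsDiscretizationMap I W R := by
  have htm : ∀ (x : M) (u : E),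
      tangentMap I J f ⟨x, u⟩ = fiberInclusion J (f x) (modelDeriv I J f x u) := fun x u => rfl
  have htz : ∀ x : M, tangentMap I J f ⟨x, 0⟩ = ⟨f x, 0⟩ := fun x =>
    (htm x 0).trans (by rw [_root_.map_zero]; rfl)
  have hmap : ∀ x : M, R ⟨x, 0⟩ = (x, x) := by
    intro x
    obtain ⟨σ, h1, h2, h3⟩ := heq _ (h0 x)
    obtain ⟨-, -, h4⟩ := h3.self_of_nhds
    have h5 : σ.symm (f x) = x := by rw [← h2 h1]; exact σ.left_inv h1
    rw [h4, htz, h.map_zero, h5]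
  have hsm : ∀ w ∈ W, ContMDiffAt I.tangent (I.prod I) ∞ R w := by
    intro w hw
    obtain ⟨σ, h1, h2, h3⟩ := heq w hw
    obtain ⟨h4, h5, -⟩ := h3.self_of_nhds
    have hT : ContMDiffAt I.tangent J.tangent ∞ (tangentMap I J f) w :=
      (hf.contMDiff_tangentMap (m := ∞) le_rfl) w
    have hS : ContMDiffAt I.tangent (J.prod J) ∞ (fun w => S (tangentMap I J f w)) w :=
      (h.contMDiffAt (hdom w hw)).comp w hT
    have h6 : ContMDiffAt I.tangent I ∞ (fun w => σ.symm (S (tangentMap I J f w)).1) w :=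
      ContMDiffAt.comp (I' := J) w (contMDiffAt_localInverse hf hi h2 h4)
        (contMDiffAt_fst.comp w hS)
    have h7 : ContMDiffAt I.tangent I ∞ (fun w => σ.symm (S (tangentMap I J f w)).2) w :=
      ContMDiffAt.comp (I' := J) w (contMDiffAt_localInverse hf hi h2 h5)
        (contMDiffAt_snd.comp w hS)
    exact (h6.prodMk h7).congr_of_eventuallyEq (h3.mono fun w' hw' => hw'.2.2)
  refine ⟨hW, h0, fun w hw => (hsm w hw).contMDiffWithinAt, hmap, fun x v => ?_⟩
  have hR : ContMDiffAt 𝓘(ℝ, E) (I.prod I) ∞ (fun u : E => R ⟨x, u⟩) 0 :=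
    (hsm _ (h0 x)).comp (0 : E) (contMDiff_fiberInclusion (I := I) x 0)
  have hS : ContMDiffAt 𝓘(ℝ, F) (J.prod J) ∞ (fun u : F => S ⟨f x, u⟩) 0 :=
    (h.contMDiffAt (h.zero_mem (f x))).comp (0 : F) (contMDiff_fiberInclusion (I := J) (f x) 0)
  have hRd := hR.mdifferentiableAt (by simp)
  have hSd := hS.mdifferentiableAt (by simp)
  have hfd := (hf x).mdifferentiableAt (by simp)
  have hDd : MDifferentiableAt 𝓘(ℝ, E) 𝓘(ℝ, F) (modelDeriv I J f x) 0 :=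
    (modelDeriv I J f x).mdifferentiableAt
  have hD : modelDeriv 𝓘(ℝ, E) 𝓘(ℝ, F) (modelDeriv I J f x) 0 = modelDeriv I J f x := by
    rw [modelDeriv_eq_fderiv, ContinuousLinearMap.fderiv]
  obtain ⟨σ, h1, h2, h3⟩ := heq _ (h0 x)
  have hc : ContinuousAt (fiberInclusion I x) 0 :=
    (contMDiff_fiberInclusion (I := I) x).continuous.continuousAt
  have hev := hc.eventually h3
  have e1 : (f ∘ fun u : E => (R ⟨x, u⟩).1) =ᶠ[𝓝 0]
      (fun u : F => (S ⟨f x, u⟩).1) ∘ modelDeriv I J f x := by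
    filter_upwards [hev] with u hu
    have h5 : (R ⟨x, u⟩).1 = _ := congrArg Prod.fst hu.2.2
    rw [Function.comp_apply, h5, ← h2 (σ.map_target hu.1), σ.right_inv hu.1]
    rfl
  have e2 : (f ∘ fun u : E => (R ⟨x, u⟩).2) =ᶠ[𝓝 0]
      (fun u : F => (S ⟨f x, u⟩).2) ∘ modelDeriv I J f x := by
    filter_upwards [hev] with u hu
    have h5 : (R ⟨x, u⟩).2 = _ := congrArg Prod.snd hu.2.2
    rw [Function.comp_apply, h5, ← h2 (σ.map_target hu.2.1), σ.right_inv hu.2.1]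
    rfl
  have d1 := modelDeriv_congr (I := 𝓘(ℝ, E)) (I' := J) e1
  have d2 := modelDeriv_congr (I := 𝓘(ℝ, E)) (I' := J) e2
  rw [modelDeriv_comp_of_eq hfd hRd.fst (congrArg Prod.fst (hmap x)),
    modelDeriv_comp_of_eq hSd.fst hDd (_root_.map_zero _), hD] at d1
  rw [modelDeriv_comp_of_eq hfd hRd.snd (congrArg Prod.snd (hmap x)),
    modelDeriv_comp_of_eq hSd.snd hDd (_root_.map_zero _), hD] at d2
  refine (hi x).injective ?_
  change modelDeriv I J f x (fiberDeriv₂ R x v - fiberDeriv₁ R x v) = _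
  have d1' : modelDeriv I J f x (fiberDeriv₁ R x v) =
    fiberDeriv₁ S (f x) (modelDeriv I J f x v) := DFunLike.congr_fun d1 v
  have d2' : modelDeriv I J f x (fiberDeriv₂ R x v) =
    fiberDeriv₂ S (f x) (modelDeriv I J f x v) := DFunLike.congr_fun d2 v
  rw [map_sub, d1', d2', h.fiberDeriv_sub]

end LocalDiffeomorphism

section LagrangianLift

variable {E : Type*} [NormedAddCommGroup E] [NormedSpace ℝ E] [FiniteDimensional ℝ E]
  {H : Type*} [TopologicalSpace H] {I : ModelWithCorners ℝ E H} [I.Boundaryless]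
  {M : Type*} [TopologicalSpace M] [ChartedSpace H M] [IsManifold I ∞ M]
  {U : Set (TangentBundle I M)} {Rd : TangentBundle I M → M × M}
  {L : TangentBundle I M → ℝ} {W : Set (TangentBundle I.tangent (TangentBundle I M))}
  {R : TangentBundle I.tangent (TangentBundle I M) → TangentBundle I M × TangentBundle I M}

theorem IsLagrangianLift.isDiscretizationMap (h : IsDiscretizationMap I U Rd)
    (hL : IsRegularLagrangian I L) (hR : IsLagrangianLift I L U Rd W R) :
    IsDiscretizationMap I.tangent W R :=
  have := FiniteDimensional.complete ℝ E
  (isDiscretizationMap_cotangentDiscretization h).pullback (contMDiff_legendre hL.smooth)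
    (isInvertible_modelDeriv_legendre hL) hR.isOpen hR.zero_mem hR.mem_domain hR.eq_comp

end LagrangianLift

section Integrator

variable {E : Type*} [NormedAddCommGroup E] [NormedSpace ℝ E]
  {H : Type*} [TopologicalSpace H] {I : ModelWithCorners ℝ E H}
  {M : Type*} [TopologicalSpace M] [ChartedSpace H M] [IsManifold I ∞ M]
  {Γ : ∀ x : M, TangentSpace I x}

omit [IsManifold I ∞ M] in
lemma tangent_ext {v w : TangentBundle I M} (h : v.proj = w.proj) (h' : vec v = vec w) :
    v = w := by
  obtain ⟨q, p⟩ := v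
  obtain ⟨q', p'⟩ := w
  obtain rfl : q = q' := h
  obtain rfl : p = p' := h'
  rfl

/-- The components of a vector field in the preferred charts. -/
def components (Γ : ∀ x : M, TangentSpace I x) (x : M) : E := Γ x

/-- The map `(h, y) ↦ h Γ(y)`. -/
def scaledField (Γ : ∀ x : M, TangentSpace I x) (z : ℝ × M) : TangentBundle I M :=
  ⟨z.2, z.1 • Γ z.2⟩

lemma contMDiff_scaledField (hΓ : ContMDiff I I.tangent ∞ fun x => (⟨x, Γ x⟩ : TangentBundle I M)) :
    ContMDiff (𝓘(ℝ, ℝ).prod I) I.tangent ∞ (scaledField Γ) := by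
  intro z₀
  refine contMDiffAt_tangentBundle.2 ⟨contMDiffAt_snd, ?_⟩
  have h1 := (contMDiffAt_tangentBundle.1 (hΓ z₀.2)).2
  have h2 : ContMDiffAt (𝓘(ℝ, ℝ).prod I) 𝓘(ℝ, E) ∞
      (fun z : ℝ × M => toChart I z₀.2 z.2 (Γ z.2)) z₀ := h1.comp z₀ contMDiffAt_snd
  have h3 : ContMDiffAt (𝓘(ℝ, ℝ).prod I) 𝓘(ℝ, E) ∞
      (fun z : ℝ × M => z.1 • toChart I z₀.2 z.2 (Γ z.2)) z₀ := contMDiffAt_fst.smul h2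
  refine h3.congr_of_eventuallyEq (Eventually.of_forall fun z => ?_)
  exact (toChart I z₀.2 z.2).map_smul z.1 (components Γ z.2)

omit [IsManifold I ∞ M] in
lemma scaledField_zero (y : M) : scaledField Γ (0, y) = (⟨y, 0⟩ : TangentBundle I M) :=
  tangent_ext rfl (zero_smul ℝ (components Γ y))

variable [I.Boundaryless]

lemma modelDeriv_scaledField
    (hΓ : ContMDiff I I.tangent ∞ fun x => (⟨x, Γ x⟩ : TangentBundle I M)) (x : M) (s : ℝ) (w : E) :
    modelDeriv (𝓘(ℝ, ℝ).prod I) I.tangent (scaledField Γ) (0, x) (s, w) = (w, s • components Γ x) := by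
  have hg := (contMDiff_scaledField hΓ (0, x)).mdifferentiableAt (by simp)
  have hidM : MDifferentiableAt I I (fun y : M => y) x := mdifferentiableAt_id
  have hidR : MDifferentiableAt 𝓘(ℝ, ℝ) 𝓘(ℝ, ℝ) (fun h : ℝ => h) 0 := mdifferentiableAt_id
  have hidM' : modelDeriv I I (fun y : M => y) x = ContinuousLinearMap.id ℝ E := modelDeriv_id x
  have hidR' : modelDeriv 𝓘(ℝ, ℝ) 𝓘(ℝ, ℝ) (fun h : ℝ => h) 0 = ContinuousLinearMap.id ℝ ℝ :=
    modelDeriv_id 0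
  have h1 := modelDeriv_comp (I := I) (f := fun y : M => ((0 : ℝ), y)) (x := x) hg
    (mdifferentiableAt_const.prodMk hidM)
  have h2 := modelDeriv_comp (I := 𝓘(ℝ, ℝ)) (f := fun h : ℝ => (h, x)) (x := 0) hg
    (hidR.prodMk mdifferentiableAt_const)
  have e1 : scaledField Γ ∘ (fun y : M => ((0 : ℝ), y)) =
    fun y : M => (⟨y, 0⟩ : TangentBundle I M) := funext scaledField_zero
  have e2 : scaledField Γ ∘ (fun h : ℝ => (h, x)) =
    fiberInclusion I x ∘ fun h : ℝ => h • components Γ x := rfl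
  have e3 : HasFDerivAt (fun h : ℝ => h • components Γ x)
    ((ContinuousLinearMap.id ℝ ℝ).smulRight (components Γ x)) 0 := (hasFDerivAt_id 0).smul_const _
  rw [e1, modelDeriv_zeroTangent, modelDeriv_prodMk mdifferentiableAt_const hidM,
    modelDeriv_const, hidM'] at h1
  rw [e2, modelDeriv_comp ((contMDiff_fiberInclusion (I := I) x _).mdifferentiableAt (by simp))
    e3.differentiableAt.mdifferentiableAt, modelDeriv_fiberInclusion, modelDeriv_eq_fderiv,
    e3.fderiv, modelDeriv_prodMk hidR mdifferentiableAt_const,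
    modelDeriv_const, hidR'] at h2
  have h3 : modelDeriv (𝓘(ℝ, ℝ).prod I) I.tangent (scaledField Γ) (0, x) (0, w) = (w, 0) :=
    (DFunLike.congr_fun h1 w).symm
  have h4 : modelDeriv (𝓘(ℝ, ℝ).prod I) I.tangent (scaledField Γ) (0, x) (s, 0) =
      (0, s • components Γ x) :=
    (DFunLike.congr_fun h2 s).symm
  have h5 : ((s, w) : ℝ × E) = (s, 0) + (0, w) := by simp
  rw [h5, map_add, h3, h4]
  simp

/-- A discretization map defines, for every smooth vector field, a one-step integrator. -/
theorem IsDiscretizationMap.isIntegrator [FiniteDimensional ℝ E] {U : Set (TangentBundle I M)}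
    {R : TangentBundle I M → M × M} (h : IsDiscretizationMap I U R)
    (hΓ : ContMDiff I I.tangent ∞ fun x => (⟨x, Γ x⟩ : TangentBundle I M)) :
    IsIntegrator I Γ U R := by
  have := FiniteDimensional.complete ℝ E
  intro x
  have hg := contMDiff_scaledField hΓ
  set S : Set (ℝ × M) := scaledField Γ ⁻¹' U with hS
  have hSo : IsOpen S := h.isOpen.preimage hg.continuous
  have hS0 : ∀ y : M, ((0 : ℝ), y) ∈ S := fun y => by
    rw [hS, mem_preimage, scaledField_zero]; exact h.zero_mem y
  set r : ℝ × M → M × M := fun z => R (scaledField Γ z) with hr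
  have hrs : ContMDiffOn (𝓘(ℝ, ℝ).prod I) (I.prod I) ∞ r S := h.smooth.comp hg.contMDiffOn
    fun z hz => hz
  have hr0 : ∀ y : M, r (0, y) = (y, y) := fun y => by
    rw [hr]; exact (congrArg R (scaledField_zero y)).trans (h.map_zero y)
  have hrd : ∀ (y : M), MDifferentiableAt (𝓘(ℝ, ℝ).prod I) (I.prod I) r (0, y) := fun y =>
    (hrs.contMDiffAt (hSo.mem_nhds (hS0 y))).mdifferentiableAt (by simp)
  have hdr : ∀ (y : M) (s : ℝ) (w : E), modelDeriv (𝓘(ℝ, ℝ).prod I) (I.prod I) r (0, y) (s, w) =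
      (w + fiberDeriv₁ R y (s • components Γ y), w + fiberDeriv₂ R y (s • components Γ y)) := by
    intro y s w
    have h1 := modelDeriv_comp_of_eq (I := 𝓘(ℝ, ℝ).prod I) (I' := I.tangent) (I'' := I.prod I)
      (g := R) (f := scaledField Γ) (x := (0, y)) (y := ⟨y, 0⟩)
      ((h.contMDiffAt (h.zero_mem y)).mdifferentiableAt (by simp))
      ((hg (0, y)).mdifferentiableAt (by simp)) (scaledField_zero y)
    refine (DFunLike.congr_fun h1 (s, w)).trans ?_
    rw [ContinuousLinearMap.comp_apply, modelDeriv_scaledField hΓ, h.modelDeriv_zero]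
  set f : ℝ × M → ℝ × M := fun z => (z.1, (r z).1) with hf
  have hfs : ContMDiffOn (𝓘(ℝ, ℝ).prod I) (𝓘(ℝ, ℝ).prod I) ∞ f S :=
    contMDiffOn_fst.prodMk (contMDiff_fst.comp_contMDiffOn hrs)
  have hinv : (modelDeriv (𝓘(ℝ, ℝ).prod I) (𝓘(ℝ, ℝ).prod I) f (0, x)).IsInvertible := by
    have hd : ∀ Z : ℝ × E, modelDeriv (𝓘(ℝ, ℝ).prod I) (𝓘(ℝ, ℝ).prod I) f (0, x) Z =
        (Z.1, Z.2 + fiberDeriv₁ R x (Z.1 • components Γ x)) := fun Z => by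
      rw [hf, modelDeriv_prodMk mdifferentiableAt_fst (hrd x).fst, modelDeriv_fst_comp (hrd x)]
      refine Prod.ext ?_ ?_
      · have : modelDeriv (𝓘(ℝ, ℝ).prod I) 𝓘(ℝ, ℝ) (fun z : ℝ × M => z.1) (0, x) =
          ContinuousLinearMap.fst ℝ ℝ E := mfderiv_fst
        exact DFunLike.congr_fun this Z
      · exact congrArg Prod.fst (hdr x Z.1 Z.2)
    refine isInvertible_of_injective ((injective_iff_map_eq_zero _).2 fun Z hZ => ?_) rfl
    rw [hd Z] at hZ
    obtain ⟨h1, h2⟩ := Prod.ext_iff.1 hZ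
    simp only [Prod.fst_zero, Prod.snd_zero] at h1 h2
    rw [h1, zero_smul, _root_.map_zero, add_zero] at h2
    exact Prod.ext h1 h2
  obtain ⟨σ, hx, hσS, hσ, hσs⟩ := exists_localInverse hSo (hS0 x) hfs hinv
  have hf0 : ∀ y : M, f (0, y) = (0, y) := fun y => by rw [hf]; simp only [hr0]
  have hσx : σ (0, x) = (0, x) := (hσ hx).trans (hf0 x)
  have hxt : (0, x) ∈ σ.target := hσx ▸ σ.map_source hx
  have hσx' : σ.symm (0, x) = (0, x) := by
    conv_lhs => rw [← hσx]
    exact σ.left_inv hx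
  have hsymm : ∀ p ∈ σ.target, (σ.symm p).1 = p.1 ∧ (r (σ.symm p)).1 = p.2 := by
    intro p hp
    have h1 : ((σ.symm p).1, (r (σ.symm p)).1) = p := by
      change f (σ.symm p) = p
      rw [← hσ (σ.map_target hp), σ.right_inv hp]
    exact Prod.ext_iff.1 h1
  obtain ⟨A, N, hA, hN, hA0, hxN, hAN⟩ := isOpen_prod_iff.1 σ.open_source 0 x hx
  have hpre : σ.target ∩ σ.symm ⁻¹' (A ×ˢ N) ∈ 𝓝 ((0 : ℝ), x) := by
    refine (σ.isOpen_inter_preimage_symm (hA.prod hN)).mem_nhds ⟨hxt, ?_⟩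
    rw [mem_preimage, hσx']
    exact ⟨hA0, hxN⟩
  obtain ⟨B, hB, V', hV', hBV⟩ := mem_nhds_prod_iff.1 hpre
  obtain ⟨h₀, hh₀, hball⟩ := Metric.mem_nhds_iff.1 hB
  obtain ⟨V, hVV', hV, hxV⟩ := mem_nhds_iff.1 hV'
  have hbox : ∀ z ∈ Ioo (-h₀) h₀ ×ˢ V, z ∈ σ.target ∧ σ.symm z ∈ A ×ˢ N := by
    intro z hz
    refine hBV ⟨hball ?_, hVV' hz.2⟩
    rw [Real.ball_eq_Ioo, zero_sub, zero_add]
    exact hz.1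
  refine ⟨h₀, hh₀, V, N, hV, hxV, hN, hxN, fun s y => (r (s, (σ.symm (s, y)).2)).2,
    fun s y => (σ.symm (s, y)).2, ?_, ?_, ?_, ?_⟩
  · have h1 : ContMDiffOn (𝓘(ℝ, ℝ).prod I) I ∞ (fun z => (r (σ.symm z)).2)
        (Ioo (-h₀) h₀ ×ˢ V) :=
      contMDiff_snd.comp_contMDiffOn (hrs.comp (hσs.mono fun z hz => (hbox z hz).1)
        fun z hz => hσS (σ.map_target (hbox z hz).1))
    refine h1.congr fun z hz => ?_
    exact congrArg (fun p => (r p).2) (Prod.ext (hsymm z (hbox z hz).1).1.symm rfl :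
      ((z.1, (σ.symm z).2) : ℝ × M) = σ.symm z)
  · exact contMDiff_snd.comp_contMDiffOn (hσs.mono fun z hz => (hbox z hz).1)
  · intro s hs x₀ hx₀ x₁ y
    have hb := hbox (s, x₀) ⟨hs, hx₀⟩
    have hsy := hsymm _ hb.1
    constructor
    · rintro ⟨hyN, hyU, hyR⟩
      have hyR' : r (s, y) = (x₀, x₁) := hyR
      have h1 : (s, y) ∈ σ.source := hAN ⟨hsy.1 ▸ hb.2.1, hyN⟩
      have h2 : σ (s, y) = (s, x₀) := by
        rw [hσ h1, hf]
        simp only [hyR']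
      have h3 : σ.symm (s, x₀) = (s, y) := by rw [← h2, σ.left_inv h1]
      simp only [h3, hyR', and_self]
    · rintro ⟨rfl, rfl⟩
      have h3 : ((s, (σ.symm (s, x₀)).2) : ℝ × M) = σ.symm (s, x₀) :=
        Prod.ext hsy.1.symm rfl
      refine ⟨hb.2.2, ?_, ?_⟩
      · have h4 : σ.symm (s, x₀) ∈ S := hσS (σ.map_target hb.1)
        rw [← h3] at h4
        exact h4
      · change r (s, (σ.symm (s, x₀)).2) = (x₀, _)
        refine Prod.ext ?_ rfl
        rw [h3]
        exact hsy.2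
  · intro x₀ hx₀
    have hI : Ioo (-h₀) h₀ ∈ 𝓝 (0 : ℝ) := Ioo_mem_nhds (neg_lt_zero.2 hh₀) hh₀
    have hb : ∀ s ∈ Ioo (-h₀) h₀, _ := fun s hs => hbox (s, x₀) ⟨hs, hx₀⟩
    have hb0 := hb 0 ⟨neg_lt_zero.2 hh₀, hh₀⟩
    set c : ℝ → M := fun s => (σ.symm (s, x₀)).2 with hc
    have hc' : ∀ s ∈ Ioo (-h₀) h₀, (s, c s) = σ.symm (s, x₀) := fun s hs =>
      Prod.ext (hsymm _ (hb s hs).1).1.symm rfl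
    have hc0 : c 0 = x₀ := by
      have h1 := (hsymm _ hb0.1).2
      rw [← hc' 0 ⟨neg_lt_zero.2 hh₀, hh₀⟩, hr0] at h1
      exact h1
    have hcs : MDifferentiableAt 𝓘(ℝ, ℝ) I c 0 := by
      have h1 := (hσs.contMDiffAt (σ.open_target.mem_nhds hb0.1)).mdifferentiableAt (by simp)
      exact (h1.comp (0 : ℝ) (f := fun s : ℝ => (s, x₀))
        (mdifferentiableAt_id.prodMk mdifferentiableAt_const)).snd
    have hidR : MDifferentiableAt 𝓘(ℝ, ℝ) 𝓘(ℝ, ℝ) (fun s : ℝ => s) 0 := mdifferentiableAt_id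
    have hidR' : modelDeriv 𝓘(ℝ, ℝ) 𝓘(ℝ, ℝ) (fun s : ℝ => s) 0 = ContinuousLinearMap.id ℝ ℝ :=
      modelDeriv_id 0
    have hk : MDifferentiableAt 𝓘(ℝ, ℝ) (𝓘(ℝ, ℝ).prod I) (fun s : ℝ => (s, c s)) 0 :=
      hidR.prodMk hcs
    have hdk := modelDeriv_comp_of_eq (I := 𝓘(ℝ, ℝ)) (g := r) (y := (0, x₀)) (hrd x₀) hk
      (by rw [hc0])
    rw [modelDeriv_prodMk hidR hcs] at hdk
    have hrk : MDifferentiableAt 𝓘(ℝ, ℝ) (I.prod I) (r ∘ fun s : ℝ => (s, c s)) 0 :=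
      MDifferentiableAt.comp_of_eq (0 : ℝ) (hrd x₀) hk (by rw [hc0])
    have hdk1 : modelDeriv 𝓘(ℝ, ℝ) (I.prod I) (r ∘ fun s : ℝ => (s, c s)) 0 1 =
        (modelDeriv 𝓘(ℝ, ℝ) I c 0 1 + fiberDeriv₁ R x₀ (components Γ x₀),
          modelDeriv 𝓘(ℝ, ℝ) I c 0 1 + fiberDeriv₂ R x₀ (components Γ x₀)) := by
      rw [hdk, ContinuousLinearMap.comp_apply, ContinuousLinearMap.prod_apply, hdr, hidR',
        ContinuousLinearMap.id_apply, one_smul]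
    have hconst : (fun s : ℝ => ((r ∘ fun s : ℝ => (s, c s)) s).1) =ᶠ[𝓝 0] fun _ => x₀ := by
      filter_upwards [hI] with s hs
      rw [Function.comp_apply, hc' s hs]
      exact (hsymm _ (hb s hs).1).2
    have h1 := modelDeriv_congr (I := 𝓘(ℝ, ℝ)) (I' := I) hconst
    rw [modelDeriv_const, modelDeriv_fst_comp hrk] at h1
    have h2 : modelDeriv 𝓘(ℝ, ℝ) I c 0 1 + fiberDeriv₁ R x₀ (components Γ x₀) = 0 :=
      (congrArg Prod.fst hdk1).symm.trans (DFunLike.congr_fun h1 1)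
    refine tangent_ext ?_ ?_
    · change (r (0, c 0)).2 = x₀
      rw [hc0, hr0]
    · have h3 := modelDeriv_snd_comp hrk
      refine (DFunLike.congr_fun h3 1).trans ((congrArg Prod.snd hdk1).trans ?_)
      change _ + _ = components Γ x₀
      rw [eq_neg_of_add_eq_zero_left h2, neg_add_eq_sub, h.fiberDeriv_sub]

end Integrator

section FiberScaling

variable {E : Type*} [NormedAddCommGroup E] [NormedSpace ℝ E]
  {H : Type*} [TopologicalSpace H] {I : ModelWithCorners ℝ E H}
  {M : Type*} [TopologicalSpace M] [ChartedSpace H M]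

/-- Multiplication by `h` in the fibres of `TM`. -/
def fiberScaling (I : ModelWithCorners ℝ E H) {M : Type*} [TopologicalSpace M] [ChartedSpace H M]
    (h : ℝ) (v : TangentBundle I M) : TangentBundle I M :=
  ⟨v.proj, h • vec v⟩

lemma fiberScaling_fiberScaling (h k : ℝ) (v : TangentBundle I M) :
    fiberScaling I h (fiberScaling I k v) = fiberScaling I (h * k) v :=
  tangent_ext rfl (smul_smul h k (vec v))

lemma fiberScaling_one (v : TangentBundle I M) : fiberScaling I 1 v = v :=
  tangent_ext rfl (one_smul ℝ (vec v))

variable [IsManifold I ∞ M]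

lemma contMDiff_fiberScaling (h : ℝ) :
    ContMDiff I.tangent I.tangent ∞ (fiberScaling I h (M := M)) := by
  intro v₀
  have h1 := (contMDiffAt_tangentBundle (I := I) (n := ∞)
    (f := (id : TangentBundle I M → _)) (x₀ := v₀)).1 contMDiffAt_id
  refine contMDiffAt_tangentBundle.2 ⟨h1.1, ?_⟩
  have h2 : ContMDiffAt I.tangent 𝓘(ℝ, E) ∞
      (fun v : TangentBundle I M => h • toChart I v₀.proj v.proj (vec v)) v₀ :=
    (contMDiffAt_const : ContMDiffAt I.tangent 𝓘(ℝ, ℝ) ∞ (fun _ : TangentBundle I M => h) v₀).smul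
      h1.2
  refine h2.congr_of_eventuallyEq (Eventually.of_forall fun v => ?_)
  exact (toChart I v₀.proj v.proj).map_smul h (vec v)

variable [I.Boundaryless]

lemma modelDeriv_fiberScaling (h : ℝ) (v : TangentBundle I M) (Z : E × E) :
    modelDeriv I.tangent I.tangent (fiberScaling I h) v Z = (Z.1, h • Z.2) := by
  have h1 := toChart_comp_modelDeriv
    ((contMDiff_fiberScaling (I := I) h v).mdifferentiableAt (by simp))
    (mem_chart_source (ModelProd H E) v) (mem_chart_source (ModelProd H E) (fiberScaling I h v))
  rw [toChart_self, ofChart_self, ContinuousLinearMap.comp_id, ContinuousLinearMap.id_comp] at h1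
  rw [← h1]
  have h2 : HasFDerivAt (fun y : E × E => (y.1, h • y.2))
      ((ContinuousLinearMap.fst ℝ E E).prod (h • ContinuousLinearMap.snd ℝ E E))
      (extChartAt I.tangent v v) := hasFDerivAt_fst.prodMk (hasFDerivAt_snd.const_smul h)
  refine DFunLike.congr_fun ((Filter.EventuallyEq.fderiv_eq ?_).trans h2.fderiv) Z
  filter_upwards [extChartAt_target_mem_nhds (I := I.tangent) v] with y hy
  have h3 : extChartAt I.tangent v ((extChartAt I.tangent v).symm y) = y :=
    (extChartAt I.tangent v).right_inv hy
  conv_rhs => rw [← h3]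
  exact Prod.ext rfl ((toChart I _ _).map_smul h _)

end FiberScaling

section Symplecticity

variable {E : Type*} [NormedAddCommGroup E] [NormedSpace ℝ E]
  {H : Type*} [TopologicalSpace H] {I : ModelWithCorners ℝ E H}
  {M : Type*} [TopologicalSpace M] [ChartedSpace H M] [IsManifold I ∞ M]
  {U : Set (TangentBundle I M)} {Rd : TangentBundle I M → M × M}
  {L : TangentBundle I M → ℝ} {W : Set (TangentBundle I.tangent (TangentBundle I M))}
  {R : TangentBundle I.tangent (TangentBundle I M) → TangentBundle I M × TangentBundle I M}
  {Γ : ∀ v : TangentBundle I M, TangentSpace I.tangent v} {h : ℝ}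

lemma IsLagrangianLift.schemeStep (hR : IsLagrangianLift I L U Rd W R)
    {x₀ x₁ y : TangentBundle I M} (hs : SchemeStep I.tangent Γ W R h x₀ x₁ y) :
    legendreLift L Γ h y ∈ cotangentDiscretizationDomain I U Rd ∧
    cotangentDiscretization I Rd (legendreLift L Γ h y) = (legendre I L x₀, legendre I L x₁) := by
  refine ⟨hR.mem_domain _ hs.1, ?_⟩
  obtain ⟨σ, h1, h2, h3⟩ := hR.eq_comp _ hs.1
  obtain ⟨h4, h5, h6⟩ := h3.self_of_nhds
  rw [hs.2] at h6
  obtain ⟨h7, h8⟩ := Prod.ext_iff.1 h6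
  simp only at h7 h8
  refine Prod.ext ?_ ?_
  · simp only [h7]
    rw [← h2 (σ.map_target h4), σ.right_inv h4]
    rfl
  · simp only [h8]
    rw [← h2 (σ.map_target h5), σ.right_inv h5]
    rfl

variable [I.Boundaryless]

/-- The discrete Euler-Lagrange relations of the scheme. -/
lemma IsLagrangianLift.pairing (hL : IsRegularLagrangian I L)
    (hR : IsLagrangianLift I L U Rd W R) (hΓ : IsEulerLagrangeField I L Γ)
    {x₀ x₁ y : TangentBundle I M} (hs : SchemeStep I.tangent Γ W R h x₀ x₁ y) :
    fiberScaling I h y ∈ U ∧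
    (modelDeriv I.tangent (I.prod I) Rd (fiberScaling I h y)).IsInvertible ∧
    Rd (fiberScaling I h y) = (x₀.proj, x₁.proj) ∧
    ∀ Z : E × E, covec (legendre I L x₁)
        (modelDeriv I.tangent (I.prod I) Rd (fiberScaling I h y) Z).2 -
      covec (legendre I L x₀) (modelDeriv I.tangent (I.prod I) Rd (fiberScaling I h y) Z).1 =
      modelDeriv I.tangent 𝓘(ℝ, ℝ) L y (h • Z.1, Z.2) := by
  obtain ⟨h1, h2⟩ := hR.schemeStep hs
  have hp : (tulczyjew I (legendreLift L Γ h y)).proj = fiberScaling I h y :=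
    tulczyjew_legendreLift_proj hL hΓ h y
  obtain ⟨h3, h4⟩ := mem_cotangentDiscretizationDomain.1 h1
  have h5 := cotangentDiscretization_pairing h4
  have h6 := cotangentDiscretization_fst_proj (R := Rd) (legendreLift L Γ h y)
  have h7 := cotangentDiscretization_snd_proj (R := Rd) (legendreLift L Γ h y)
  rw [h2, hp] at h5 h6 h7
  rw [hp] at h3 h4
  exact ⟨h3, h4, Prod.ext h6.symm h7.symm, fun Z =>
    (h5 Z).trans (covec_tulczyjew_legendreLift hL hΓ h y Z)⟩

/-- For `h ≠ 0`, the auxiliary point of the scheme depends smoothly on the initial point. -/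
lemma IsLagrangianLift.contMDiffAt_auxiliary [CompleteSpace E] (hRd : IsDiscretizationMap I U Rd)
    (hL : IsRegularLagrangian I L) (hR : IsLagrangianLift I L U Rd W R)
    (hΓ : IsEulerLagrangeField I L Γ) (hh : h ≠ 0) {V : Set (TangentBundle I M)}
    {φ Y : TangentBundle I M → TangentBundle I M} (hV : IsOpen V)
    (hφ : ContMDiffOn I.tangent I.tangent ∞ φ V) (hY : ContinuousOn Y V)
    (hs : ∀ x₀ ∈ V, SchemeStep I.tangent Γ W R h x₀ (φ x₀) (Y x₀)) {x : TangentBundle I M}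
    (hx : x ∈ V) : ContMDiffAt I.tangent I.tangent ∞ Y x := by
  obtain ⟨h1, h2, h3, -⟩ := hR.pairing hL hΓ (hs x hx)
  obtain ⟨τ, h4, h5, h6, h7⟩ := exists_localInverse hRd.isOpen h1 hRd.smooth h2
  have hpr : ContMDiff I.tangent I ∞ (TotalSpace.proj : TangentBundle I M → M) :=
    contMDiff_proj (TangentSpace I)
  have hη : ContinuousAt (fun x => fiberScaling I h (Y x)) x :=
    ((contMDiff_fiberScaling h).continuous.continuousAt).comp (hY.continuousAt (hV.mem_nhds hx))
  have hb : ContMDiffAt I.tangent (I.prod I) ∞ (fun x => (x.proj, (φ x).proj)) x :=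
    (hpr x).prodMk ((hpr (φ x)).comp x (hφ.contMDiffAt (hV.mem_nhds hx)))
  have ht : (x.proj, (φ x).proj) ∈ τ.target := by
    rw [← h3, ← h6 h4]
    exact τ.map_source h4
  have hτ : ContMDiffAt I.tangent I.tangent ∞ (fun x => τ.symm (x.proj, (φ x).proj)) x :=
    ContMDiffAt.comp (I' := I.prod I) x (h7.contMDiffAt (τ.open_target.mem_nhds ht)) hb
  refine ((contMDiff_fiberScaling (I := I) h⁻¹ _).comp x hτ).congr_of_eventuallyEq ?_
  filter_upwards [hV.mem_nhds hx, hη.eventually (τ.open_source.eventually_mem h4)] with x' hx' hx''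
  obtain ⟨-, -, h8, -⟩ := hR.pairing hL hΓ (hs x' hx')
  rw [Function.comp_apply, ← h8, ← h6 hx'', τ.left_inv hx'', fiberScaling_fiberScaling,
    inv_mul_cancel₀ hh, fiberScaling_one]

/-- The one-step map of the scheme pulls back the Liouville form to itself up to an exact form. -/
lemma IsLagrangianLift.pulledLiouville_sub (hRd : IsDiscretizationMap I U Rd)
    (hL : IsRegularLagrangian I L) (hR : IsLagrangianLift I L U Rd W R)
    (hΓ : IsEulerLagrangeField I L Γ) {F : Type*} [NormedAddCommGroup F] [NormedSpace ℝ F]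
    {a b Y : F → TangentBundle I M} {y₀ : F}
    (hY : MDifferentiableAt 𝓘(ℝ, F) I.tangent Y y₀)
    (hs : ∀ᶠ y in 𝓝 y₀, SchemeStep I.tangent Γ W R h (a y) (b y) (Y y)) :
    pulledLiouville (fun y => legendre I L (b y)) y₀ -
      pulledLiouville (fun y => legendre I L (a y)) y₀ =
      fderiv ℝ (fun y => h * L (Y y)) y₀ := by
  obtain ⟨h1, h2, h3, h4⟩ := hR.pairing hL hΓ hs.self_of_nhds
  have hsc := (contMDiff_fiberScaling (I := I) h (Y y₀)).mdifferentiableAt (by simp)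
  have hη : MDifferentiableAt 𝓘(ℝ, F) I.tangent (fun y => fiberScaling I h (Y y)) y₀ :=
    hsc.comp y₀ hY
  have hRdd := (hRd.contMDiffAt h1).mdifferentiableAt (by simp)
  have hRη : MDifferentiableAt 𝓘(ℝ, F) (I.prod I) (Rd ∘ fun y => fiberScaling I h (Y y)) y₀ :=
    hRdd.comp y₀ hη
  have ha : (fun y => (legendre I L (a y)).proj) =ᶠ[𝓝 y₀]
      fun y => ((Rd ∘ fun y => fiberScaling I h (Y y)) y).1 := by
    filter_upwards [hs] with y hy
    exact (congrArg Prod.fst (hR.pairing hL hΓ hy).2.2.1).symm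
  have hb : (fun y => (legendre I L (b y)).proj) =ᶠ[𝓝 y₀]
      fun y => ((Rd ∘ fun y => fiberScaling I h (Y y)) y).2 := by
    filter_upwards [hs] with y hy
    exact (congrArg Prod.snd (hR.pairing hL hΓ hy).2.2.1).symm
  have hdη : modelDeriv 𝓘(ℝ, F) I.tangent (fun y => fiberScaling I h (Y y)) y₀ = _ :=
    modelDeriv_comp (I := 𝓘(ℝ, F)) (g := fiberScaling I h) (f := Y) hsc hY
  have hdR := modelDeriv_comp (I := 𝓘(ℝ, F)) (g := Rd) (f := fun y => fiberScaling I h (Y y))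
    hRdd hη
  have hLd := (hL.smooth (Y y₀)).mdifferentiableAt (by simp)
  have hdL : fderiv ℝ (fun y => L (Y y)) y₀ = _ :=
    (modelDeriv_eq_fderiv (fun y => L (Y y)) y₀).symm.trans
      (modelDeriv_comp (I := 𝓘(ℝ, F)) (g := L) (f := Y) hLd hY)
  have hLY : DifferentiableAt ℝ (fun y => L (Y y)) y₀ := (hLd.comp y₀ hY).differentiableAt
  refine ContinuousLinearMap.ext fun u => ?_
  rw [fderiv_const_mul hLY, hdL]
  change covec (legendre I L (b y₀)) (modelDeriv _ _ _ y₀ u) -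
    covec (legendre I L (a y₀)) (modelDeriv _ _ _ y₀ u) = _
  rw [modelDeriv_congr ha, modelDeriv_congr hb, modelDeriv_fst_comp hRη, modelDeriv_snd_comp hRη,
    hdR]
  refine (h4 (modelDeriv 𝓘(ℝ, F) I.tangent (fun y => fiberScaling I h (Y y)) y₀ u)).trans ?_
  rw [hdη, ContinuousLinearMap.comp_apply, modelDeriv_fiberScaling, ← Prod.smul_mk, map_smul]
  rfl

/-- The scheme is symplectic. -/
theorem IsLagrangianLift.isSymplecticScheme [FiniteDimensional ℝ E]
    (hRd : IsDiscretizationMap I U Rd)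
    (hL : IsRegularLagrangian I L) (hR : IsLagrangianLift I L U Rd W R)
    (hΓ : IsEulerLagrangeField I L Γ) :
    IsSymplecticScheme I.tangent (lagrangeForm I L) Γ W R := by
  have := FiniteDimensional.complete ℝ E
  intro h V φ Y hV hφ hY hs x hx u w
  have hFL := contMDiff_legendre hL.smooth
  have hFd : ∀ v, MDifferentiableAt I.tangent (cotangentModel I) (legendre I L) v :=
    fun v => (hFL v).mdifferentiableAt (by simp)
  have hφx := hφ.contMDiffAt (hV.mem_nhds hx)
  set Dφ : E × E →L[ℝ] E × E := modelDeriv I.tangent I.tangent φ x with hDφ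
  have goal : ∀ u w : E × E, canonicalForm I (legendre I L (φ x))
      (modelDeriv I.tangent (cotangentModel I) (legendre I L) (φ x) (Dφ u))
      (modelDeriv I.tangent (cotangentModel I) (legendre I L) (φ x) (Dφ w)) =
      canonicalForm I (legendre I L x)
        (modelDeriv I.tangent (cotangentModel I) (legendre I L) x u)
        (modelDeriv I.tangent (cotangentModel I) (legendre I L) x w) := by
    clear u w
    intro u w
    rcases eq_or_ne h 0 with rfl | hh
    · have hid : φ =ᶠ[𝓝 x] id := by
        filter_upwards [hV.mem_nhds hx] with x' hx'
        have h1 := (hs x' hx').2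
        have h2 : (⟨Y x', (0 : ℝ) • Γ (Y x')⟩ : TangentBundle I.tangent (TangentBundle I M)) =
          ⟨Y x', 0⟩ := tangent_ext rfl (zero_smul ℝ (components Γ (Y x')))
        rw [h2, (hR.isDiscretizationMap hRd hL).map_zero] at h1
        obtain ⟨h3, h4⟩ := Prod.ext_iff.1 h1
        exact h4.symm.trans h3
      have hD : Dφ = ContinuousLinearMap.id ℝ (E × E) :=
        (modelDeriv_congr hid).trans (modelDeriv_id x)
      rw [hD, hid.self_of_nhds]
      rfl
    · set c := extChartAt I.tangent x with hc
      set y₀ := c x with hy₀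
      have hcx : c.symm y₀ = x := extChartAt_to_inv x
      have hcs : ContMDiffAt 𝓘(ℝ, E × E) I.tangent ∞ c.symm y₀ :=
        (contMDiffOn_extChartAt_symm x).contMDiffAt (extChartAt_target_mem_nhds x)
      have hcd : modelDeriv 𝓘(ℝ, E × E) I.tangent c.symm y₀ = ContinuousLinearMap.id ℝ (E × E) := by
        have := modelDeriv_extChartAt_symm' (I := I.tangent) (mem_chart_source (ModelProd H E) x)
        rwa [ofChart_self] at this
      have hVc : ∀ᶠ y in 𝓝 y₀, c.symm y ∈ V :=
        hcs.continuousAt.eventually (hV.eventually_mem (by rw [hcx]; exact hx))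
      have hYx := hR.contMDiffAt_auxiliary hRd hL hΓ hh hV hφ hY hs hx
      have hYc : ContMDiffAt 𝓘(ℝ, E × E) I.tangent ∞ (fun y => Y (c.symm y)) y₀ :=
        ContMDiffAt.comp_of_eq hYx hcs hcx
      have hg₀ : ContMDiffAt 𝓘(ℝ, E × E) (cotangentModel I) ∞ (fun y => legendre I L (c.symm y))
        y₀ := ContMDiffAt.comp (I' := I.tangent) y₀ (hFL _) hcs
      have hφc : ContMDiffAt 𝓘(ℝ, E × E) I.tangent ∞ (fun y => φ (c.symm y)) y₀ :=
        ContMDiffAt.comp_of_eq hφx hcs hcx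
      have hg₁ : ContMDiffAt 𝓘(ℝ, E × E) (cotangentModel I) ∞ (fun y => legendre I L (φ (c.symm y)))
        y₀ := ContMDiffAt.comp (I' := I.tangent) y₀ (hFL _) hφc
      have hSs : ContDiffAt ℝ ∞ (fun y => h * L (Y (c.symm y))) y₀ :=
        contDiffAt_const.mul (ContMDiffAt.contDiffAt
          (ContMDiffAt.comp (I' := I.tangent) y₀ (hL.smooth _) hYc))
      obtain ⟨hd₀, hp₀⟩ := canonicalForm_pullback hg₀
      obtain ⟨hd₁, hp₁⟩ := canonicalForm_pullback hg₁
      have hexact : pulledLiouville (fun y => legendre I L (φ (c.symm y))) =ᶠ[𝓝 y₀] fun y =>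
          pulledLiouville (fun y => legendre I L (c.symm y)) y +
            fderiv ℝ (fun y => h * L (Y (c.symm y))) y := by
        have hYd : ∀ᶠ y in 𝓝 y₀, ContMDiffAt 𝓘(ℝ, E × E) I.tangent 1 (fun y => Y (c.symm y)) y :=
          (contMDiffAt_iff_contMDiffAt_nhds (n := 1) (by simp)).1 (hYc.of_le (by simp))
        filter_upwards [hVc.eventually_nhds, hYd] with y hy hy'
        rw [← hR.pulledLiouville_sub hRd hL hΓ (a := fun y => c.symm y)
          (b := fun y => φ (c.symm y)) (hy'.mdifferentiableAt one_ne_zero)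
          (hy.mono fun y hy => hs _ hy), add_sub_cancel]
      have hdS := (hSs.fderiv_right (m := ∞) le_rfl).differentiableAt (by simp)
      have hsym := (hSs.isSymmSndFDerivAt
        (by simpa using WithTop.coe_le_coe.2 (le_top : (2 : ℕ∞) ≤ ⊤))) w u
      have hD₁ : modelDeriv 𝓘(ℝ, E × E) (cotangentModel I)
          (fun y => legendre I L (φ (c.symm y))) y₀ = _ := modelDeriv_comp_of_eq (I := 𝓘(ℝ, E × E)) (g := fun v => legendre I L (φ v))
        (f := c.symm) ((hFd _).comp x (hφx.mdifferentiableAt (by simp)))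
        (hcs.mdifferentiableAt (by simp)) hcx
      have hD₁' : modelDeriv I.tangent (cotangentModel I) (fun v => legendre I L (φ v)) x = _ :=
        modelDeriv_comp (I := I.tangent) (hFd (φ x)) (hφx.mdifferentiableAt (by simp))
      have hD₀ : modelDeriv 𝓘(ℝ, E × E) (cotangentModel I)
          (fun y => legendre I L (c.symm y)) y₀ = _ := modelDeriv_comp_of_eq (I := 𝓘(ℝ, E × E)) (g := legendre I L)
        (f := c.symm) (hFd x) (hcs.mdifferentiableAt (by simp)) hcx
      rw [hcd, ContinuousLinearMap.comp_id] at hD₀ hD₁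
      have e₁ := hp₁ u w
      have e₀ := hp₀ u w
      rw [hexact.fderiv_eq, fderiv_fun_add hd₀ hdS] at e₁
      rw [add_apply, add_apply, add_apply, add_apply, hsym, add_sub_add_right_eq_sub, ← e₀] at e₁
      rw [hD₁, hD₁', hD₀, hcx] at e₁
      exact e₁
  exact goal u w

end Symplecticity

section Topology

/-- The local inverses of a local homeomorphism `f` glue to a map `s` defined near the graph of `f`,
such that `s (x, ·)` inverts `f` near `x`. -/
theorem _root_.IsLocalHomeomorph.exists_inverse_near_graph {X Y : Type*} [TopologicalSpace X]
    [TopologicalSpace.MetrizableSpace X] [TopologicalSpace Y] {f : X → Y}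
    (hf : IsLocalHomeomorph f) :
    ∃ (G : Set (X × Y)) (s : X × Y → X), IsOpen G ∧ (∀ x, (x, f x) ∈ G) ∧
      ∀ x α β, (x, α) ∈ G → (x, β) ∈ G → ∃ σ : OpenPartialHomeomorph X Y,
        x ∈ σ.source ∧ EqOn σ f σ.source ∧
        (∀ᶠ p in 𝓝 (x, α), p.2 ∈ σ.target ∧ s p = σ.symm p.2) ∧
        ∀ᶠ p in 𝓝 (x, β), p.2 ∈ σ.target ∧ s p = σ.symm p.2 := by
  classical
  let _ := TopologicalSpace.metrizableSpaceMetric X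
  set P : X × Y → ℝ → X → Prop := fun p ρ x' =>
    InjOn f (Metric.ball p.1 ρ) ∧ x' ∈ Metric.ball p.1 ρ ∧ f x' = p.2 with hP
  have huniq : ∀ {p ρ ρ' x' x''}, P p ρ x' → P p ρ' x'' → x' = x'' := by
    rintro p ρ ρ' x' x'' ⟨h1, h2, h3⟩ ⟨h4, h5, h6⟩
    rcases le_total ρ ρ' with h | h
    · exact h4 (Metric.ball_subset_ball h h2) h5 (h3.trans h6.symm)
    · exact h1 h2 (Metric.ball_subset_ball h h5) (h3.trans h6.symm)
  set s : X × Y → X := fun p => if h : ∃ x' ρ, P p ρ x' then h.choose else p.1 with hs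
  have hsP : ∀ {p ρ x'}, P p ρ x' → s p = x' := by
    intro p ρ x' h
    have hex : ∃ x' ρ, P p ρ x' := ⟨x', ρ, h⟩
    rw [hs]
    simp only [dif_pos hex]
    exact huniq hex.choose_spec.choose_spec h
  -- the solutions near a given one
  have hev : ∀ {x α ρ x'}, P (x, α) ρ x' → ∀ᶠ p in 𝓝 (x, α), ∃ ρ' x'', P p ρ' x'' ∧
      x'' ∈ Metric.ball x ρ := by
    rintro x α ρ x' ⟨h1, h2, h3⟩
    simp only at h1 h2 h3
    obtain ⟨δ, hδ, hd⟩ : ∃ δ > 0, dist x' x < ρ - 2 * δ :=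
      ⟨(ρ - dist x' x) / 4, by linarith [Metric.mem_ball.1 h2], by
        linarith [Metric.mem_ball.1 h2]⟩
    have h4 : f '' Metric.ball x (ρ - 2 * δ) ∈ 𝓝 α :=
      (hf.isOpenMap _ Metric.isOpen_ball).mem_nhds ⟨x', hd, h3⟩
    filter_upwards [prod_mem_nhds (Metric.ball_mem_nhds x hδ) h4]
    rintro ⟨u, α'⟩ ⟨hu, x'', hx'', rfl⟩
    have hu' : dist u x < δ := hu
    have h5 : dist x'' x < ρ - 2 * δ := hx''
    refine ⟨ρ - δ, x'', ⟨h1.mono fun y hy => ?_, ?_, rfl⟩, ?_⟩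
    · have := Metric.mem_ball.1 hy
      have := dist_triangle y u x
      rw [Metric.mem_ball]
      linarith
    · have := dist_triangle x'' x u
      rw [dist_comm x u] at this
      rw [Metric.mem_ball]
      linarith
    · rw [Metric.mem_ball]
      linarith
  refine ⟨{p | ∃ x' ρ, P p ρ x'}, s, ?_, ?_, ?_⟩
  · refine isOpen_iff_mem_nhds.2 ?_
    rintro ⟨x, α⟩ ⟨x', ρ, h⟩
    filter_upwards [hev h] with p hp
    obtain ⟨ρ', x'', hp', -⟩ := hp
    exact ⟨x'', ρ', hp'⟩
  · intro x
    obtain ⟨e, he, rfl⟩ := hf x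
    obtain ⟨ρ, hρ, hb⟩ := Metric.isOpen_iff.1 e.open_source x he
    exact ⟨x, ρ, e.injOn.mono hb, Metric.mem_ball_self hρ, rfl⟩
  · rintro x α β ⟨x₁, ρ₁, h₁⟩ ⟨x₂, ρ₂, h₂⟩
    obtain ⟨ρ, hρ, hρ₁, hρ₂⟩ : ∃ ρ, InjOn f (Metric.ball x ρ) ∧ ρ₁ ≤ ρ ∧ ρ₂ ≤ ρ := by
      rcases le_total ρ₁ ρ₂ with h | h
      · exact ⟨ρ₂, h₂.1, h, le_rfl⟩
      · exact ⟨ρ₁, h₁.1, le_rfl, h⟩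
    have : Nonempty X := ⟨x⟩
    set σ := OpenPartialHomeomorph.ofContinuousOpen (InjOn.toPartialEquiv f _ hρ)
      hf.continuous.continuousOn hf.isOpenMap Metric.isOpen_ball with hσ
    have hσf : ⇑σ = f := rfl
    have hσs : σ.source = Metric.ball x ρ := rfl
    have hmain : ∀ {γ ρ' x'}, ρ' ≤ ρ → P (x, γ) ρ' x' →
        ∀ᶠ p in 𝓝 (x, γ), p.2 ∈ σ.target ∧ s p = σ.symm p.2 := by
      intro γ ρ' x' hle h
      filter_upwards [hev h] with p hp
      obtain ⟨ρ'', x'', hp', hx''⟩ := hp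
      have h1 : x'' ∈ σ.source := Metric.ball_subset_ball hle hx''
      have h2 : σ x'' = p.2 := hp'.2.2
      exact ⟨h2 ▸ σ.map_source h1, by rw [hsP hp', ← h2, σ.left_inv h1]⟩
    exact ⟨σ, Metric.mem_ball_self (lt_of_lt_of_le (Metric.pos_of_mem_ball h₁.2.1) hρ₁),
      fun _ _ => rfl, hmain hρ₁ h₁, hmain hρ₂ h₂⟩

lemma t2Space_totalSpace {B F : Type*} [TopologicalSpace B] [TopologicalSpace F] (E : B → Type*)
    [TopologicalSpace (TotalSpace F E)] [∀ b, TopologicalSpace (E b)] [FiberBundle F E]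
    [T2Space B] [T2Space F] : T2Space (TotalSpace F E) := by
  refine ⟨fun v w hvw => ?_⟩
  by_cases h : v.proj = w.proj
  · set e := trivializationAt F E v.proj with he
    have hv : v ∈ e.source := FiberBundle.mem_trivializationAt_proj_source
    have hw : w ∈ e.source := by
      rw [e.mem_source, ← h]
      exact FiberBundle.mem_baseSet_trivializationAt F E v.proj
    have hne : e v ≠ e w := fun hc => hvw (e.injOn hv hw hc)
    obtain ⟨A, B', hA, hB, hvA, hwB, hAB⟩ := t2_separation hne
    refine ⟨e.source ∩ e ⁻¹' A, e.source ∩ e ⁻¹' B',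
      e.toOpenPartialHomeomorph.isOpen_inter_preimage hA,
      e.toOpenPartialHomeomorph.isOpen_inter_preimage hB, ⟨hv, hvA⟩, ⟨hw, hwB⟩, ?_⟩
    exact (hAB.preimage e).mono inter_subset_right inter_subset_right
  · obtain ⟨A, B', hA, hB, hvA, hwB, hAB⟩ := t2_separation h
    have hc := FiberBundle.continuous_proj F E
    exact ⟨_, _, hA.preimage hc, hB.preimage hc, hvA, hwB, hAB.preimage _⟩

variable {E : Type*} [NormedAddCommGroup E] [NormedSpace ℝ E] [FiniteDimensional ℝ E]
  {H : Type*} [TopologicalSpace H] (I : ModelWithCorners ℝ E H)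
  (M : Type*) [TopologicalSpace M] [ChartedSpace H M] [IsManifold I ∞ M]
  [T2Space M] [SecondCountableTopology M]

lemma metrizableSpace_tangentBundle :
    TopologicalSpace.MetrizableSpace (TangentBundle I M) := by
  have h1 : T2Space (TangentBundle I M) := t2Space_totalSpace (TangentSpace I)
  have h2 : LocallyCompactSpace (TangentBundle I M) :=
    Manifold.locallyCompact_of_finiteDimensional I.tangent
  have := FiniteDimensional.proper ℝ E
  have h3 : SecondCountableTopology H := I.secondCountableTopology
  have h4 : SecondCountableTopology (ModelProd H E) :=
    inferInstanceAs (SecondCountableTopology (H × E))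
  obtain ⟨s, hs, hsU⟩ := TopologicalSpace.countable_cover_nhds
    (fun q : M => chart_source_mem_nhds H q)
  have h5 : SecondCountableTopology (TangentBundle I M) := by
    refine ChartedSpace.secondCountable_of_countable_cover (ModelProd H E)
      (s := (fun q : M => (⟨q, 0⟩ : TangentBundle I M)) '' s) ?_ (hs.image _)
    refine eq_univ_of_forall fun v => ?_
    obtain ⟨q, hq, hqv⟩ := mem_iUnion₂.1 (hsU.symm ▸ mem_univ v.proj : v.proj ∈ ⋃ x ∈ s, _)
    exact mem_iUnion₂.2 ⟨_, mem_image_of_mem _ hq, mem_chart_tangentBundle.2 hqv⟩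
  infer_instance

end Topology

section Existence

variable {E : Type*} [NormedAddCommGroup E] [NormedSpace ℝ E] [FiniteDimensional ℝ E]
  {H : Type*} [TopologicalSpace H] {I : ModelWithCorners ℝ E H} [I.Boundaryless]
  {M : Type*} [TopologicalSpace M] [ChartedSpace H M] [IsManifold I ∞ M]
  {U : Set (TangentBundle I M)} {Rd : TangentBundle I M → M × M} {L : TangentBundle I M → ℝ}

lemma isLocalHomeomorph_legendre (hL : IsRegularLagrangian I L) :
    IsLocalHomeomorph (legendre I L) := by
  have := FiniteDimensional.complete ℝ E
  refine IsLocalHomeomorph.mk _ fun v => ?_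
  obtain ⟨σ, h1, -, h2, -⟩ := exists_localInverse isOpen_univ (mem_univ v)
    (contMDiff_legendre hL.smooth).contMDiffOn (isInvertible_modelDeriv_legendre hL v)
  exact ⟨σ, h1, h2.symm⟩

theorem exists_isLagrangianLift [T2Space M] [SecondCountableTopology M]
    (hRd : IsDiscretizationMap I U Rd) (hL : IsRegularLagrangian I L) :
    ∃ W R, IsLagrangianLift I L U Rd W R := by
  have := metrizableSpace_tangentBundle I M
  obtain ⟨G, s, hG, hG0, hs⟩ := (isLocalHomeomorph_legendre hL).exists_inverse_near_graph
  have hZ := isDiscretizationMap_cotangentDiscretization hRd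
  set T := tangentMap I.tangent (cotangentModel I) (legendre I L) with hT
  have hTc : Continuous T :=
    ((contMDiff_legendre hL.smooth).contMDiff_tangentMap (m := ∞) le_rfl).continuous
  have hT0 : ∀ v : TangentBundle I M, T ⟨v, 0⟩ = ⟨legendre I L v, 0⟩ := fun v =>
    tangent_ext rfl (map_zero (modelDeriv I.tangent (cotangentModel I) (legendre I L) v))
  set z := fun w => cotangentDiscretization I Rd (T w) with hz
  set D := cotangentDiscretizationDomain I U Rd with hD
  have hzc : ∀ w, T w ∈ D → ContinuousAt z w := fun w hw =>
    (hZ.contMDiffAt hw).continuousAt.comp hTc.continuousAt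
  have hpc : Continuous (TotalSpace.proj :
      TangentBundle I.tangent (TangentBundle I M) → TangentBundle I M) :=
    FiberBundle.continuous_proj _ _
  have hc₁ : ∀ w, T w ∈ D → ContinuousAt (fun w => (w.proj, (z w).1)) w := fun w hw =>
    hpc.continuousAt.prodMk (hzc w hw).fst
  have hc₂ : ∀ w, T w ∈ D → ContinuousAt (fun w => (w.proj, (z w).2)) w := fun w hw =>
    hpc.continuousAt.prodMk (hzc w hw).snd
  refine ⟨{w | T w ∈ D ∧ (w.proj, (z w).1) ∈ G ∧ (w.proj, (z w).2) ∈ G},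
    fun w => (s (w.proj, (z w).1), s (w.proj, (z w).2)), ?_, ?_, fun w hw => hw.1, ?_⟩
  · refine isOpen_iff_mem_nhds.2 fun w hw => ?_
    filter_upwards [hTc.continuousAt.eventually (hZ.isOpen.eventually_mem hw.1),
      (hc₁ w hw.1).eventually (hG.eventually_mem hw.2.1),
      (hc₂ w hw.1).eventually (hG.eventually_mem hw.2.2)] with w' h1 h2 h3
    exact ⟨h1, h2, h3⟩
  · intro v
    have hz0 : z ⟨v, 0⟩ = (legendre I L v, legendre I L v) := by
      simp only [hz, hT0]
      exact hZ.map_zero _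
    refine ⟨?_, ?_, ?_⟩
    · rw [hT0]
      exact hZ.zero_mem _
    · rw [hz0]
      exact hG0 v
    · rw [hz0]
      exact hG0 v
  · intro w hw
    obtain ⟨σ, h1, h2, h3, h4⟩ := hs w.proj (z w).1 (z w).2 hw.2.1 hw.2.2
    refine ⟨σ, h1, h2, ?_⟩
    filter_upwards [(hc₁ w hw.1).eventually h3, (hc₂ w hw.1).eventually h4] with w' h5 h6
    exact ⟨h5.1, h6.1, Prod.ext h5.2 h6.2⟩

end Existence

end DiscMap

end

theorem mainTheorem5 {E : Type*} [NormedAddCommGroup E] [NormedSpace ℝ E] [FiniteDimensional ℝ E]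
    {Q : Type*} [TopologicalSpace Q] [ChartedSpace E Q] [IsManifold 𝓘(ℝ, E) ∞ Q]
    [T2Space Q] [SecondCountableTopology Q]
    (U : Set (TangentBundle 𝓘(ℝ, E) Q)) (Rd : TangentBundle 𝓘(ℝ, E) Q → Q × Q)
    (hRd : DiscMap.IsDiscretizationMap 𝓘(ℝ, E) U Rd)
    (L : TangentBundle 𝓘(ℝ, E) Q → ℝ) (hL : DiscMap.IsRegularLagrangian 𝓘(ℝ, E) L) :
    (∃! Γ, DiscMap.IsEulerLagrangeField 𝓘(ℝ, E) L Γ) ∧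
    (∃ W R, DiscMap.IsLagrangianLift 𝓘(ℝ, E) L U Rd W R) ∧
    ∀ W R, DiscMap.IsLagrangianLift 𝓘(ℝ, E) L U Rd W R →
      (∀ Γ, DiscMap.IsEulerLagrangeField 𝓘(ℝ, E) L Γ →
        DiscMap.IsIntegrator 𝓘(ℝ, E).tangent Γ W R ∧
        DiscMap.IsSymplecticScheme 𝓘(ℝ, E).tangent (DiscMap.lagrangeForm 𝓘(ℝ, E) L) Γ W R) ∧
      DiscMap.IsDiscretizationMap 𝓘(ℝ, E).tangent W R :=
  ⟨DiscMap.existsUnique_eulerLagrangeField hL, DiscMap.exists_isLagrangianLift hRd hL,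
    fun _ _ hR => ⟨fun _ hΓ =>
      ⟨(hR.isDiscretizationMap hRd hL).isIntegrator (DiscMap.contMDiff_eulerLagrangeField hL hΓ),
        hR.isSymplecticScheme hRd hL hΓ⟩, hR.isDiscretizationMap hRd hL⟩⟩
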